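/- Let $\mathcal A$ be the heart of a t-structure $(\mathcal D^{\le 0},\mathcal D^{\ge 0})$ on a triangulated category $\mathcal T$, let $H:\mathcal T\to\mathcal A$, $H(X)=\tau^{\ge 0}\tau^{\le 0}X$, be the associated homological functor, and put $H^n(X)=H(X[n])$. Assume that there is an exact (triangulated) functor $G:D^b(\mathcal A)\to\mathcal T$ extending the identity on $\mathcal A$, i.e. equipped with a natural isomorphism from its restriction to $\mathcal A$ (complexes concentrated in degree $0$) to the inclusion $\mathcal A\subseteq\mathcal T$. Let $$0\to A\xrightarrow{a}B\xrightarrow{b}C\xrightarrow{c}D\xrightarrow{d}E\xrightarrow{e}F\to 0\qquad(*)$$ be an exact sequence in $\mathcal A$, and let $K,L,M$ be the images of $b$, $c$, $d$ respectively. Let $$F\xrightarrow{\alpha}M[1]\xrightarrow{\beta}L[2]\xrightarrow{\gamma}K[3]\xrightarrow{\delta}A[4]$$ be the morphisms of $\mathcal T$ given by the (shifted) images under $G$ of the extension classes of the short exact sequences $0\to M\to E\to F\to0$, $0\to L\to D\to M\to0$, $0\to K\to C\to L\to0$ and $0\to A\to B\to K\to0$. For composable morphisms $X\xrightarrow{x}Y\xrightarrow{y}Z\xrightarrow{z}W$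 in a triangulated category, choose a distinguished triangle $Z\xrightarrow{i}V\xrightarrow{p}Y[1]\xrightarrow{y[1]}Z[1]$. The Toda bracket $\langle z,y,x\rangle$ is the set of all morphisms $X[1]\to W$ of the form $f\circ g$ with $g:X[1]\to V$, $f:V\to W$, $p\circ g=x[1]$ and $f\circ i=z$; it does not depend on the choice of the triangle. Then the following are equivalent: 1. there is a distinguished triangle $X\xrightarrow{x}Y\xrightarrow{y}Z\xrightarrow{z}X[1]$ in $\mathcal T$ whose long exact homology sequence is isomorphic to $(*)$, that is, $H^n(X)=H^n(Y)=H^n(Z)=0$ for all $n\ne 0,1$ and the sequence $H^0(X)\to H^0(Y)\to H^0(Z)\to H^1(X)\to H^1(Y)\to H^1(Z)$ induced by the triangle is isomorphic to $A\to B\to C\to D\to E\to F$; 2. $0\in\langle\delta,\gamma\beta,\alpha\rangle$. Moreover, taking $\mathcal T=D^b(\mathcal A)$ with its canonical t-structure and $G=\mathrm{id}$: the sequence $(*)$ comes from the snake lemma, i.e. it is isomorphic to the sequence $0\to\operatorname{Ker}f_1\to\operatorname{Ker}f_2\to\operatorname{Ker}f_3\to\operatorname{Coker}f_1\to\operatorname{Coker}f_2\to\operatorname{Coker}f_3\to0$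 of some morphism $(f_1,f_2,f_3)$ between short exact sequences in $\mathcal A$, if and only if $0\in\langle\delta,\gamma\beta,\alpha\rangle$, where now $\alpha,\beta,\gamma,\delta$ and the Toda bracket are formed in $D^b(\mathcal A)$. -/

import Mathlib

open CategoryTheory Category Limits Pretriangulated Triangulated

universe w v u v' u'

noncomputable section

namespace SnakeToda

/-! ### Exact sequences of length six -/

/-- An exact sequence `0 ⟶ A ⟶ B ⟶ C ⟶ D ⟶ E ⟶ F ⟶ 0` in an abelian category. -/
structure SixTermExact (𝒜 : Type u) [Category.{v} 𝒜] [Abelian 𝒜] where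
  (A B C D E F : 𝒜)
  a : A ⟶ B
  b : B ⟶ C
  c : C ⟶ D
  d : D ⟶ E
  e : E ⟶ F
  ab : a ≫ b = 0
  bc : b ≫ c = 0
  cd : c ≫ d = 0
  de : d ≫ e = 0
  mono_a : Mono a
  exact_B : (ShortComplex.mk a b ab).Exact
  exact_C : (ShortComplex.mk b c bc).Exact
  exact_D : (ShortComplex.mk c d cd).Exact
  exact_E : (ShortComplex.mk d e de).Exact
  epi_e : Epi e

namespace SixTermExact

variable {𝒜 : Type u} [Category.{v} 𝒜] [Abelian 𝒜] (S : SixTermExact 𝒜)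

/-- The underlying diagram `A ⟶ B ⟶ C ⟶ D ⟶ E ⟶ F`. -/
def arrows : ComposableArrows 𝒜 5 := ComposableArrows.mk₅ S.a S.b S.c S.d S.e

/-- The image of `B ⟶ C`. -/
abbrev K : 𝒜 := image S.b

/-- The image of `C ⟶ D`. -/
abbrev L : 𝒜 := image S.c

/-- The image of `D ⟶ E`. -/
abbrev M : 𝒜 := image S.d

/-- The piece `A ⟶ B ⟶ K`. -/
def piece₁ : ShortComplex 𝒜 where
  X₁ := S.A
  X₂ := S.B
  X₃ := S.K
  f := S.a
  g := factorThruImage S.b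
  zero := by rw [← cancel_mono (image.ι S.b), assoc, image.fac, S.ab, zero_comp]

/-- The piece `K ⟶ C ⟶ L`. -/
def piece₂ : ShortComplex 𝒜 where
  X₁ := S.K
  X₂ := S.C
  X₃ := S.L
  f := image.ι S.b
  g := factorThruImage S.c
  zero := by
    rw [← cancel_mono (image.ι S.c), ← cancel_epi (factorThruImage S.b), assoc,
      image.fac, image.fac_assoc, S.bc, zero_comp, comp_zero]

/-- The piece `L ⟶ D ⟶ M`. -/
def piece₃ : ShortComplex 𝒜 where
  X₁ := S.L
  X₂ := S.D
  X₃ := S.M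
  f := image.ι S.c
  g := factorThruImage S.d
  zero := by
    rw [← cancel_mono (image.ι S.d), ← cancel_epi (factorThruImage S.c), assoc,
      image.fac, image.fac_assoc, S.cd, zero_comp, comp_zero]

/-- The piece `M ⟶ E ⟶ F`. -/
def piece₄ : ShortComplex 𝒜 where
  X₁ := S.M
  X₂ := S.E
  X₃ := S.F
  f := image.ι S.d
  g := S.e
  zero := by rw [← cancel_epi (factorThruImage S.d), image.fac_assoc, S.de, comp_zero]

lemma piece₁_shortExact : S.piece₁.ShortExact where
  exact := by
    let φ : S.piece₁ ⟶ ShortComplex.mk S.a S.b S.ab :=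
      { τ₁ := 𝟙 _, τ₂ := 𝟙 _, τ₃ := image.ι S.b
        comm₁₂ := by simp [piece₁]
        comm₂₃ := by simp [piece₁] }
    have : Epi φ.τ₁ := inferInstanceAs (Epi (𝟙 S.A))
    have : IsIso φ.τ₂ := inferInstanceAs (IsIso (𝟙 S.B))
    have : Mono φ.τ₃ := inferInstanceAs (Mono (image.ι S.b))
    exact (ShortComplex.exact_iff_of_epi_of_isIso_of_mono φ).2 S.exact_B
  mono_f := S.mono_a
  epi_g := inferInstanceAs (Epi (factorThruImage S.b))

lemma piece₂_shortExact : S.piece₂.ShortExact where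
  exact := by
    let φ : ShortComplex.mk S.b (factorThruImage S.c)
        (by rw [← cancel_mono (image.ι S.c), assoc, image.fac, S.bc, zero_comp]) ⟶
        ShortComplex.mk S.b S.c S.bc :=
      { τ₁ := 𝟙 _, τ₂ := 𝟙 _, τ₃ := image.ι S.c }
    let ψ : ShortComplex.mk S.b (factorThruImage S.c)
        (by rw [← cancel_mono (image.ι S.c), assoc, image.fac, S.bc, zero_comp]) ⟶ S.piece₂ :=
      { τ₁ := factorThruImage S.b, τ₂ := 𝟙 _, τ₃ := 𝟙 _
        comm₁₂ := by simp [piece₂]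
        comm₂₃ := by simp [piece₂] }
    have : Epi φ.τ₁ := inferInstanceAs (Epi (𝟙 S.B))
    have : IsIso φ.τ₂ := inferInstanceAs (IsIso (𝟙 S.C))
    have : Mono φ.τ₃ := inferInstanceAs (Mono (image.ι S.c))
    have : Epi ψ.τ₁ := inferInstanceAs (Epi (factorThruImage S.b))
    have : IsIso ψ.τ₂ := inferInstanceAs (IsIso (𝟙 S.C))
    have : Mono ψ.τ₃ := inferInstanceAs (Mono (𝟙 S.L))
    exact (ShortComplex.exact_iff_of_epi_of_isIso_of_mono ψ).1
      ((ShortComplex.exact_iff_of_epi_of_isIso_of_mono φ).2 S.exact_C)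
  mono_f := inferInstanceAs (Mono (image.ι S.b))
  epi_g := inferInstanceAs (Epi (factorThruImage S.c))

lemma piece₃_shortExact : S.piece₃.ShortExact where
  exact := by
    let φ : ShortComplex.mk S.c (factorThruImage S.d)
        (by rw [← cancel_mono (image.ι S.d), assoc, image.fac, S.cd, zero_comp]) ⟶
        ShortComplex.mk S.c S.d S.cd :=
      { τ₁ := 𝟙 _, τ₂ := 𝟙 _, τ₃ := image.ι S.d }
    let ψ : ShortComplex.mk S.c (factorThruImage S.d)
        (by rw [← cancel_mono (image.ι S.d), assoc, image.fac, S.cd, zero_comp]) ⟶ S.piece₃ :=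
      { τ₁ := factorThruImage S.c, τ₂ := 𝟙 _, τ₃ := 𝟙 _
        comm₁₂ := by simp [piece₃]
        comm₂₃ := by simp [piece₃] }
    have : Epi φ.τ₁ := inferInstanceAs (Epi (𝟙 S.C))
    have : IsIso φ.τ₂ := inferInstanceAs (IsIso (𝟙 S.D))
    have : Mono φ.τ₃ := inferInstanceAs (Mono (image.ι S.d))
    have : Epi ψ.τ₁ := inferInstanceAs (Epi (factorThruImage S.c))
    have : IsIso ψ.τ₂ := inferInstanceAs (IsIso (𝟙 S.D))
    have : Mono ψ.τ₃ := inferInstanceAs (Mono (𝟙 S.M))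
    exact (ShortComplex.exact_iff_of_epi_of_isIso_of_mono ψ).1
      ((ShortComplex.exact_iff_of_epi_of_isIso_of_mono φ).2 S.exact_D)
  mono_f := inferInstanceAs (Mono (image.ι S.c))
  epi_g := inferInstanceAs (Epi (factorThruImage S.d))

lemma piece₄_shortExact : S.piece₄.ShortExact where
  exact := by
    let ψ : ShortComplex.mk S.d S.e S.de ⟶ S.piece₄ :=
      { τ₁ := factorThruImage S.d, τ₂ := 𝟙 _, τ₃ := 𝟙 _
        comm₁₂ := by simp [piece₄]
        comm₂₃ := by simp [piece₄] }
    have : Epi ψ.τ₁ := inferInstanceAs (Epi (factorThruImage S.d))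
    have : IsIso ψ.τ₂ := inferInstanceAs (IsIso (𝟙 S.E))
    have : Mono ψ.τ₃ := inferInstanceAs (Mono (𝟙 S.F))
    exact (ShortComplex.exact_iff_of_epi_of_isIso_of_mono ψ).1 S.exact_E
  mono_f := inferInstanceAs (Mono (image.ι S.d))
  epi_g := S.epi_e

/-- The sequence comes from the snake lemma: it is isomorphic to
`0 ⟶ Ker f₁ ⟶ Ker f₂ ⟶ Ker f₃ ⟶ Coker f₁ ⟶ Coker f₂ ⟶ Coker f₃ ⟶ 0` (with the connecting
morphism of the snake lemma) for some morphism `(f₁, f₂, f₃)` between short exact sequences.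
In a `SnakeInput`, the rows `L₁` and `L₂` are the source and the target of this morphism, and
`L₀` and `L₃` are its kernel and its cokernel. -/
def ComesFromSnakeLemma : Prop :=
  ∃ I : ShortComplex.SnakeInput 𝒜,
    I.L₁.ShortExact ∧ I.L₂.ShortExact ∧ Nonempty (S.arrows ≅ I.composableArrows)

end SixTermExact

/-! ### Triangulated categories: Toda brackets and homology in the heart -/

section Triangulated

variable {𝒯 : Type u'} [Category.{v'} 𝒯] [Preadditive 𝒯] [HasZeroObject 𝒯] [HasShift 𝒯 ℤ]
  [∀ n : ℤ, (shiftFunctor 𝒯 n).Additive] [Pretriangulated 𝒯]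

/-- The Toda bracket `⟨z, y, x⟩` of composable morphisms `x : X ⟶ Y`, `y : Y ⟶ Z`, `z : Z ⟶ W`:
the set of the composites `X⟦1⟧ ⟶ V ⟶ W` of `g` and `f`, where
`Z ⟶ V ⟶ Y⟦1⟧ ⟶ Z⟦1⟧` is a distinguished triangle on `y⟦1⟧`, the morphism `g` lifts `x⟦1⟧`
and the morphism `f` extends `z`. -/
def todaBracket {X Y Z W : 𝒯} (z : Z ⟶ W) (y : Y ⟶ Z) (x : X ⟶ Y) : Set (X⟦(1 : ℤ)⟧ ⟶ W) :=
  {φ | ∃ (V : 𝒯) (i : Z ⟶ V) (p : V ⟶ Y⟦(1 : ℤ)⟧)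
      (_ : Triangle.mk i p (y⟦(1 : ℤ)⟧') ∈ distTriang 𝒯)
      (g : X⟦(1 : ℤ)⟧ ⟶ V) (f : V ⟶ W),
      g ≫ p = x⟦(1 : ℤ)⟧' ∧ i ≫ f = z ∧ φ = g ≫ f}

/-- The `n`-th shift `X⟦n⟧ ⟶ Y⟦m⟧`, where `m = n + 1`, of a morphism `X ⟶ Y⟦1⟧`. -/
def shiftDegreeOne {X Y : 𝒯} (φ : X ⟶ Y⟦(1 : ℤ)⟧) (n m : ℤ) (h : 1 + n = m) : X⟦n⟧ ⟶ Y⟦m⟧ :=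
  φ⟦n⟧' ≫ (shiftFunctorAdd' 𝒯 1 n m h).inv.app Y

variable [IsTriangulated 𝒯] (t : TStructure 𝒯)
  (𝒜 : Type u) [Category.{v} 𝒜] [Abelian 𝒜] [t.Heart 𝒜]

/-- The comparison of `𝒜` with the full subcategory of objects in the heart. -/
def toHeart : 𝒜 ⥤ t.heart.FullSubcategory := t.heart.lift t.ιHeart t.ιHeart_obj_mem

instance : (toHeart t 𝒜).IsEquivalence where
  faithful := inferInstanceAs (t.heart.lift t.ιHeart t.ιHeart_obj_mem).Faithful
  full := inferInstanceAs (t.heart.lift t.ιHeart t.ιHeart_obj_mem).Full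
  essSurj := ⟨fun X ↦ by
    obtain ⟨Y, ⟨e⟩⟩ : t.ιHeart.essImage X.obj := by
      rw [t.essImage_ιHeart 𝒜]
      exact X.property
    exact ⟨Y, ⟨t.heart.ι.preimageIso e⟩⟩⟩

/-- The homological functor `H : 𝒯 ⥤ 𝒜` which sends `X` to `τ^{≥ 0} τ^{≤ 0} X`, considered
as an object of the heart. The degree `n` homology of `X` is `H (X⟦n⟧)`. -/
def heartHomology : 𝒯 ⥤ 𝒜 :=
  t.heart.lift (t.truncGELE 0 0)
    (fun _ ↦ (t.mem_heart_iff _).2 ⟨inferInstance, inferInstance⟩) ⋙ (toHeart t 𝒜).inv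

/-- The six-term sequence `H⁰(X) ⟶ H⁰(Y) ⟶ H⁰(Z) ⟶ H¹(X) ⟶ H¹(Y) ⟶ H¹(Z)` of a triangle
`X ⟶ Y ⟶ Z ⟶ X⟦1⟧`. -/
def homologyArrows (T : Triangle 𝒯) : ComposableArrows 𝒜 5 :=
  ComposableArrows.mk₅
    ((heartHomology t 𝒜).map T.mor₁) ((heartHomology t 𝒜).map T.mor₂)
    ((heartHomology t 𝒜).map T.mor₃)
    ((heartHomology t 𝒜).map (T.mor₁⟦(1 : ℤ)⟧')) ((heartHomology t 𝒜).map (T.mor₂⟦(1 : ℤ)⟧'))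

variable {𝒜}

/-- There is a distinguished triangle `X ⟶ Y ⟶ Z ⟶ X⟦1⟧` whose long exact homology sequence
is isomorphic to the given six-term exact sequence, extended by zeros (with `A` in the place
of `H⁰(X)`). -/
def IsHomologyOfTriangle (S : SixTermExact 𝒜) : Prop :=
  ∃ T ∈ distTriang 𝒯,
    (∀ n : ℤ, n ≠ 0 → n ≠ 1 →
      IsZero ((heartHomology t 𝒜).obj (T.obj₁⟦n⟧)) ∧
      IsZero ((heartHomology t 𝒜).obj (T.obj₂⟦n⟧)) ∧
      IsZero ((heartHomology t 𝒜).obj (T.obj₃⟦n⟧))) ∧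
    Nonempty (S.arrows ≅ homologyArrows t 𝒜 T)

end Triangulated

/-! ### The bounded derived category -/

section Derived

variable (𝒜 : Type u) [Category.{v} 𝒜] [Abelian 𝒜] [HasDerivedCategory.{w} 𝒜]

/-- The inclusion of `𝒜` in `D^b(𝒜)` as complexes concentrated in degree `0`. -/
def singleBounded : 𝒜 ⥤ DerivedCategory.Bounded 𝒜 :=
  DerivedCategory.TStructure.t.bounded.lift (DerivedCategory.singleFunctor 𝒜 0)
    (fun _ ↦ ⟨⟨0, inferInstance⟩, ⟨0, inferInstance⟩⟩)

/-- The composition `𝒜 ⥤ D^b(𝒜) ⥤ D(𝒜)` is the usual inclusion. -/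
def singleBoundedCompι :
    singleBounded 𝒜 ⋙ DerivedCategory.Bounded.ι ≅ DerivedCategory.singleFunctor 𝒜 0 :=
  ObjectProperty.liftCompιIso _ _ _

instance : (singleBounded 𝒜).Additive where
  map_add := (DerivedCategory.Bounded.ι (C := 𝒜)).map_injective
    ((DerivedCategory.singleFunctor 𝒜 0).map_add)

instance : (singleBounded 𝒜).Full :=
  have : (singleBounded 𝒜 ⋙ DerivedCategory.Bounded.ι).Full :=
    inferInstanceAs (DerivedCategory.singleFunctor 𝒜 0).Full
  Functor.Full.of_comp_faithful _ DerivedCategory.Bounded.ι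

instance : (singleBounded 𝒜).Faithful :=
  have : (singleBounded 𝒜 ⋙ DerivedCategory.Bounded.ι).Faithful :=
    inferInstanceAs (DerivedCategory.singleFunctor 𝒜 0).Faithful
  Functor.Faithful.of_comp _ DerivedCategory.Bounded.ι

/-- The canonical t-structure on `D^b(𝒜)`. -/
abbrev tBounded : TStructure (DerivedCategory.Bounded 𝒜) :=
  TStructure.onBounded (DerivedCategory.TStructure.t (C := 𝒜))

/-- The category `𝒜` is the heart of the canonical t-structure on `D^b(𝒜)`. -/
instance heartBounded : (tBounded 𝒜).Heart 𝒜 where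
  ι := singleBounded 𝒜
  essImage_eq_heart := by
    ext X
    rw [TStructure.mem_heart_iff, ObjectProperty.tStructure_isLE_iff,
      ObjectProperty.tStructure_isGE_iff]
    constructor
    · rintro ⟨Y, ⟨e⟩⟩
      have e' : (DerivedCategory.singleFunctor 𝒜 0).obj Y ≅ X.obj :=
        (DerivedCategory.Bounded.ι (C := 𝒜)).mapIso e
      exact ⟨TStructure.isLE_of_iso _ e' 0, TStructure.isGE_of_iso _ e' 0⟩
    · rintro ⟨h₁, h₂⟩
      obtain ⟨Y, ⟨e⟩⟩ :=
        DerivedCategory.exists_iso_singleFunctor_obj_of_isGE_of_isLE X.obj 0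
      exact ⟨Y, ⟨(DerivedCategory.Bounded.ι (C := 𝒜)).preimageIso e.symm⟩⟩

variable {𝒜}

/-- The class `X₃ ⟶ X₁⟦1⟧` in `D^b(𝒜)` of a short exact sequence
`0 ⟶ X₁ ⟶ X₂ ⟶ X₃ ⟶ 0` in `𝒜`. -/
def boundedClass {P : ShortComplex 𝒜} (hP : P.ShortExact) :
    (singleBounded 𝒜).obj P.X₃ ⟶ ((singleBounded 𝒜).obj P.X₁)⟦(1 : ℤ)⟧ :=
  (DerivedCategory.Bounded.ι (C := 𝒜)).preimage
    ((singleBoundedCompι 𝒜).hom.app P.X₃ ≫ hP.singleδ ≫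
      ((singleBoundedCompι 𝒜).inv.app P.X₁)⟦(1 : ℤ)⟧' ≫
      ((DerivedCategory.Bounded.ι (C := 𝒜)).commShiftIso (1 : ℤ)).inv.app
        ((singleBounded 𝒜).obj P.X₁))

variable {𝒯 : Type u'} [Category.{v'} 𝒯] [Preadditive 𝒯] [HasZeroObject 𝒯] [HasShift 𝒯 ℤ]
  [∀ n : ℤ, (shiftFunctor 𝒯 n).Additive] [Pretriangulated 𝒯] {t : TStructure 𝒯} [t.Heart 𝒜]
  {G : DerivedCategory.Bounded 𝒜 ⥤ 𝒯} [G.CommShift ℤ] (ε : singleBounded 𝒜 ⋙ G ≅ t.ιHeart)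

/-- The morphism `X₃ ⟶ X₁⟦1⟧` in `𝒯` coming from a short exact sequence
`0 ⟶ X₁ ⟶ X₂ ⟶ X₃ ⟶ 0` in the heart `𝒜`: the image of its class by the functor `G`, where `G`
extends the identity of `𝒜` by means of `ε`. -/
def heartClass {P : ShortComplex 𝒜} (hP : P.ShortExact) :
    t.ιHeart.obj P.X₃ ⟶ (t.ιHeart.obj P.X₁)⟦(1 : ℤ)⟧ :=
  ε.inv.app P.X₃ ≫ G.map (boundedClass hP) ≫ (G.commShiftIso (1 : ℤ)).hom.app _ ≫
    (ε.hom.app P.X₁)⟦(1 : ℤ)⟧'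

namespace SixTermExact

variable (S : SixTermExact 𝒜)

/-- `α : F ⟶ M⟦1⟧`. -/
def α : t.ιHeart.obj S.F ⟶ (t.ιHeart.obj S.M)⟦(1 : ℤ)⟧ :=
  heartClass ε S.piece₄_shortExact

/-- `β : M⟦1⟧ ⟶ L⟦2⟧`. -/
def β : (t.ιHeart.obj S.M)⟦(1 : ℤ)⟧ ⟶ (t.ιHeart.obj S.L)⟦(2 : ℤ)⟧ :=
  shiftDegreeOne (heartClass ε S.piece₃_shortExact) 1 2 (by norm_num)

/-- `γ : L⟦2⟧ ⟶ K⟦3⟧`. -/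
def γ : (t.ιHeart.obj S.L)⟦(2 : ℤ)⟧ ⟶ (t.ιHeart.obj S.K)⟦(3 : ℤ)⟧ :=
  shiftDegreeOne (heartClass ε S.piece₂_shortExact) 2 3 (by norm_num)

/-- `δ : K⟦3⟧ ⟶ A⟦4⟧`. -/
def δ : (t.ιHeart.obj S.K)⟦(3 : ℤ)⟧ ⟶ (t.ιHeart.obj S.A)⟦(4 : ℤ)⟧ :=
  shiftDegreeOne (heartClass ε S.piece₁_shortExact) 3 4 (by norm_num)

end SixTermExact

variable (𝒜) in
/-- The identity functor of `D^b(𝒜)` extends the identity of `𝒜`. -/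
def idExtends : singleBounded 𝒜 ⋙ 𝟭 (DerivedCategory.Bounded 𝒜) ≅ (tBounded 𝒜).ιHeart :=
  (singleBounded 𝒜).rightUnitor

end Derived

end SnakeToda

end

noncomputable section

namespace SnakeToda

/-! ### Distinguished triangles: signs, Hom-exactness, comparison of triangles. -/

section Triangles

variable {𝒯 : Type u'} [Category.{v'} 𝒯] [Preadditive 𝒯] [HasZeroObject 𝒯] [HasShift 𝒯 ℤ]
  [∀ n : ℤ, (shiftFunctor 𝒯 n).Additive] [Pretriangulated 𝒯]

section

variable {X Y Z : 𝒯} {f : X ⟶ Y} {g : Y ⟶ Z} {h : Z ⟶ X⟦(1 : ℤ)⟧}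

/-! Think of distinguished triangles as extensions and shift the triangle `X ⟶ Y ⟶ Z` by one, so
that `X`, `Y`, `Z` become extensions of `D`, `E`, `F` by `A[1]`, `B[1]`, `C[1]`. Such a
presentation, together with the maps of `(*)` on the pieces, is a `HomologyData`.

Let `V` be the cone of `c : C ⟶ D`. It is an extension of `C[1]` by `D`. Since `c` factors through
`L`, the octahedral axiom makes `V` also an extension of `M` by `K[1]`, with class the product of
the classes of `M ⟶ L[1]` and `L ⟶ K[1]` (`exists_extension_of_cone`). Up to shift, `V` is therefore
the object that computes the Toda bracket, and `0` lies in the bracket iff there are `f : V ⟶ A[2]`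
extending the class of `K ⟶ A[1]` and `g : F ⟶ V[1]` lifting the class of `F ⟶ M[1]` with `g ≫ f[1]
= 0` (`zero_mem_todaBracket_shiftDegreeOne_iff`).

The vanishing of `g ≫ f[1]` means that `g` lifts to `U[1]`, where `U` is the fibre of `f`. From `f`
and the lift one reads off a triangle: `X` is the fibre of `D ⟶ V ⟶ A[2]`, `Y` is the extension of
`F` by `U` given by the lift, and `Z` is the cone of `X ⟶ U ⟶ Y`. The fibre of `K[1] ⟶ V ⟶ A[2]` is
`B[1]`, and `Y` modulo `B[1]` is the extension of `F` by `M` with the class of `E`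
(`HomologyData.nonempty_of_factorization`). Conversely, a triangle gives `U` as the fibre of `Y ⟶ Z
⟶ F` and `V` as the cone of `A[1] ⟶ U`; the vanishing of Homs into higher degrees shows that the
resulting `f` and `g` have the right components (`HomologyData.exists_factorization`).

Condition 1 concerns homology only, and `t` may be degenerate. Truncations replace the given
triangle by one with objects in degrees `[0, 1]` and the same homology sequence, and there condition
1 becomes `HomologyData` (`isHomologyOfTriangle_iff`).

For `D^b(𝒜)` it remains to compare triangles with snake diagrams. The columns of a snake diagram are
two-term complexes, whose long exact homology sequence is the snake sequence. Conversely, a triangle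
in degrees `[0, 1]` with `H¹(y)` epi comes from a short exact sequence of two-term complexes, since
adding a contractible summand to the source makes a representative of `y` an epimorphism
(`exists_shortExact_of_epi_homologyMap`). -/

lemma distinguished_iff_of_isos {X' Y' Z' : 𝒯} {f' : X' ⟶ Y'} {g' : Y' ⟶ Z'}
    {h' : Z' ⟶ X'⟦(1 : ℤ)⟧} (e₁ : X ≅ X') (e₂ : Y ≅ Y') (e₃ : Z ≅ Z')
    (comm₁ : f ≫ e₂.hom = e₁.hom ≫ f') (comm₂ : g ≫ e₃.hom = e₂.hom ≫ g')
    (comm₃ : h ≫ e₁.hom⟦(1 : ℤ)⟧' = e₃.hom ≫ h') :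
    Triangle.mk f g h ∈ distTriang 𝒯 ↔ Triangle.mk f' g' h' ∈ distTriang 𝒯 :=
  distinguished_iff_of_iso (Triangle.isoMk _ _ e₁ e₂ e₃ comm₁ comm₂ comm₃)

lemma distinguished_rotate_iff :
    Triangle.mk f g h ∈ distTriang 𝒯 ↔ Triangle.mk g h (-f⟦(1 : ℤ)⟧') ∈ distTriang 𝒯 :=
  rotate_distinguished_triangle _

lemma distinguished_neg₁₂_iff :
    Triangle.mk (-f) (-g) h ∈ distTriang 𝒯 ↔ Triangle.mk f g h ∈ distTriang 𝒯 :=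
  distinguished_iff_of_isos (Iso.refl X) (-Iso.refl Y) (Iso.refl Z)
    (by simp) (by simp) (by simp)

lemma distinguished_neg₂₃_iff :
    Triangle.mk f (-g) (-h) ∈ distTriang 𝒯 ↔ Triangle.mk f g h ∈ distTriang 𝒯 :=
  distinguished_iff_of_isos (Iso.refl X) (Iso.refl Y) (-Iso.refl Z)
    (by simp) (by simp) (by simp)

/-- Three rotations put a sign on every morphism; the first two signs are removed by an isomorphism
of triangles. -/
lemma distinguished_shift_iff :
    Triangle.mk (f⟦(1 : ℤ)⟧') (g⟦(1 : ℤ)⟧') (-h⟦(1 : ℤ)⟧') ∈ distTriang 𝒯 ↔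
      Triangle.mk f g h ∈ distTriang 𝒯 := by
  rw [distinguished_rotate_iff (f := f), distinguished_rotate_iff (f := g),
    distinguished_rotate_iff (f := h), distinguished_neg₁₂_iff]

variable (hT : Triangle.mk f g h ∈ distTriang 𝒯)

include hT

lemma mor₂_comp_mor₃ : g ≫ h = 0 := comp_distTriang_mor_zero₂₃ _ hT

variable {W : 𝒯}

lemma exists_eq_mor₂_comp (a : Y ⟶ W) (ha : f ≫ a = 0) : ∃ b : Z ⟶ W, a = g ≫ b :=
  Triangle.yoneda_exact₂ _ hT a ha

lemma exists_eq_mor₃_comp (a : Z ⟶ W) (ha : g ≫ a = 0) :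
    ∃ b : X⟦(1 : ℤ)⟧ ⟶ W, a = h ≫ b :=
  Triangle.yoneda_exact₃ _ hT a ha

lemma exists_eq_comp_mor₁ (a : W ⟶ Y) (ha : a ≫ g = 0) : ∃ b : W ⟶ X, a = b ≫ f :=
  Triangle.coyoneda_exact₂ _ hT a ha

lemma exists_eq_comp_mor₂ (a : W ⟶ Z) (ha : a ≫ h = 0) : ∃ b : W ⟶ Y, a = b ≫ g :=
  Triangle.coyoneda_exact₃ _ hT a ha

lemma exists_eq_comp_mor₃ (a : W ⟶ X⟦(1 : ℤ)⟧) (ha : a ≫ f⟦(1 : ℤ)⟧' = 0) :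
    ∃ b : W ⟶ Z, a = b ≫ h :=
  Triangle.coyoneda_exact₁ _ hT a ha

/-- Precomposition with the second morphism of a triangle is injective when there is no
morphism from the shift of the first object. -/
lemma eq_of_mor₂_comp_eq (h₀ : ∀ φ : X⟦(1 : ℤ)⟧ ⟶ W, φ = 0) {a b : Z ⟶ W}
    (hab : g ≫ a = g ≫ b) : a = b := by
  obtain ⟨c, hc⟩ := exists_eq_mor₃_comp hT (a - b) (by rw [Preadditive.comp_sub, hab, sub_self])
  rw [← sub_eq_zero, hc, h₀ c, comp_zero]

/-- Precomposition with the first morphism of a triangle is injective when there is no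
morphism from the third object. -/
lemma eq_of_mor₁_comp_eq (h₀ : ∀ φ : Z ⟶ W, φ = 0) {a b : Y ⟶ W}
    (hab : f ≫ a = f ≫ b) : a = b := by
  obtain ⟨c, hc⟩ := exists_eq_mor₂_comp hT (a - b) (by rw [Preadditive.comp_sub, hab, sub_self])
  rw [← sub_eq_zero, hc, h₀ c, comp_zero]

/-- Postcomposition with the second morphism of a triangle is injective when there is no
morphism to the first object. -/
lemma eq_of_comp_mor₂_eq (h₀ : ∀ φ : W ⟶ X, φ = 0) {a b : W ⟶ Y}
    (hab : a ≫ g = b ≫ g) : a = b := by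
  obtain ⟨c, hc⟩ := exists_eq_comp_mor₁ hT (a - b) (by rw [Preadditive.sub_comp, hab, sub_self])
  rw [← sub_eq_zero, hc, h₀ c, zero_comp]

/-- Postcomposition with the first morphism of a triangle is injective when there is no
morphism from the shifted source to the third object. -/
lemma eq_of_comp_mor₁_eq (h₀ : ∀ φ : W⟦(1 : ℤ)⟧ ⟶ Z, φ = 0) {a b : W ⟶ X}
    (hab : a ≫ f = b ≫ f) : a = b := by
  apply (shiftFunctor 𝒯 (1 : ℤ)).map_injective
  obtain ⟨c, hc⟩ := exists_eq_comp_mor₃ hT (a⟦(1 : ℤ)⟧' - b⟦(1 : ℤ)⟧') (by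
    rw [Preadditive.sub_comp, ← Functor.map_comp, hab, Functor.map_comp, sub_self])
  rw [← sub_eq_zero, hc, h₀ c, zero_comp]

/-- The axiom (TR3) of triangulated categories. -/
lemma exists_third_morphism {X' Y' Z' : 𝒯} {f' : X' ⟶ Y'} {g' : Y' ⟶ Z'}
    {h' : Z' ⟶ X'⟦(1 : ℤ)⟧} (hT' : Triangle.mk f' g' h' ∈ distTriang 𝒯)
    (a : X ⟶ X') (b : Y ⟶ Y') (comm : f ≫ b = a ≫ f') :
    ∃ c : Z ⟶ Z', g ≫ c = b ≫ g' ∧ h ≫ a⟦(1 : ℤ)⟧' = c ≫ h' :=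
  complete_distinguished_triangle_morphism _ _ hT hT' a b comm

lemma exists_first_morphism {X' Y' Z' : 𝒯} {f' : X' ⟶ Y'} {g' : Y' ⟶ Z'}
    {h' : Z' ⟶ X'⟦(1 : ℤ)⟧} (hT' : Triangle.mk f' g' h' ∈ distTriang 𝒯)
    (b : Y ⟶ Y') (c : Z ⟶ Z') (comm : g ≫ c = b ≫ g') :
    ∃ a : X ⟶ X', f ≫ b = a ≫ f' ∧ h ≫ a⟦(1 : ℤ)⟧' = c ≫ h' :=
  complete_distinguished_triangle_morphism₁ _ _ hT hT' b c comm

/-- Two distinguished triangles with the same third morphism are isomorphic. -/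
lemma exists_second_iso {Y' : 𝒯} {f' : X ⟶ Y'} {g' : Y' ⟶ Z}
    (hT' : Triangle.mk f' g' h ∈ distTriang 𝒯) :
    ∃ e : Y ≅ Y', f ≫ e.hom = f' ∧ e.hom ≫ g' = g := by
  obtain ⟨b, hb₁, hb₂⟩ := complete_distinguished_triangle_morphism₂ _ _ hT hT' (𝟙 X) (𝟙 Z)
    (by
      change h ≫ (𝟙 X)⟦(1 : ℤ)⟧' = 𝟙 Z ≫ h
      simp)
  change f ≫ b = 𝟙 X ≫ f' at hb₁
  change g ≫ 𝟙 Z = b ≫ g' at hb₂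
  rw [id_comp] at hb₁
  rw [comp_id] at hb₂
  let φ : Triangle.mk f g h ⟶ Triangle.mk f' g' h := Triangle.homMk _ _ (𝟙 X) b (𝟙 Z)
    (hb₁.trans (id_comp _).symm) ((comp_id _).trans hb₂) (by
      change h ≫ (𝟙 X)⟦(1 : ℤ)⟧' = 𝟙 Z ≫ h
      simp)
  have : IsIso b := isIso₂_of_isIso₁₃ φ hT hT' (inferInstanceAs (IsIso (𝟙 X)))
    (inferInstanceAs (IsIso (𝟙 Z)))
  exact ⟨@asIso _ _ _ _ b this, hb₁, hb₂.symm⟩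

/-- Two distinguished triangles with the same first morphism are isomorphic. -/
lemma exists_third_iso {Z' : 𝒯} {g' : Y ⟶ Z'} {h' : Z' ⟶ X⟦(1 : ℤ)⟧}
    (hT' : Triangle.mk f g' h' ∈ distTriang 𝒯) :
    ∃ e : Z ≅ Z', g ≫ e.hom = g' ∧ e.hom ≫ h' = h := by
  rw [distinguished_rotate_iff] at hT hT'
  exact exists_second_iso hT hT'

end

end Triangles

/-! ### Extension classes complete short exact sequences to triangles. -/

section HeartClass

variable {𝒜 : Type u} [Category.{v} 𝒜] [Abelian 𝒜] [HasDerivedCategory.{w} 𝒜]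

/-- Distinguished triangles of `D^b(𝒜)` are tested in `D(𝒜)`. There the shift comparison built into
`boundedClass` cancels the one by which the inclusion acts on third morphisms. -/
lemma boundedClass_distinguished {P : ShortComplex 𝒜} (hP : P.ShortExact) :
    Triangle.mk ((singleBounded 𝒜).map P.f) ((singleBounded 𝒜).map P.g) (boundedClass hP) ∈
      distTriang (DerivedCategory.Bounded 𝒜) := by
  refine isomorphic_distinguished _ hP.singleTriangle_distinguished _
    (Triangle.isoMk _ _ ((singleBoundedCompι 𝒜).app P.X₁) ((singleBoundedCompι 𝒜).app P.X₂)
      ((singleBoundedCompι 𝒜).app P.X₃) ((singleBoundedCompι 𝒜).hom.naturality P.f)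
        ((singleBoundedCompι 𝒜).hom.naturality P.g) ?_)
  change (DerivedCategory.Bounded.ι.map (boundedClass hP) ≫
      (DerivedCategory.Bounded.ι.commShiftIso (1 : ℤ)).hom.app _) ≫
        ((singleBoundedCompι 𝒜).hom.app P.X₁)⟦(1 : ℤ)⟧' =
      (singleBoundedCompι 𝒜).hom.app P.X₃ ≫ hP.singleδ
  rw [boundedClass, Functor.map_preimage]
  simp only [assoc, Iso.inv_hom_id_app_assoc]
  rw [← Functor.map_comp, Iso.inv_hom_id_app, CategoryTheory.Functor.map_id, comp_id]

variable {𝒯 : Type u'} [Category.{v'} 𝒯] [Preadditive 𝒯] [HasZeroObject 𝒯] [HasShift 𝒯 ℤ]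
  [∀ n : ℤ, (shiftFunctor 𝒯 n).Additive] [Pretriangulated 𝒯] {t : TStructure 𝒯} [t.Heart 𝒜]
  {G : DerivedCategory.Bounded 𝒜 ⥤ 𝒯} [G.CommShift ℤ] (ε : singleBounded 𝒜 ⋙ G ≅ t.ιHeart)

lemma heartClass_distinguished [G.IsTriangulated] {P : ShortComplex 𝒜} (hP : P.ShortExact) :
    Triangle.mk (t.ιHeart.map P.f) (t.ιHeart.map P.g) (heartClass ε hP) ∈ distTriang 𝒯 := by
  refine isomorphic_distinguished _ (G.map_distinguished _ (boundedClass_distinguished hP)) _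
    (Triangle.isoMk _ _ (ε.symm.app P.X₁) (ε.symm.app P.X₂) (ε.symm.app P.X₃)
      (ε.inv.naturality P.f) (ε.inv.naturality P.g) ?_)
  change heartClass ε hP ≫ (ε.inv.app P.X₁)⟦(1 : ℤ)⟧' = ε.inv.app P.X₃ ≫
    G.map (boundedClass hP) ≫ (G.commShiftIso (1 : ℤ)).hom.app _
  have h : (ε.hom.app P.X₁)⟦(1 : ℤ)⟧' ≫ (ε.inv.app P.X₁)⟦(1 : ℤ)⟧' =
      𝟙 ((G.obj ((singleBounded 𝒜).obj P.X₁))⟦(1 : ℤ)⟧) := by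
    rw [← Functor.map_comp, Iso.hom_inv_id_app]
    exact CategoryTheory.Functor.map_id _ _
  simp only [heartClass, assoc]
  exact congr_arg (ε.inv.app P.X₃ ≫ G.map (boundedClass hP) ≫ ·)
    ((congr_arg ((G.commShiftIso (1 : ℤ)).hom.app _ ≫ ·) h).trans (comp_id _))

end HeartClass

/-! ### Composites of shifted degree-one classes. -/

section ShiftDegreeOne

variable {C : Type u} [Category.{v} C] [HasShift C ℤ]

lemma shiftFunctorAdd'_inv_app_comp {a b c : ℤ}
    (h : a + b = c) {X Y Z : C} (f : X ⟶ Y) (g : Y⟦c⟧ ⟶ Z) :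
    (shiftFunctorAdd' C a b c h).inv.app X ≫ f⟦c⟧' ≫ g =
      f⟦a⟧'⟦b⟧' ≫ (shiftFunctorAdd' C a b c h).inv.app Y ≫ g := by
  have := (shiftFunctorAdd' C a b c h).inv.naturality f
  exact (assoc _ _ _).symm.trans ((congrArg (· ≫ g) this.symm).trans (assoc _ _ _))

/-- Puts `β ≫ γ` in the form of the shift of one degree-two class `h₂ ≫ h₃[1]`, up to the canonical
identification of iterated shifts of `K`. -/
lemma shiftDegreeOne_comp_shiftDegreeOne {L M K : C} (h₂ : M ⟶ L⟦(1 : ℤ)⟧)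
    (h₃ : L ⟶ K⟦(1 : ℤ)⟧) :
    shiftDegreeOne h₂ 1 2 (by norm_num) ≫ shiftDegreeOne h₃ 2 3 (by norm_num) =
      (h₂ ≫ h₃⟦(1 : ℤ)⟧')⟦(1 : ℤ)⟧' ≫
        (shiftFunctorAdd' C (1 : ℤ) 1 2 (by norm_num)).inv.app (K⟦(1 : ℤ)⟧) ≫
          (shiftFunctorAdd' C (1 : ℤ) 2 3 (by norm_num)).inv.app K := by
  simp only [shiftDegreeOne, assoc, Functor.map_comp, shiftFunctorAdd'_inv_app_comp]

/-- The identification used for `β ≫ γ` turns `δ` into an iterated shift of `k`; both are needed to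
desuspend the bracket. -/
lemma comp_shiftDegreeOne {K A : C} (k : K ⟶ A⟦(1 : ℤ)⟧) :
    ((shiftFunctorAdd' C (1 : ℤ) 1 2 (by norm_num)).inv.app (K⟦(1 : ℤ)⟧) ≫
      (shiftFunctorAdd' C (1 : ℤ) 2 3 (by norm_num)).inv.app K) ≫
        shiftDegreeOne k 3 4 (by norm_num) =
    k⟦(1 : ℤ)⟧'⟦(1 : ℤ)⟧'⟦(1 : ℤ)⟧' ≫
      (shiftFunctorAdd' C (1 : ℤ) 1 2 (by norm_num)).inv.app (A⟦(1 : ℤ)⟧⟦(1 : ℤ)⟧) ≫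
      (shiftFunctorAdd' C (1 : ℤ) 2 3 (by norm_num)).inv.app (A⟦(1 : ℤ)⟧) ≫
      (shiftFunctorAdd' C (1 : ℤ) 3 4 (by norm_num)).inv.app A := by
  simp only [shiftDegreeOne, assoc, shiftFunctorAdd'_inv_app_comp]

end ShiftDegreeOne

/-! ### The Toda bracket as a lifting and extension problem. -/

section Toda

variable {𝒯 : Type u'} [Category.{v'} 𝒯] [Preadditive 𝒯] [HasZeroObject 𝒯] [HasShift 𝒯 ℤ]
  [∀ n : ℤ, (shiftFunctor 𝒯 n).Additive] [Pretriangulated 𝒯]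

/-- The Toda bracket can be computed with any choice of the distinguished triangle. -/
lemma zero_mem_todaBracket_iff {X Y Z W V : 𝒯} (z : Z ⟶ W) (y : Y ⟶ Z) (x : X ⟶ Y)
    {i : Z ⟶ V} {p : V ⟶ Y⟦(1 : ℤ)⟧} (hT : Triangle.mk i p (y⟦(1 : ℤ)⟧') ∈ distTriang 𝒯) :
    0 ∈ todaBracket z y x ↔
      ∃ (g : X⟦(1 : ℤ)⟧ ⟶ V) (f : V ⟶ W), g ≫ p = x⟦(1 : ℤ)⟧' ∧ i ≫ f = z ∧ g ≫ f = 0 := by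
  constructor
  · rintro ⟨V', i', p', hT', g, f, hg, hf, h₀⟩
    obtain ⟨e, he₁, he₂⟩ := exists_second_iso hT hT'
    refine ⟨g ≫ e.inv, e.hom ≫ f, ?_, ?_, ?_⟩
    · rw [assoc, ← he₂, e.inv_hom_id_assoc, hg]
    · rw [reassoc_of% he₁, hf]
    · rw [assoc, e.inv_hom_id_assoc, ← h₀]
  · rintro ⟨g, f, hg, hf, h₀⟩
    exact ⟨V, i, p, hT, g, f, hg, hf, h₀.symm⟩

/-- The shift is an autoequivalence, so the data of the bracket descend to the unshifted triangle on
`y`. That triangle is shifted twice, which cancels the sign on its third morphism. -/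
lemma zero_mem_todaBracket_shift_iff {F M K V A K' A' : 𝒯} (x : F ⟶ M⟦(1 : ℤ)⟧)
    {y : M ⟶ K⟦(1 : ℤ)⟧} (z : K ⟶ A) {i : K ⟶ V} {p : V ⟶ M}
    (hT : Triangle.mk i p y ∈ distTriang 𝒯)
    (e : K⟦(1 : ℤ)⟧⟦(1 : ℤ)⟧ ≅ K') (e' : A⟦(1 : ℤ)⟧⟦(1 : ℤ)⟧ ≅ A') {y' : M⟦(1 : ℤ)⟧ ⟶ K'}
    {z' : K' ⟶ A'} (hy' : y⟦(1 : ℤ)⟧' ≫ e.hom = y')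
    (hz' : e.hom ≫ z' = z⟦(1 : ℤ)⟧'⟦(1 : ℤ)⟧' ≫ e'.hom) :
    0 ∈ todaBracket z' y' x ↔ ∃ (f : V ⟶ A) (g : F ⟶ V⟦(1 : ℤ)⟧),
      g ≫ p⟦(1 : ℤ)⟧' = x ∧ i ≫ f = z ∧ g ≫ f⟦(1 : ℤ)⟧' = 0 := by
  have hT' : Triangle.mk (e.inv ≫ i⟦(1 : ℤ)⟧'⟦(1 : ℤ)⟧') (p⟦(1 : ℤ)⟧'⟦(1 : ℤ)⟧') (y'⟦(1 : ℤ)⟧') ∈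
      distTriang 𝒯 := by
    refine (distinguished_iff_of_isos e.symm (Iso.refl _) (Iso.refl _) (by simp) (by simp) ?_).2
      ((distinguished_shift_iff (h := -y⟦(1 : ℤ)⟧')).2 (distinguished_shift_iff.2 hT))
    rw [← hy']
    simp [← Functor.map_comp]
  rw [zero_mem_todaBracket_iff _ _ _ hT']
  constructor
  · rintro ⟨g, f, hg, hf, h₀⟩
    obtain ⟨g, rfl⟩ := (shiftFunctor 𝒯 (1 : ℤ)).map_surjective g
    obtain ⟨f', hf'⟩ := (shiftFunctor 𝒯 (1 : ℤ)).map_surjective (f ≫ e'.inv)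
    obtain ⟨f', rfl⟩ := (shiftFunctor 𝒯 (1 : ℤ)).map_surjective f'
    refine ⟨f', g, (shiftFunctor 𝒯 (1 : ℤ)).map_injective ?_,
      (shiftFunctor 𝒯 (1 : ℤ)).map_injective ((shiftFunctor 𝒯 (1 : ℤ)).map_injective ?_),
      (shiftFunctor 𝒯 (1 : ℤ)).map_injective ?_⟩
    · rw [Functor.map_comp, hg]
    · rw [Functor.map_comp, Functor.map_comp, hf', ← cancel_mono e'.hom, ← hz', ← hf]
      simp
    · rw [Functor.map_comp, hf', reassoc_of% h₀, Functor.map_zero, zero_comp]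
  · rintro ⟨f, g, hg, hf, h₀⟩
    refine ⟨g⟦(1 : ℤ)⟧', f⟦(1 : ℤ)⟧'⟦(1 : ℤ)⟧' ≫ e'.hom, ?_, ?_, ?_⟩
    · rw [← hg, Functor.map_comp]
    · rw [← cancel_epi e.hom, hz', ← hf]
      simp
    · rw [← Functor.map_comp_assoc, h₀, Functor.map_zero, zero_comp]

/-- The Toda bracket of shifted morphisms of degree one contains zero if and only if there
are suitable morphisms from and to an object `V` which is an extension of `M` by `K⟦1⟧`. -/
lemma zero_mem_todaBracket_shiftDegreeOne_iff {F M L K A V : 𝒯} (h₁ : F ⟶ M⟦(1 : ℤ)⟧)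
    (h₂ : M ⟶ L⟦(1 : ℤ)⟧) (h₃ : L ⟶ K⟦(1 : ℤ)⟧) (k : K ⟶ A⟦(1 : ℤ)⟧)
    {i : K⟦(1 : ℤ)⟧ ⟶ V} {p : V ⟶ M}
    (hT : Triangle.mk i p (h₂ ≫ h₃⟦(1 : ℤ)⟧') ∈ distTriang 𝒯) :
    0 ∈ todaBracket (shiftDegreeOne k 3 4 (by norm_num))
        (shiftDegreeOne h₂ 1 2 (by norm_num) ≫ shiftDegreeOne h₃ 2 3 (by norm_num)) h₁ ↔
      ∃ (f : V ⟶ A⟦(1 : ℤ)⟧⟦(1 : ℤ)⟧) (g : F ⟶ V⟦(1 : ℤ)⟧),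
        g ≫ p⟦(1 : ℤ)⟧' = h₁ ∧ i ≫ f = k⟦(1 : ℤ)⟧' ∧ g ≫ f⟦(1 : ℤ)⟧' = 0 :=
  zero_mem_todaBracket_shift_iff h₁ (k⟦(1 : ℤ)⟧') hT
    ((shiftFunctorAdd' 𝒯 (1 : ℤ) 1 2 (by norm_num)).symm.app (K⟦(1 : ℤ)⟧) ≪≫
      (shiftFunctorAdd' 𝒯 (1 : ℤ) 2 3 (by norm_num)).symm.app K)
    ((shiftFunctorAdd' 𝒯 (1 : ℤ) 1 2 (by norm_num)).symm.app (A⟦(1 : ℤ)⟧⟦(1 : ℤ)⟧) ≪≫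
      (shiftFunctorAdd' 𝒯 (1 : ℤ) 2 3 (by norm_num)).symm.app (A⟦(1 : ℤ)⟧) ≪≫
      (shiftFunctorAdd' 𝒯 (1 : ℤ) 3 4 (by norm_num)).symm.app A)
    (shiftDegreeOne_comp_shiftDegreeOne h₂ h₃).symm (comp_shiftDegreeOne k)

end Toda

/-! ### From triangles to Toda bracket data and back, by octahedra. -/

section Core

variable {𝒯 : Type u'} [Category.{v'} 𝒯] [Preadditive 𝒯] [HasZeroObject 𝒯] [HasShift 𝒯 ℤ]
  [∀ n : ℤ, (shiftFunctor 𝒯 n).Additive] [Pretriangulated 𝒯]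

/-- A distinguished triangle `X ⟶ Y ⟶ Z ⟶ X⟦1⟧` together with the structure of extensions
on the objects `X`, `Y` and `Z`, which induce the given morphisms on the constituents. When
`A`, `B`, `C`, `D`, `E`, `F` are in the heart, these are the homology objects of the triangle
in degrees `-1` and `0`. -/
structure HomologyData {A B C D E F : 𝒯} (a : A ⟶ B) (b : B ⟶ C) (c : C ⟶ D) (d : D ⟶ E)
    (e : E ⟶ F) where
  {X Y Z : 𝒯}
  {x : X ⟶ Y}
  {y : Y ⟶ Z}
  {z : Z ⟶ X⟦(1 : ℤ)⟧}
  distinguished : Triangle.mk x y z ∈ distTriang 𝒯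
  {iA : A⟦(1 : ℤ)⟧ ⟶ X}
  {pA : X ⟶ D}
  {wA : D ⟶ A⟦(1 : ℤ)⟧⟦(1 : ℤ)⟧}
  distinguished_A : Triangle.mk iA pA wA ∈ distTriang 𝒯
  {iB : B⟦(1 : ℤ)⟧ ⟶ Y}
  {pB : Y ⟶ E}
  {wB : E ⟶ B⟦(1 : ℤ)⟧⟦(1 : ℤ)⟧}
  distinguished_B : Triangle.mk iB pB wB ∈ distTriang 𝒯
  {iC : C⟦(1 : ℤ)⟧ ⟶ Z}
  {pC : Z ⟶ F}
  {wC : F ⟶ C⟦(1 : ℤ)⟧⟦(1 : ℤ)⟧}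
  distinguished_C : Triangle.mk iC pC wC ∈ distTriang 𝒯
  comm_a : a⟦(1 : ℤ)⟧' ≫ iB = iA ≫ x
  comm_b : b⟦(1 : ℤ)⟧' ≫ iC = iB ≫ y
  comm_c : iC ≫ z ≫ pA⟦(1 : ℤ)⟧' = -c⟦(1 : ℤ)⟧'
  comm_d : x ≫ pB = pA ≫ d
  comm_e : y ≫ pC = pB ≫ e

variable [IsTriangulated 𝒯]

/-- The extension `V` in the Toda bracket condition, constructed as a cone of `c`. -/
lemma exists_extension_of_cone {K C L D M V : 𝒯} {κ : K ⟶ C} {c' : C ⟶ L} {h₃ : L ⟶ K⟦(1 : ℤ)⟧}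
    (H₃ : Triangle.mk κ c' h₃ ∈ distTriang 𝒯) {l : L ⟶ D} {d' : D ⟶ M} {h₂ : M ⟶ L⟦(1 : ℤ)⟧}
    (H₂ : Triangle.mk l d' h₂ ∈ distTriang 𝒯) {q : D ⟶ V} {r : V ⟶ C⟦(1 : ℤ)⟧}
    (H : Triangle.mk (c' ≫ l) q r ∈ distTriang 𝒯) :
    ∃ (i : K⟦(1 : ℤ)⟧ ⟶ V) (p : V ⟶ M),
      Triangle.mk i p (h₂ ≫ h₃⟦(1 : ℤ)⟧') ∈ distTriang 𝒯 ∧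
        i ≫ r = -κ⟦(1 : ℤ)⟧' ∧ q ≫ p = d' := by
  -- The factors `c'` and `l` have cones `K[1]` and `M`, and their composite has cone `V`.
  let O := someOctahedron rfl (distinguished_rotate_iff.1 H₃) H₂ H
  exact ⟨O.m₁, O.m₃, O.mem, O.comm₂, O.comm₃⟩

variable (t : TStructure 𝒯) {A B C D E F K M : 𝒯}
  {a : A ⟶ B} {b' : B ⟶ K} {κ : K ⟶ C} {c : C ⟶ D} {d' : D ⟶ M} {μ : M ⟶ E} {e : E ⟶ F}
  {k : K ⟶ A⟦(1 : ℤ)⟧} {h₁ : F ⟶ M⟦(1 : ℤ)⟧}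
  (Hk : Triangle.mk a b' k ∈ distTriang 𝒯) (H₁ : Triangle.mk μ e h₁ ∈ distTriang 𝒯)

include Hk H₁

/-- The statement allows every compatible pair `(i, p)` because the octahedron presenting `V` as an
extension of `M` by `K[1]` is chosen only after `V` is known. The t-structure enters only through
vanishing of Homs. -/
lemma HomologyData.exists_factorization
    [t.IsLE A 0] [t.IsGE C 0] [t.IsLE C 0] [t.IsLE B 0] [t.IsGE D 0] [t.IsGE F 0] [t.IsGE E 0]
    [t.IsLE K 0] [t.IsLE D 0]
    (T : HomologyData a (b' ≫ κ) c (d' ≫ μ) e) :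
    ∃ (V : 𝒯) (q : D ⟶ V) (r : V ⟶ C⟦(1 : ℤ)⟧) (_ : Triangle.mk c q r ∈ distTriang 𝒯),
      ∀ (i : K⟦(1 : ℤ)⟧ ⟶ V) (p : V ⟶ M) (_ : i ≫ r = -κ⟦(1 : ℤ)⟧') (_ : q ≫ p = d'),
        ∃ (f : V ⟶ A⟦(1 : ℤ)⟧⟦(1 : ℤ)⟧) (g : F ⟶ V⟦(1 : ℤ)⟧),
          g ≫ p⟦(1 : ℤ)⟧' = h₁ ∧ i ≫ f = k⟦(1 : ℤ)⟧' ∧ g ≫ f⟦(1 : ℤ)⟧' = 0 := by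
  obtain ⟨hT, hA, hB, hC, comm_a, comm_b, comm_c, comm_d, comm_e⟩ := T
  rename_i X Y Z x y z iA pA wA iB pB wB iC pC wC
  -- `U` plays the role of the pullback of `Y ⟶ Z` along `C[1] ⟶ Z`: an extension of `C[1]` by `X`,
  -- and by the next octahedron the fibre of `Y ⟶ F`.
  obtain ⟨U, s, τ, hU⟩ := distinguished_cocone_triangle₂ (iC ≫ z)
  -- the octahedron on `iC` and `z`
  let O₁ := someOctahedron rfl hC (distinguished_rotate_iff.1 (distinguished_rotate_iff.1 hT))
    (distinguished_rotate_iff.1 (distinguished_rotate_iff.1 hU))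
  obtain ⟨u, hu⟩ := (shiftFunctor 𝒯 (1 : ℤ)).map_surjective O₁.m₃
  have hsu : s ≫ u = x := (shiftFunctor 𝒯 (1 : ℤ)).map_injective (by
    have := O₁.comm₃
    rw [← hu, Preadditive.neg_comp, neg_inj] at this
    rw [Functor.map_comp, this])
  have huy : u ≫ y = τ ≫ iC := (shiftFunctor 𝒯 (1 : ℤ)).map_injective (by
    have := O₁.comm₄
    rw [← hu, Preadditive.neg_comp, Preadditive.comp_neg, neg_inj] at this
    rw [Functor.map_comp, Functor.map_comp, this])
  have hm : Triangle.mk u (y ≫ pC) (-O₁.m₁) ∈ distTriang 𝒯 := by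
    rw [← distinguished_shift_iff, ← distinguished_neg₂₃_iff, Functor.map_neg, neg_neg,
      ← distinguished_rotate_iff, hu, Functor.map_comp, ← Preadditive.neg_comp]
    exact O₁.mem
  -- the octahedron on `iA` and `s`
  obtain ⟨V, v, f, hV⟩ := distinguished_cocone_triangle (iA ≫ s)
  let O₂ := someOctahedron rfl hA hU hV
  have hq : pA ≫ O₂.m₁ = s ≫ v := O₂.comm₁
  have hvr : v ≫ O₂.m₃ = τ := O₂.comm₃
  -- The quotient of `U` by `A[1]` is an extension of `C[1]` by `D` with connecting morphism
  -- `-c[1]`, that is, a cone of `c`.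
  have hqr : Triangle.mk O₂.m₁ O₂.m₃ (-c⟦(1 : ℤ)⟧') ∈ distTriang 𝒯 := by
    rw [← comm_c, ← assoc]
    exact O₂.mem
  -- `f` is the connecting morphism of `A[1] ⟶ U ⟶ V`, and `g` is that of `U ⟶ Y ⟶ F` followed by
  -- `U[1] ⟶ V[1]`. Hence `g ≫ f[1]` contains two consecutive morphisms of a triangle.
  refine ⟨V, O₂.m₁, O₂.m₃, distinguished_rotate_iff.2 hqr, fun i p hi hp ↦
    ⟨f, -(O₁.m₁ ≫ v⟦(1 : ℤ)⟧'), ?_, ?_, ?_⟩⟩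
  · -- compatibility with the class `h₁`
    have hvp : (v ≫ p) ≫ μ = u ≫ pB := by
      have h₀ : ∀ φ : C⟦(1 : ℤ)⟧ ⟶ E, φ = 0 := fun φ ↦
        have := t.isLE_shift C 0 1 (-1)
        t.zero φ (-1) 0
      refine eq_of_mor₁_comp_eq hU h₀ ?_
      rw [reassoc_of% hsu, comm_d, ← hp, assoc, assoc, reassoc_of% hq]
    obtain ⟨φ, hφ₁, hφ₂⟩ := exists_third_morphism hm H₁ (v ≫ p) pB hvp.symm
    -- The filler `φ` commutes with the projection `Y ⟶ F`, and `Hom(U[1], F) = 0` leaves only the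
    -- identity.
    have hφ : φ = 𝟙 F := by
      have h₀ : ∀ φ : U⟦(1 : ℤ)⟧ ⟶ F, φ = 0 := fun φ ↦ by
        have hA₁ : t.IsLE (A⟦(1 : ℤ)⟧) 0 := by
          have := t.isLE_shift A 0 1 (-1)
          exact t.isLE_of_le _ (-1) 0
        have hC₁ : t.IsLE (C⟦(1 : ℤ)⟧) 0 := by
          have := t.isLE_shift C 0 1 (-1)
          exact t.isLE_of_le _ (-1) 0
        have hX : t.IsLE X 0 := t.isLE₂ _ hA 0 hA₁ ‹t.IsLE D 0›
        have : t.IsLE U 0 := t.isLE₂ _ hU 0 hX hC₁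
        have := t.isLE_shift U 0 1 (-1)
        exact t.zero φ (-1) 0
      refine eq_of_mor₂_comp_eq hm h₀ ?_
      rw [hφ₁, comp_id, comm_e]
    rw [hφ, id_comp] at hφ₂
    rw [Preadditive.neg_comp, assoc, ← Functor.map_comp, ← hφ₂, Preadditive.neg_comp]
  · -- compatibility with the class `k`
    have h₀ : ∀ (W : 𝒯) [t.IsLE W 0] (φ : W⟦(1 : ℤ)⟧⟦(1 : ℤ)⟧ ⟶ F), φ = 0 := fun W _ φ ↦ by
      have := t.isLE_shift W 0 1 (-1)
      have := t.isLE_shift (W⟦(1 : ℤ)⟧) (-1) 1 (-2)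
      exact t.zero φ (-2) 0
    -- As `Hom(B[1], F) = 0`, the inclusion of `B[1]` in `Y` factors through the fibre `U`.
    obtain ⟨β, hβ⟩ := exists_eq_comp_mor₁ hm iB (by
      have := t.isLE_shift B 0 1 (-1)
      exact t.zero _ (-1) 0)
    have hβτ : β ≫ τ = (b' ≫ κ)⟦(1 : ℤ)⟧' := by
      refine eq_of_comp_mor₁_eq hC (h₀ B) ?_
      rw [assoc, ← huy, ← assoc, ← hβ, comm_b]
    have hβa : a⟦(1 : ℤ)⟧' ≫ β = iA ≫ s := by
      refine eq_of_comp_mor₁_eq hm (h₀ A) ?_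
      rw [assoc, assoc, ← hβ, comm_a, hsu]
    -- `j : K[1] ⟶ V` is induced on the quotients by `A[1]`. Its composite with `r` is `κ[1]`, so
    -- `j` agrees with `-i`, because `Hom(K[1], D) = 0`. The sign cancels the one on the shifted
    -- class `k`.
    obtain ⟨j, hj₁, hj₂⟩ := exists_third_morphism (distinguished_shift_iff.2 Hk) hV (𝟙 _) β
      (hβa.trans (id_comp _).symm)
    have hjr : j ≫ O₂.m₃ = κ⟦(1 : ℤ)⟧' := by
      have h₀ : ∀ (φ : A⟦(1 : ℤ)⟧⟦(1 : ℤ)⟧ ⟶ C⟦(1 : ℤ)⟧), φ = 0 := fun φ ↦ by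
        have := t.isLE_shift A 0 1 (-1)
        have := t.isLE_shift (A⟦(1 : ℤ)⟧) (-1) 1 (-2)
        have := t.isGE_shift C 0 1 (-1)
        exact t.zero φ (-2) (-1)
      refine eq_of_mor₂_comp_eq (distinguished_shift_iff.2 Hk) h₀ ?_
      rw [reassoc_of% hj₁, hvr, hβτ, Functor.map_comp]
    have hij : i = -j := by
      refine eq_of_comp_mor₂_eq hqr (fun φ ↦ ?_) ?_
      · have := t.isLE_shift K 0 1 (-1)
        exact t.zero φ (-1) 0
      · rw [hi, Preadditive.neg_comp, hjr]
    rw [hij, Preadditive.neg_comp, ← hj₂, CategoryTheory.Functor.map_id, comp_id, neg_neg]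
  · rw [Preadditive.neg_comp, assoc, ← Functor.map_comp, mor₂_comp_mor₃ hV, Functor.map_zero,
      comp_zero, neg_zero]

omit t in
-- The relation `g ≫ f[1] = 0` lifts `g` to the fibre `U` of `f`, and octahedra then split `U` in
-- two ways. No degree argument is needed.
lemma HomologyData.nonempty_of_factorization {V : 𝒯} {q : D ⟶ V} {r : V ⟶ C⟦(1 : ℤ)⟧}
    (H : Triangle.mk c q r ∈ distTriang 𝒯) {i : K⟦(1 : ℤ)⟧ ⟶ V} {p : V ⟶ M}
    {w : M ⟶ K⟦(1 : ℤ)⟧⟦(1 : ℤ)⟧} (H' : Triangle.mk i p w ∈ distTriang 𝒯)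
    (hi : i ≫ r = -κ⟦(1 : ℤ)⟧') (hp : q ≫ p = d') {f : V ⟶ A⟦(1 : ℤ)⟧⟦(1 : ℤ)⟧}
    {g : F ⟶ V⟦(1 : ℤ)⟧} (hg : g ≫ p⟦(1 : ℤ)⟧' = h₁) (hf : i ≫ f = k⟦(1 : ℤ)⟧')
    (hgf : g ≫ f⟦(1 : ℤ)⟧' = 0) :
    Nonempty (HomologyData a (b' ≫ κ) c (d' ≫ μ) e) := by
  obtain ⟨U, l, v, hU⟩ := distinguished_cocone_triangle₂ f
  obtain ⟨X, iA, pA, hA⟩ := distinguished_cocone_triangle₂ (q ≫ f)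
  obtain ⟨g', hg'⟩ := exists_eq_comp_mor₂ (distinguished_shift_iff.2 hU) g (by
    rw [Preadditive.comp_neg, hgf, neg_zero])
  have hU' := distinguished_rotate_iff.1 (distinguished_rotate_iff.1 hU)
  -- the octahedron on `q` and `f`
  let O₁ := someOctahedron rfl (distinguished_rotate_iff.1 H) hU'
    (distinguished_rotate_iff.1 (distinguished_rotate_iff.1 hA))
  obtain ⟨s, hs⟩ := (shiftFunctor 𝒯 (1 : ℤ)).map_surjective O₁.m₃
  have hω : O₁.m₁ ≫ pA⟦(1 : ℤ)⟧' = c⟦(1 : ℤ)⟧' := by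
    have := O₁.comm₂
    rwa [Preadditive.comp_neg, neg_inj] at this
  have hl : iA ≫ s = l := (shiftFunctor 𝒯 (1 : ℤ)).map_injective (by
    have := O₁.comm₃
    rw [← hs, Preadditive.neg_comp, neg_inj] at this
    rw [Functor.map_comp, this])
  have hsv : s ≫ v = pA ≫ q := (shiftFunctor 𝒯 (1 : ℤ)).map_injective (by
    have := O₁.comm₄
    rw [← hs, Preadditive.neg_comp, Preadditive.comp_neg, neg_inj] at this
    rw [Functor.map_comp, Functor.map_comp, this])
  -- Pulling the filtration `D ⟶ V ⟶ C[1]` back to `U` makes `U` an extension of `C[1]` by `X`.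
  have hX : Triangle.mk s (v ≫ r) (-O₁.m₁) ∈ distTriang 𝒯 := by
    rw [← distinguished_shift_iff, ← distinguished_neg₂₃_iff, Functor.map_neg, neg_neg,
      ← distinguished_rotate_iff, hs, Functor.map_comp, ← Preadditive.neg_comp]
    exact O₁.mem
  obtain ⟨Y, u, π, hY⟩ := distinguished_cocone_triangle₂ g'
  -- the octahedron on `s` and `u`
  obtain ⟨Z, y, z, hT⟩ := distinguished_cocone_triangle (s ≫ u)
  let O₂ := someOctahedron rfl hX hY hT
  -- the octahedron on `i` and `f`
  have Hk' : Triangle.mk (i ≫ f) (-a⟦(1 : ℤ)⟧'⟦(1 : ℤ)⟧') (b'⟦(1 : ℤ)⟧'⟦(1 : ℤ)⟧') ∈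
      distTriang 𝒯 := by
    have := distinguished_shift_iff.2 (distinguished_rotate_iff.1 (distinguished_rotate_iff.1 Hk))
    rw [Functor.map_neg, Functor.map_neg, neg_neg, ← hf] at this
    exact this
  let O₃ := someOctahedron rfl H' hU' Hk'
  obtain ⟨β, hβ⟩ := (shiftFunctor 𝒯 (1 : ℤ)).map_surjective O₃.m₃
  have hal : a⟦(1 : ℤ)⟧' ≫ β = l := (shiftFunctor 𝒯 (1 : ℤ)).map_injective (by
    have := O₃.comm₃
    rw [← hβ, Preadditive.neg_comp, neg_inj] at this
    rw [Functor.map_comp, this])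
  have hβv : β ≫ v = -(b'⟦(1 : ℤ)⟧' ≫ i) := (shiftFunctor 𝒯 (1 : ℤ)).map_injective (by
    have := O₃.comm₄
    rw [← hβ, Preadditive.comp_neg] at this
    rw [Functor.map_comp, Functor.map_neg, Functor.map_comp, this, neg_neg])
  -- Pulling back the other filtration `K[1] ⟶ V ⟶ M` makes `U` an extension of `M` by `B[1]`: the
  -- piece above `K[1]` has class `i ≫ f = k[1]`.
  have hU'' : Triangle.mk β (v ≫ p) (-O₃.m₁) ∈ distTriang 𝒯 := by
    rw [← distinguished_shift_iff, ← distinguished_neg₂₃_iff, Functor.map_neg, neg_neg,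
      ← distinguished_rotate_iff, hβ, Functor.map_comp, ← Preadditive.neg_comp]
    exact O₃.mem
  -- the octahedron on `β` and `u`
  obtain ⟨E', ρ, σ, hB⟩ := distinguished_cocone_triangle (β ≫ u)
  let O₄ := someOctahedron rfl hU'' hY hB
  -- `E'`, the quotient of `Y` by `B[1]`, is an extension of `F` by `M` whose class is `g ≫ p[1] =
  -- h₁`; hence it is isomorphic to `E`.
  have hE : Triangle.mk O₄.m₁ O₄.m₃ h₁ ∈ distTriang 𝒯 := by
    rw [← hg, hg', assoc, ← Functor.map_comp]
    exact O₄.mem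
  obtain ⟨ε, hε₁, hε₂⟩ := exists_second_iso hE H₁
  have hB' : Triangle.mk (β ≫ u) (ρ ≫ ε.hom) (ε.inv ≫ σ) ∈ distTriang 𝒯 :=
    (distinguished_iff_of_isos (Iso.refl _) (Iso.refl _) ε.symm (by simp) (by simp) (by simp)).2 hB
  have huρ : u ≫ ρ ≫ ε.hom = v ≫ p ≫ μ := by
    rw [← hε₁]
    simpa using (O₄.comm₁ =≫ ε.hom).symm
  exact ⟨{
    distinguished := hT
    distinguished_A := hA
    distinguished_B := hB'
    distinguished_C := O₂.mem
    comm_a := by rw [reassoc_of% hal, ← hl, assoc]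
    comm_b := by
      have h₁ := O₂.comm₁
      rw [assoc] at h₁
      rw [assoc, ← h₁, reassoc_of% hβv, Preadditive.neg_comp, assoc, reassoc_of% hi]
      simp
    comm_c := by
      rw [← assoc, O₂.comm₂, Preadditive.neg_comp, hω]
    comm_d := by
      rw [assoc, huρ, reassoc_of% hsv, reassoc_of% hp]
    comm_e := by
      rw [assoc, hε₂, O₄.comm₃, O₂.comm₃] }⟩

end Core

/-! ### Homology in the heart and truncations. -/

section HeartHomology

variable {𝒯 : Type u'} [Category.{v'} 𝒯] [Preadditive 𝒯] [HasZeroObject 𝒯] [HasShift 𝒯 ℤ]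
  [∀ n : ℤ, (shiftFunctor 𝒯 n).Additive] [Pretriangulated 𝒯] [IsTriangulated 𝒯]
  (t : TStructure 𝒯) (𝒜 : Type u) [Category.{v} 𝒜] [Abelian 𝒜] [t.Heart 𝒜]

/-- The functor `heartHomology t 𝒜` is `τ^{≥ 0} τ^{≤ 0}`. -/
def heartHomologyCompιIso : heartHomology t 𝒜 ⋙ t.ιHeart ≅ t.truncGELE 0 0 :=
  Functor.isoWhiskerLeft (t.heart.lift (t.truncGELE 0 0)
    (fun _ ↦ (t.mem_heart_iff _).2 ⟨inferInstance, inferInstance⟩))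
    (Functor.isoWhiskerRight (toHeart t 𝒜).asEquivalence.counitIso t.heart.ι)

instance : (heartHomology t 𝒜 ⋙ t.ιHeart).Additive :=
  have : (t.truncGELE 0 0).Additive := inferInstanceAs (t.truncLE 0 ⋙ t.truncGE 0).Additive
  Functor.additive_of_iso (heartHomologyCompιIso t 𝒜).symm

instance : (heartHomology t 𝒜).Additive where
  map_add {X Y f g} := t.ιHeart.map_injective (by
    rw [Functor.map_add (t.ιHeart (H := 𝒜))]
    exact (heartHomology t 𝒜 ⋙ t.ιHeart).map_add)

lemma isIso_heartHomology_map_iff {X Y : 𝒯} (f : X ⟶ Y) :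
    IsIso ((heartHomology t 𝒜).map f) ↔ IsIso ((t.truncGELE 0 0).map f) := by
  rw [← isIso_iff_of_reflects_iso _ (t.ιHeart (H := 𝒜)), ← Functor.comp_map]
  exact NatIso.isIso_map_iff (heartHomologyCompιIso t 𝒜) f

lemma isZero_heartHomology_obj_iff (X : 𝒯) :
    IsZero ((heartHomology t 𝒜).obj X) ↔ IsZero ((t.truncGELE 0 0).obj X) := by
  rw [← ((heartHomologyCompιIso t 𝒜).app X).isZero_iff]
  refine ⟨fun h ↦ (t.ιHeart (H := 𝒜)).map_isZero h, fun h ↦ ?_⟩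
  rw [IsZero.iff_id_eq_zero] at h ⊢
  apply (t.ιHeart (H := 𝒜)).map_injective
  simpa using h

section

variable {X Y Z : 𝒯} {f : X ⟶ Y} {g : Y ⟶ Z} {h : Z ⟶ X⟦(1 : ℤ)⟧}
  (hT : Triangle.mk f g h ∈ distTriang 𝒯)

include hT

/-- Already `τ^{≤ 0} f` is invertible. Only truncations are used, not the long exact homology
sequence. -/
lemma isIso_heartHomology_map_of_isGE [hZ : t.IsGE Z 1] : IsIso ((heartHomology t 𝒜).map f) := by
  rw [isIso_heartHomology_map_iff]
  have : IsIso ((t.truncLE 0).map f) := t.isIso₁_truncLE_map_of_isGE _ hT 0 1 rfl hZ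
  exact inferInstanceAs (IsIso ((t.truncGE 0).map ((t.truncLE 0).map f)))

lemma isIso_heartHomology_map_of_isLE [hX : t.IsLE X (-1)] :
    IsIso ((heartHomology t 𝒜).map g) := by
  rw [isIso_heartHomology_map_iff, NatIso.isIso_map_iff (t.truncGELEIsoLEGE 0 0)]
  have : IsIso ((t.truncGE 0).map g) := t.isIso₂_truncGE_map_of_isLE _ hT (-1) 0 rfl hX
  exact inferInstanceAs (IsIso ((t.truncLE 0).map ((t.truncGE 0).map g)))

omit [IsTriangulated 𝒯] in
-- Shifting by `n` introduces signs `(-1)^n`. Recording them as a unit is enough, since they do not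
-- affect invertibility on homology.
lemma exists_shift_distinguished (n : ℤ) :
    ∃ (u : ℤˣ) (h' : Z⟦n⟧ ⟶ X⟦n⟧⟦(1 : ℤ)⟧),
      Triangle.mk (u • f⟦n⟧') (u • g⟦n⟧') h' ∈ distTriang 𝒯 :=
  ⟨n.negOnePow, _, Triangle.shift_distinguished _ hT n⟩

omit hT in
lemma isIso_map_of_isIso_map_units_smul {V W : 𝒯} (φ : V ⟶ W) (u : ℤˣ)
    (h : IsIso ((heartHomology t 𝒜).map (u • φ))) : IsIso ((heartHomology t 𝒜).map φ) := by
  obtain rfl | rfl := Int.units_eq_one_or u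
  · simpa using h
  · rw [Units.neg_smul, one_smul, Functor.map_neg] at h
    exact ⟨-inv (-(heartHomology t 𝒜).map φ), by
      rw [← Preadditive.neg_comp_neg, neg_neg, IsIso.hom_inv_id], by
      rw [← Preadditive.neg_comp_neg, neg_neg, IsIso.inv_hom_id]⟩

lemma isIso_heartHomology_map_shift_of_isGE (n m : ℤ) [hZ : t.IsGE Z m] (hnm : n < m := by lia) :
    IsIso ((heartHomology t 𝒜).map (f⟦n⟧')) := by
  obtain ⟨u, h', H⟩ := exists_shift_distinguished hT n
  have := t.isGE_shift Z m n (m - n)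
  have : t.IsGE (Z⟦n⟧) 1 := t.isGE_of_ge _ 1 (m - n)
  exact isIso_map_of_isIso_map_units_smul t 𝒜 _ u (isIso_heartHomology_map_of_isGE t 𝒜 H)

lemma isIso_heartHomology_map_shift_of_isLE (n m : ℤ) [hX : t.IsLE X m] (hnm : m < n := by lia) :
    IsIso ((heartHomology t 𝒜).map (g⟦n⟧')) := by
  obtain ⟨u, h', H⟩ := exists_shift_distinguished hT n
  have := t.isLE_shift X m n (m - n)
  have : t.IsLE (X⟦n⟧) (-1) := t.isLE_of_le _ (m - n) (-1)
  exact isIso_map_of_isIso_map_units_smul t 𝒜 _ u (isIso_heartHomology_map_of_isLE t 𝒜 H)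

end

lemma isZero_heartHomology_obj_of_isGE (X : 𝒯) [t.IsGE X 1] :
    IsZero ((heartHomology t 𝒜).obj X) := by
  rw [isZero_heartHomology_obj_iff]
  exact (t.truncGE 0).map_isZero (t.isZero_truncLE_obj_of_isGE 0 1 rfl X)

lemma isZero_heartHomology_obj_of_isLE (X : 𝒯) [t.IsLE X (-1)] :
    IsZero ((heartHomology t 𝒜).obj X) := by
  rw [isZero_heartHomology_obj_iff, ((t.truncGELEIsoLEGE 0 0).app X).isZero_iff]
  exact (t.truncLE 0).map_isZero (t.isZero_truncGE_obj_of_isLE (-1) 0 rfl X)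

/-- For `X` in degrees `≥ 0`, the homology is `τ^{≤ 0} X`, the obstruction to `X` being in degrees
`≥ 1`. -/
lemma isGE_one_of_isZero_heartHomology_obj (X : 𝒯) [t.IsGE X 0]
    (h : IsZero ((heartHomology t 𝒜).obj X)) : t.IsGE X 1 := by
  rw [t.isGE_iff_isZero_truncLE_obj 0 1 rfl]
  rw [isZero_heartHomology_obj_iff] at h
  exact h.of_iso (asIso ((t.truncGEπ 0).app ((t.truncLE 0).obj X)))

lemma isLE_neg_one_of_isZero_heartHomology_obj (X : 𝒯) [t.IsLE X 0]
    (h : IsZero ((heartHomology t 𝒜).obj X)) : t.IsLE X (-1) := by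
  rw [t.isLE_iff_isZero_truncGE_obj (-1) 0 rfl]
  rw [isZero_heartHomology_obj_iff, ((t.truncGELEIsoLEGE 0 0).app X).isZero_iff] at h
  have : t.IsLE ((t.truncGE 0).obj X) 0 := inferInstance
  exact h.of_iso (asIso ((t.truncLEι 0).app ((t.truncGE 0).obj X))).symm

/-- The functor `τ^{≥ 0} τ^{≤ 0}` is isomorphic to the identity on the heart. -/
def ιHeartCompTruncGELEIso : (t.ιHeart (H := 𝒜)) ⋙ t.truncGELE 0 0 ≅ t.ιHeart :=
  (NatIso.ofComponents
    (F := t.ιHeart (H := 𝒜) ⋙ t.truncLE 0) (G := t.ιHeart (H := 𝒜) ⋙ t.truncGELE 0 0)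
    (fun A ↦ asIso ((t.truncGEπ 0).app ((t.truncLE 0).obj (t.ιHeart.obj A))))
    (fun f ↦ (t.truncGEπ 0).naturality ((t.truncLE 0).map (t.ιHeart.map f)))).symm ≪≫
  NatIso.ofComponents
    (F := t.ιHeart (H := 𝒜) ⋙ t.truncLE 0) (G := t.ιHeart (H := 𝒜))
    (fun A ↦ asIso ((t.truncLEι 0).app (t.ιHeart.obj A)))
    (fun f ↦ (t.truncLEι 0).naturality (t.ιHeart.map f))

/-- Objects in the heart are their own homology. -/
def ιHeartCompHeartHomologyIso : t.ιHeart ⋙ heartHomology t 𝒜 ≅ 𝟭 𝒜 :=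
  Functor.fullyFaithfulCancelRight (t.ιHeart (H := 𝒜))
    (Functor.associator _ _ _ ≪≫ Functor.isoWhiskerLeft _ (heartHomologyCompιIso t 𝒜) ≪≫
      ιHeartCompTruncGELEIso t 𝒜)

end HeartHomology

lemma nonempty_mk₅_iso_iff {C : Type u} [Category.{v} C] {X₀ X₁ X₂ X₃ X₄ X₅ : C} {f₀ : X₀ ⟶ X₁}
    {f₁ : X₁ ⟶ X₂} {f₂ : X₂ ⟶ X₃} {f₃ : X₃ ⟶ X₄} {f₄ : X₄ ⟶ X₅} {Y₀ Y₁ Y₂ Y₃ Y₄ Y₅ : C}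
    {g₀ : Y₀ ⟶ Y₁} {g₁ : Y₁ ⟶ Y₂} {g₂ : Y₂ ⟶ Y₃} {g₃ : Y₃ ⟶ Y₄} {g₄ : Y₄ ⟶ Y₅} :
    Nonempty (ComposableArrows.mk₅ f₀ f₁ f₂ f₃ f₄ ≅ ComposableArrows.mk₅ g₀ g₁ g₂ g₃ g₄) ↔
      ∃ (e₀ : X₀ ≅ Y₀) (e₁ : X₁ ≅ Y₁) (e₂ : X₂ ≅ Y₂) (e₃ : X₃ ≅ Y₃) (e₄ : X₄ ≅ Y₄)
        (e₅ : X₅ ≅ Y₅), f₀ ≫ e₁.hom = e₀.hom ≫ g₀ ∧ f₁ ≫ e₂.hom = e₁.hom ≫ g₁ ∧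
          f₂ ≫ e₃.hom = e₂.hom ≫ g₂ ∧ f₃ ≫ e₄.hom = e₃.hom ≫ g₃ ∧ f₄ ≫ e₅.hom = e₄.hom ≫ g₄ := by
  refine ⟨fun ⟨e⟩ ↦ ⟨e.app 0, e.app 1, e.app 2, e.app 3, e.app 4, e.app 5, ?_, ?_, ?_, ?_, ?_⟩,
    fun ⟨e₀, e₁, e₂, e₃, e₄, e₅, h₀, h₁, h₂, h₃, h₄⟩ ↦
      ⟨ComposableArrows.isoMk₅ e₀ e₁ e₂ e₃ e₄ e₅ h₀ h₁ h₂ h₃ h₄⟩⟩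
  · exact ComposableArrows.naturality' e.hom 0 1
  · exact ComposableArrows.naturality' e.hom 1 2
  · exact ComposableArrows.naturality' e.hom 2 3
  · exact ComposableArrows.naturality' e.hom 3 4
  · exact ComposableArrows.naturality' e.hom 4 5

/-! ### Replacing a triangle by one in degrees `[0, 1]`, for a possibly degenerate t-structure. -/

section Reduction

variable {𝒯 : Type u'} [Category.{v'} 𝒯] [Preadditive 𝒯] [HasZeroObject 𝒯] [HasShift 𝒯 ℤ]
  [∀ n : ℤ, (shiftFunctor 𝒯 n).Additive] [Pretriangulated 𝒯] [IsTriangulated 𝒯]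
  (t : TStructure 𝒯) (𝒜 : Type u) [Category.{v} 𝒜] [Abelian 𝒜] [t.Heart 𝒜]

/-- Morphisms which induce isomorphisms on homology in all degrees. -/
def IsHomologyIso {X Y : 𝒯} (f : X ⟶ Y) : Prop :=
  ∀ n : ℤ, IsIso ((heartHomology t 𝒜).map (f⟦n⟧'))

namespace IsHomologyIso

variable {t 𝒜} {X Y Z : 𝒯} {f : X ⟶ Y} {g : Y ⟶ Z}

lemma comp (hf : IsHomologyIso t 𝒜 f) (hg : IsHomologyIso t 𝒜 g) :
    IsHomologyIso t 𝒜 (f ≫ g) := fun n ↦ by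
  have := hf n
  have := hg n
  rw [Functor.map_comp, Functor.map_comp]
  infer_instance

lemma of_isIso (f : X ⟶ Y) [IsIso f] : IsHomologyIso t 𝒜 f := fun _ ↦ inferInstance

lemma neg (hf : IsHomologyIso t 𝒜 f) : IsHomologyIso t 𝒜 (-f) := fun n ↦ by
  rw [Functor.map_neg]
  refine isIso_map_of_isIso_map_units_smul t 𝒜 _ (-1) ?_
  rw [Units.neg_smul, one_smul, neg_neg]
  exact hf n

lemma of_shift (hf : IsHomologyIso t 𝒜 (f⟦(1 : ℤ)⟧')) : IsHomologyIso t 𝒜 f := fun n ↦ by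
  have h : IsIso ((heartHomology t 𝒜).map (f⟦(1 : ℤ)⟧'⟦n - 1⟧')) := hf (n - 1)
  have e := NatIso.isIso_map_iff (Functor.isoWhiskerRight
    (shiftFunctorAdd' 𝒯 1 (n - 1) n (by lia)) (heartHomology t 𝒜)) f
  rw [Functor.comp_map, Functor.comp_map, Functor.comp_map] at e
  exact e.2 h

lemma isIso_map (hf : IsHomologyIso t 𝒜 f) : IsIso ((heartHomology t 𝒜).map f) :=
  (NatIso.isIso_map_iff (Functor.isoWhiskerRight
    (shiftFunctorZero 𝒯 ℤ) (heartHomology t 𝒜)) f).1 (hf 0)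

lemma isZero_iff (hf : IsHomologyIso t 𝒜 f) (n : ℤ) :
    IsZero ((heartHomology t 𝒜).obj (X⟦n⟧)) ↔ IsZero ((heartHomology t 𝒜).obj (Y⟦n⟧)) :=
  have := hf n
  (asIso ((heartHomology t 𝒜).map (f⟦n⟧'))).isZero_iff

variable {h : Z ⟶ X⟦(1 : ℤ)⟧} (hT : Triangle.mk f g h ∈ distTriang 𝒯)

include hT

/-- An object in `t.ge n` for all `n` has no homology but need not be zero. This lemma and the next
three let such an object be an outer term of a triangle without affecting homology. -/
lemma of_isGE₃ (hZ : ∀ n, t.IsGE Z n) : IsHomologyIso t 𝒜 f := fun n ↦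
  have := hZ (n + 1)
  isIso_heartHomology_map_shift_of_isGE t 𝒜 hT n (n + 1)

lemma of_isLE₁ (hX : ∀ n, t.IsLE X n) : IsHomologyIso t 𝒜 g := fun n ↦
  have := hX (n - 1)
  isIso_heartHomology_map_shift_of_isLE t 𝒜 hT n (n - 1)

lemma of_isLE₃ (hZ : ∀ n, t.IsLE Z n) : IsHomologyIso t 𝒜 f := by
  have := (of_isLE₁ (𝒜 := 𝒜) (distinguished_rotate_iff.1 (distinguished_rotate_iff.1 hT)) hZ).neg
  rw [neg_neg] at this
  exact this.of_shift

lemma of_isGE₁ (hX : ∀ n, t.IsGE X n) : IsHomologyIso t 𝒜 g :=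
  of_isGE₃ (distinguished_rotate_iff.1 hT) (fun n ↦
    have := hX (n + 1)
    t.isGE_shift X (n + 1) 1 n)

end IsHomologyIso

omit [IsTriangulated 𝒯] in
lemma truncation_distinguished (a b : ℤ) (h : a + 1 = b) (X : 𝒯) :
    Triangle.mk (Y := X) ((t.truncLEι a).app X) ((t.truncGEπ b).app X)
      ((t.truncGEδLE a b h).app X) ∈ distTriang 𝒯 :=
  t.triangleLEGE_distinguished a b h X

lemma isGE_shift_heartHomology (X : 𝒯) (n : ℤ) [t.IsGE X n]
    (h : IsZero ((heartHomology t 𝒜).obj (X⟦n⟧))) : t.IsGE X (n + 1) := by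
  have := t.isGE_shift X n n 0
  have := isGE_one_of_isZero_heartHomology_obj t 𝒜 _ h
  exact t.isGE_of_shift X (n + 1) n 1

lemma isLE_shift_heartHomology (X : 𝒯) (n : ℤ) [t.IsLE X n]
    (h : IsZero ((heartHomology t 𝒜).obj (X⟦n⟧))) : t.IsLE X (n - 1) := by
  have := t.isLE_shift X n n 0
  have := isLE_neg_one_of_isZero_heartHomology_obj t 𝒜 _ h
  exact t.isLE_of_shift X (n - 1) n (-1)

/-- Each vanishing homology object raises the lower bound by one. The truncation need not vanish, as
`t` may be degenerate. -/
lemma isGE_truncGE_of_isZero_heartHomology (X : 𝒯) (n₀ : ℤ)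
    (h : ∀ n, n₀ ≤ n → IsZero ((heartHomology t 𝒜).obj (X⟦n⟧))) (n : ℤ) :
    t.IsGE ((t.truncGE n₀).obj X) n := by
  obtain hn | hn := le_total n n₀
  · exact t.isGE_of_ge _ n n₀
  induction n, hn using Int.leInduction with
  | base => infer_instance
  | succ n hn ih =>
    refine isGE_shift_heartHomology t 𝒜 _ n ?_
    have : t.IsLE ((t.truncLE (n₀ - 1)).obj X) (n₀ - 1) := inferInstance
    have := isIso_heartHomology_map_shift_of_isLE t 𝒜
      (truncation_distinguished t (n₀ - 1) n₀ (by lia) X) n (n₀ - 1)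
    exact (h n hn).of_iso (asIso ((heartHomology t 𝒜).map (((t.truncGEπ n₀).app X)⟦n⟧'))).symm

lemma isLE_truncLE_of_isZero_heartHomology (X : 𝒯) (n₀ : ℤ)
    (h : ∀ n, n ≤ n₀ → IsZero ((heartHomology t 𝒜).obj (X⟦n⟧))) (n : ℤ) :
    t.IsLE ((t.truncLE n₀).obj X) n := by
  obtain hn | hn := le_total n₀ n
  · exact t.isLE_of_le _ n₀ n
  induction n, hn using Int.leInductionDown with
  | base => infer_instance
  | pred n hn ih =>
    refine isLE_shift_heartHomology t 𝒜 _ n ?_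
    have : t.IsGE ((t.truncGE (n₀ + 1)).obj X) (n₀ + 1) := inferInstance
    have := isIso_heartHomology_map_shift_of_isGE t 𝒜
      (truncation_distinguished t n₀ (n₀ + 1) (by lia) X) n (n₀ + 1)
    exact (h n hn).of_iso (asIso ((heartHomology t 𝒜).map (((t.truncLEι n₀).app X)⟦n⟧')))

lemma nonempty_homologyArrows_iso {X Y Z X' Y' Z' : 𝒯} {x : X ⟶ Y} {y : Y ⟶ Z}
    {z : Z ⟶ X⟦(1 : ℤ)⟧} {x' : X' ⟶ Y'} {y' : Y' ⟶ Z'} {z' : Z' ⟶ X'⟦(1 : ℤ)⟧}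
    {φ₁ : X ⟶ X'} {φ₂ : Y ⟶ Y'} {φ₃ : Z ⟶ Z'} (hφ₁ : IsHomologyIso t 𝒜 φ₁)
    (hφ₂ : IsHomologyIso t 𝒜 φ₂) (hφ₃ : IsHomologyIso t 𝒜 φ₃) (h₁ : x ≫ φ₂ = φ₁ ≫ x')
    (h₂ : y ≫ φ₃ = φ₂ ≫ y') (h₃ : z ≫ φ₁⟦(1 : ℤ)⟧' = φ₃ ≫ z') :
    Nonempty (homologyArrows t 𝒜 (Triangle.mk x y z) ≅
      homologyArrows t 𝒜 (Triangle.mk x' y' z')) := by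
  have := hφ₁.isIso_map
  have := hφ₂.isIso_map
  have := hφ₃.isIso_map
  have := hφ₁ 1
  have := hφ₂ 1
  have := hφ₃ 1
  change Nonempty (ComposableArrows.mk₅ ((heartHomology t 𝒜).map x) ((heartHomology t 𝒜).map y)
    ((heartHomology t 𝒜).map z) ((heartHomology t 𝒜).map (x⟦(1 : ℤ)⟧'))
    ((heartHomology t 𝒜).map (y⟦(1 : ℤ)⟧')) ≅ ComposableArrows.mk₅ ((heartHomology t 𝒜).map x')
    ((heartHomology t 𝒜).map y') ((heartHomology t 𝒜).map z')
    ((heartHomology t 𝒜).map (x'⟦(1 : ℤ)⟧')) ((heartHomology t 𝒜).map (y'⟦(1 : ℤ)⟧')))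
  refine nonempty_mk₅_iso_iff.2 ⟨asIso ((heartHomology t 𝒜).map φ₁),
    asIso ((heartHomology t 𝒜).map φ₂), asIso ((heartHomology t 𝒜).map φ₃),
    asIso ((heartHomology t 𝒜).map (φ₁⟦(1 : ℤ)⟧')),
    asIso ((heartHomology t 𝒜).map (φ₂⟦(1 : ℤ)⟧')), asIso ((heartHomology t 𝒜).map (φ₃⟦(1 : ℤ)⟧')),
    ?_, ?_, ?_, ?_, ?_⟩
  · exact ((heartHomology t 𝒜).map_comp _ _).symm.trans
      ((congrArg (heartHomology t 𝒜).map h₁).trans ((heartHomology t 𝒜).map_comp _ _))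
  · exact ((heartHomology t 𝒜).map_comp _ _).symm.trans
      ((congrArg (heartHomology t 𝒜).map h₂).trans ((heartHomology t 𝒜).map_comp _ _))
  · exact ((heartHomology t 𝒜).map_comp _ _).symm.trans
      ((congrArg (heartHomology t 𝒜).map h₃).trans ((heartHomology t 𝒜).map_comp _ _))
  · exact ((shiftFunctor 𝒯 (1 : ℤ) ⋙ heartHomology t 𝒜).map_comp _ _).symm.trans
      ((congrArg (shiftFunctor 𝒯 (1 : ℤ) ⋙ heartHomology t 𝒜).map h₁).trans
        ((shiftFunctor 𝒯 (1 : ℤ) ⋙ heartHomology t 𝒜).map_comp _ _))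
  · exact ((shiftFunctor 𝒯 (1 : ℤ) ⋙ heartHomology t 𝒜).map_comp _ _).symm.trans
      ((congrArg (shiftFunctor 𝒯 (1 : ℤ) ⋙ heartHomology t 𝒜).map h₂).trans
        ((shiftFunctor 𝒯 (1 : ℤ) ⋙ heartHomology t 𝒜).map_comp _ _))

/-- A triangle whose homology is concentrated in degrees `≤ n` can be replaced by a triangle
of objects in `t.le n`. -/
lemma exists_distinguished_isLE (n : ℤ) {X Y Z : 𝒯} {x : X ⟶ Y} {y : Y ⟶ Z} {z : Z ⟶ X⟦(1 : ℤ)⟧}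
    (hT : Triangle.mk x y z ∈ distTriang 𝒯)
    (hX : ∀ m, n < m → IsZero ((heartHomology t 𝒜).obj (X⟦m⟧)))
    (hY : ∀ m, n < m → IsZero ((heartHomology t 𝒜).obj (Y⟦m⟧))) :
    ∃ (X' Y' Z' : 𝒯) (x' : X' ⟶ Y') (y' : Y' ⟶ Z') (z' : Z' ⟶ X'⟦(1 : ℤ)⟧)
      (_ : Triangle.mk x' y' z' ∈ distTriang 𝒯) (φ₁ : X' ⟶ X) (φ₂ : Y' ⟶ Y) (φ₃ : Z' ⟶ Z),
      t.IsLE X' n ∧ t.IsLE Y' n ∧ t.IsLE Z' n ∧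
      IsHomologyIso t 𝒜 φ₁ ∧ IsHomologyIso t 𝒜 φ₂ ∧ IsHomologyIso t 𝒜 φ₃ ∧
      x' ≫ φ₂ = φ₁ ≫ x ∧ y' ≫ φ₃ = φ₂ ≫ y ∧ z' ≫ φ₁⟦(1 : ℤ)⟧' = φ₃ ≫ z := by
  have hX' := isGE_truncGE_of_isZero_heartHomology t 𝒜 X (n + 1) (fun m hm ↦ hX m (by lia))
  have hY' := isGE_truncGE_of_isZero_heartHomology t 𝒜 Y (n + 1) (fun m hm ↦ hY m (by lia))
  have tX := truncation_distinguished t n (n + 1) rfl X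
  have tY := truncation_distinguished t n (n + 1) rfl Y
  let x' := (t.truncLE n).map x
  have hx' : x' ≫ (t.truncLEι n).app Y = (t.truncLEι n).app X ≫ x := (t.truncLEι n).naturality x
  -- A filler from (TR3) would be uncontrolled on homology. Passing through the cone `Z₁` of `τ^{≤
  -- n} X ⟶ Y` gives `Z' ⟶ Z₁ ⟶ Z`, whose two steps differ from isomorphisms only by `τ^{> n} Y` and
  -- `τ^{> n} X`.
  obtain ⟨Z₁, y₁, z₁, h₁⟩ := distinguished_cocone_triangle ((t.truncLEι n).app X ≫ x)
  obtain ⟨Z', y', z', h'⟩ := distinguished_cocone_triangle x'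
  let O₁ := someOctahedron rfl tX hT h₁
  let O₂ := someOctahedron hx' h' tY h₁
  have hXn : t.IsLE ((t.truncLE n).obj X) n := inferInstance
  have hYn : t.IsLE ((t.truncLE n).obj Y) n := inferInstance
  refine ⟨_, _, _, x', y', z', h', (t.truncLEι n).app X, (t.truncLEι n).app Y, O₂.m₁ ≫ O₁.m₃,
    hXn, hYn, ?_, .of_isGE₃ tX hX', .of_isGE₃ tY hY',
    .comp (.of_isGE₃ O₂.mem hY') (.of_isGE₁ O₁.mem hX'), hx', ?_, ?_⟩
  · have hX₁ : t.IsLE (((t.truncLE n).obj X)⟦(1 : ℤ)⟧) n := by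
      have := t.isLE_shift ((t.truncLE n).obj X) n 1 (n - 1)
      exact t.isLE_of_le _ (n - 1) n
    exact t.isLE₂ _ (distinguished_rotate_iff.1 h') n hYn hX₁
  · rw [← assoc, O₂.comm₁, assoc, O₁.comm₃]
  · rw [assoc, ← O₁.comm₄, ← assoc, O₂.comm₂]

/-- A triangle whose homology is concentrated in degrees `≥ n` can be replaced by a triangle
of objects in `t.ge n`. -/
lemma exists_distinguished_isGE (n m : ℤ) {X Y Z : 𝒯} {x : X ⟶ Y} {y : Y ⟶ Z}
    {z : Z ⟶ X⟦(1 : ℤ)⟧} (hT : Triangle.mk x y z ∈ distTriang 𝒯)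
    [hXm : t.IsLE X m] [hYm : t.IsLE Y m] [hZm : t.IsLE Z m]
    (hY : ∀ m, m < n → IsZero ((heartHomology t 𝒜).obj (Y⟦m⟧)))
    (hZ : ∀ m, m < n → IsZero ((heartHomology t 𝒜).obj (Z⟦m⟧))) :
    ∃ (X' Y' Z' : 𝒯) (x' : X' ⟶ Y') (y' : Y' ⟶ Z') (z' : Z' ⟶ X'⟦(1 : ℤ)⟧)
      (_ : Triangle.mk x' y' z' ∈ distTriang 𝒯) (φ₁ : X ⟶ X') (φ₂ : Y ⟶ Y') (φ₃ : Z ⟶ Z'),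
      t.IsGE X' n ∧ t.IsGE Y' n ∧ t.IsGE Z' n ∧ t.IsLE X' m ∧ t.IsLE Y' m ∧ t.IsLE Z' m ∧
      IsHomologyIso t 𝒜 φ₁ ∧ IsHomologyIso t 𝒜 φ₂ ∧ IsHomologyIso t 𝒜 φ₃ ∧
      x ≫ φ₂ = φ₁ ≫ x' ∧ y ≫ φ₃ = φ₂ ≫ y' ∧ z ≫ φ₁⟦(1 : ℤ)⟧' = φ₃ ≫ z' := by
  have hY' := isLE_truncLE_of_isZero_heartHomology t 𝒜 Y (n - 1) (fun m hm ↦ hY m (by lia))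
  have hZ' := isLE_truncLE_of_isZero_heartHomology t 𝒜 Z (n - 1) (fun m hm ↦ hZ m (by lia))
  have hY₁ (k : ℤ) : t.IsLE (((t.truncLE (n - 1)).obj Y)⟦(1 : ℤ)⟧) k :=
    have := hY' (k + 1)
    t.isLE_shift _ (k + 1) 1 k
  have hZ₁ (k : ℤ) : t.IsLE (((t.truncLE (n - 1)).obj Z)⟦(1 : ℤ)⟧) k :=
    have := hZ' (k + 1)
    t.isLE_shift _ (k + 1) 1 k
  have tY := truncation_distinguished t (n - 1) n (by lia) Y
  have tZ := truncation_distinguished t (n - 1) n (by lia) Z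
  let y' := (t.truncGE n).map y
  have hy' : (t.truncGEπ n).app Y ≫ y' = y ≫ (t.truncGEπ n).app Z :=
    ((t.truncGEπ n).naturality y).symm
  -- As in the dual case, `X ⟶ X'` is factored through the fibre `X₁` of `Y ⟶ τ^{≥ n} Z`, so that
  -- only `τ^{< n} Z` and `τ^{< n} Y` intervene.
  obtain ⟨X₁, x₁, z₁, h₁⟩ := distinguished_cocone_triangle₁ (y ≫ (t.truncGEπ n).app Z)
  obtain ⟨X', x', z', h'⟩ := distinguished_cocone_triangle₁ y'
  let O₁ := someOctahedron rfl (distinguished_rotate_iff.1 hT) (distinguished_rotate_iff.1 tZ)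
    (distinguished_rotate_iff.1 h₁)
  let O₂ := someOctahedron hy' (distinguished_rotate_iff.1 tY) (distinguished_rotate_iff.1 h')
    (distinguished_rotate_iff.1 h₁)
  obtain ⟨φ, hφ⟩ := (shiftFunctor 𝒯 (1 : ℤ)).map_surjective O₁.m₁
  obtain ⟨ψ, hψ⟩ := (shiftFunctor 𝒯 (1 : ℤ)).map_surjective O₂.m₃
  have hφ' : IsHomologyIso t 𝒜 φ := by
    apply IsHomologyIso.of_shift
    rw [hφ]
    exact .of_isLE₃ O₁.mem hZ₁
  have hψ' : IsHomologyIso t 𝒜 ψ := by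
    apply IsHomologyIso.of_shift
    rw [hψ]
    exact .of_isLE₁ O₂.mem hY₁
  have hYn : t.IsGE ((t.truncGE n).obj Y) n := inferInstance
  have hZn : t.IsGE ((t.truncGE n).obj Z) n := inferInstance
  have hYm : t.IsLE ((t.truncGE n).obj Y) m := inferInstance
  have hZm : t.IsLE ((t.truncGE n).obj Z) m := inferInstance
  refine ⟨_, _, _, x', y', z', h', φ ≫ ψ, (t.truncGEπ n).app Y, (t.truncGEπ n).app Z,
    ?_, hYn, hZn, ?_, hYm, hZm, hφ'.comp hψ', .of_isLE₁ tY hY', .of_isLE₁ tZ hZ', ?_, hy'.symm, ?_⟩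
  · have h₁ : t.IsGE ((t.truncGE n).obj Z) (n - 1) := t.isGE_of_ge _ (n - 1) n
    have h₂ : t.IsGE (((t.truncGE n).obj Y)⟦(1 : ℤ)⟧) (n - 1) := t.isGE_shift _ n 1 (n - 1)
    have : t.IsGE (X'⟦(1 : ℤ)⟧) (n - 1) :=
      t.isGE₂ _ (distinguished_rotate_iff.1 (distinguished_rotate_iff.1 h')) (n - 1) h₁ h₂
    exact t.isGE_of_shift X' n 1 (n - 1)
  · have hX₁ : t.IsLE (X⟦(1 : ℤ)⟧) (m - 1) := t.isLE_shift _ m 1 (m - 1)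
    have h₁ : t.IsLE (X₁⟦(1 : ℤ)⟧) (m - 1) := t.isLE₂ _ O₁.mem (m - 1) hX₁ (hZ₁ _)
    have h₂ : t.IsLE (((t.truncLE (n - 1)).obj Y)⟦(1 : ℤ)⟧⟦(1 : ℤ)⟧) (m - 1) :=
      have := hY₁ m
      t.isLE_shift _ m 1 (m - 1)
    have : t.IsLE (X'⟦(1 : ℤ)⟧) (m - 1) :=
      t.isLE₂ _ (distinguished_rotate_iff.1 O₂.mem) (m - 1) h₁ h₂
    exact t.isLE_of_shift X' m 1 (m - 1)
  · apply (shiftFunctor 𝒯 (1 : ℤ)).map_injective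
    have h₁ := O₁.comm₂
    have h₂ := O₂.comm₄
    rw [← hφ, Preadditive.comp_neg, neg_inj] at h₁
    rw [← hψ, Preadditive.comp_neg, Preadditive.neg_comp, neg_inj] at h₂
    rw [Functor.map_comp, Functor.map_comp, Functor.map_comp, ← h₁, assoc, assoc, h₂]
  · rw [Functor.map_comp, hφ, hψ, ← assoc, O₁.comm₁, assoc, O₂.comm₃]

/-- A triangle whose homology is concentrated in degrees `0` and `1` can be replaced by a
triangle of objects in `t.ge 0` and in `t.le 1`. -/
lemma exists_distinguished_isGE_isLE {X Y Z : 𝒯} {x : X ⟶ Y} {y : Y ⟶ Z} {z : Z ⟶ X⟦(1 : ℤ)⟧}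
    (hT : Triangle.mk x y z ∈ distTriang 𝒯)
    (hX : ∀ n : ℤ, n ≠ 0 → n ≠ 1 → IsZero ((heartHomology t 𝒜).obj (X⟦n⟧)))
    (hY : ∀ n : ℤ, n ≠ 0 → n ≠ 1 → IsZero ((heartHomology t 𝒜).obj (Y⟦n⟧)))
    (hZ : ∀ n : ℤ, n ≠ 0 → n ≠ 1 → IsZero ((heartHomology t 𝒜).obj (Z⟦n⟧))) :
    ∃ (X' Y' Z' : 𝒯) (x' : X' ⟶ Y') (y' : Y' ⟶ Z') (z' : Z' ⟶ X'⟦(1 : ℤ)⟧)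
      (_ : Triangle.mk x' y' z' ∈ distTriang 𝒯),
      t.IsGE X' 0 ∧ t.IsGE Y' 0 ∧ t.IsGE Z' 0 ∧ t.IsLE X' 1 ∧ t.IsLE Y' 1 ∧ t.IsLE Z' 1 ∧
      Nonempty (homologyArrows t 𝒜 (Triangle.mk x y z) ≅
        homologyArrows t 𝒜 (Triangle.mk x' y' z')) := by
  obtain ⟨X₁, Y₁, Z₁, x₁, y₁, z₁, h₁, φ₁, φ₂, φ₃, _, _, _, hφ₁, hφ₂, hφ₃, c₁, c₂, c₃⟩ :=
    exists_distinguished_isLE t 𝒜 1 hT (fun m hm ↦ hX m (by lia) (by lia))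
      (fun m hm ↦ hY m (by lia) (by lia))
  obtain ⟨X₂, Y₂, Z₂, x₂, y₂, z₂, h₂, ψ₁, ψ₂, ψ₃, i₁, i₂, i₃, i₄, i₅, i₆, hψ₁, hψ₂, hψ₃,
    d₁, d₂, d₃⟩ :=
    exists_distinguished_isGE t 𝒜 0 1 h₁
      (fun m hm ↦ (hφ₂.isZero_iff m).2 (hY m (by lia) (by lia)))
      (fun m hm ↦ (hφ₃.isZero_iff m).2 (hZ m (by lia) (by lia)))
  obtain ⟨e₁⟩ := nonempty_homologyArrows_iso t 𝒜 hφ₁ hφ₂ hφ₃ c₁ c₂ c₃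
  obtain ⟨e₂⟩ := nonempty_homologyArrows_iso t 𝒜 hψ₁ hψ₂ hψ₃ d₁ d₂ d₃
  exact ⟨X₂, Y₂, Z₂, x₂, y₂, z₂, h₂, i₁, i₂, i₃, i₄, i₅, i₆, ⟨e₁.symm ≪≫ e₂⟩⟩

end Reduction

/-! ### Triangles with prescribed homology in degrees `0` and `1`. -/

section Comparison

variable {𝒯 : Type u'} [Category.{v'} 𝒯] [Preadditive 𝒯] [HasZeroObject 𝒯] [HasShift 𝒯 ℤ]
  [∀ n : ℤ, (shiftFunctor 𝒯 n).Additive] [Pretriangulated 𝒯] [IsTriangulated 𝒯]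
  (t : TStructure 𝒯) (𝒜 : Type u) [Category.{v} 𝒜] [Abelian 𝒜] [t.Heart 𝒜]

omit [IsTriangulated 𝒯] in
lemma exists_ιHeart_iso (V : 𝒯) [t.IsLE V 0] [t.IsGE V 0] :
    ∃ A : 𝒜, Nonempty (t.ιHeart.obj A ≅ V) := by
  have : (t.ιHeart (H := 𝒜)).essImage V := by
    rw [t.essImage_ιHeart, t.mem_heart_iff]
    exact ⟨inferInstance, inferInstance⟩
  exact this

lemma exists_triangle_of_isGE (X : 𝒯) [t.IsGE X 0] :
    ∃ (A : 𝒜) (W : 𝒯) (i : t.ιHeart.obj A ⟶ X) (q : X ⟶ W)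
      (r : W ⟶ (t.ιHeart.obj A)⟦(1 : ℤ)⟧), Triangle.mk i q r ∈ distTriang 𝒯 ∧ t.IsGE W 1 := by
  obtain ⟨A, ⟨ψ⟩⟩ := exists_ιHeart_iso t 𝒜 ((t.truncLE 0).obj X)
  have hW : t.IsGE ((t.truncGE 1).obj X) 1 := inferInstance
  exact ⟨A, _, ψ.hom ≫ (t.truncLEι 0).app X, (t.truncGEπ 1).app X,
    (t.truncGEδLE 0 1 rfl).app X ≫ ψ.inv⟦(1 : ℤ)⟧',
    (distinguished_iff_of_isos ψ (Iso.refl X) (Iso.refl _) (comp_id _)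
      ((comp_id _).trans (id_comp _).symm) (by simp [← Functor.map_comp])).2
      (truncation_distinguished t 0 1 rfl X), hW⟩

lemma exists_triangle_of_isLE (X : 𝒯) [t.IsLE X 0] :
    ∃ (A : 𝒜) (W : 𝒯) (i : W ⟶ X) (q : X ⟶ t.ιHeart.obj A)
      (r : t.ιHeart.obj A ⟶ W⟦(1 : ℤ)⟧), Triangle.mk i q r ∈ distTriang 𝒯 ∧ t.IsLE W (-1) := by
  obtain ⟨A, ⟨ψ⟩⟩ := exists_ιHeart_iso t 𝒜 ((t.truncGE 0).obj X)
  have hW : t.IsLE ((t.truncLE (-1)).obj X) (-1) := inferInstance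
  exact ⟨A, _, (t.truncLEι (-1)).app X, (t.truncGEπ 0).app X ≫ ψ.inv,
    ψ.hom ≫ (t.truncGEδLE (-1) 0 rfl).app X,
    (distinguished_iff_of_isos (Iso.refl _) (Iso.refl X) ψ ((comp_id _).trans (id_comp _).symm)
      (by simp) (by simp)).2
      (truncation_distinguished t (-1) 0 rfl X), hW⟩

variable {𝒜}

lemma heartHomology_map_ιHeart_map {A B : 𝒜} (f : A ⟶ B) :
    (heartHomology t 𝒜).map (t.ιHeart.map f) = (ιHeartCompHeartHomologyIso t 𝒜).hom.app A ≫ f ≫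
      (ιHeartCompHeartHomologyIso t 𝒜).inv.app B := by
  have := (ιHeartCompHeartHomologyIso t 𝒜).hom.naturality f
  rw [Functor.comp_map, Functor.id_map] at this
  rw [← reassoc_of% this, Iso.hom_inv_id_app]
  exact (comp_id _).symm

lemma isIso_of_isIso_heartHomology_map {V : 𝒯} [t.IsLE V 0] [t.IsGE V 0] {D : 𝒜}
    (f : V ⟶ t.ιHeart.obj D) (hf : IsIso ((heartHomology t 𝒜).map f)) : IsIso f := by
  obtain ⟨A, ⟨e⟩⟩ := exists_ιHeart_iso t 𝒜 V
  obtain ⟨u, hu⟩ := (t.ιHeart (H := 𝒜)).map_surjective (e.hom ≫ f)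
  have h : IsIso ((heartHomology t 𝒜).map (t.ιHeart.map u)) := by
    rw [hu, Functor.map_comp]
    infer_instance
  have : IsIso u := (NatIso.isIso_map_iff (ιHeartCompHeartHomologyIso t 𝒜) u).1 h
  have : IsIso (e.hom ≫ f) := by
    rw [← hu]
    infer_instance
  exact IsIso.of_isIso_comp_left e.hom f

section

variable {X : 𝒯} {A : 𝒜}

/-- The inclusion of the lowest homology object is normalised to induce the prescribed isomorphism
`e`; this makes the later squares commute on the nose. -/
lemma exists_ιHeart_obj_hom [t.IsGE X 0] (e : A ≅ (heartHomology t 𝒜).obj X) :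
    ∃ j : t.ιHeart.obj A ⟶ X,
      (heartHomology t 𝒜).map j = (ιHeartCompHeartHomologyIso t 𝒜).hom.app A ≫ e.hom ∧
      ∃ (W : 𝒯) (q : X ⟶ W) (r : W ⟶ (t.ιHeart.obj A)⟦(1 : ℤ)⟧)
        (_ : Triangle.mk j q r ∈ distTriang 𝒯), t.IsGE W 1 := by
  obtain ⟨A₀, W, i, q, r, hi, hW⟩ := exists_triangle_of_isGE t 𝒜 X
  have := isIso_heartHomology_map_of_isGE t 𝒜 hi
  let θ := ιHeartCompHeartHomologyIso t 𝒜
  let u : A ≅ A₀ := e ≪≫ (asIso ((heartHomology t 𝒜).map i)).symm ≪≫ θ.app A₀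
  refine ⟨t.ιHeart.map u.hom ≫ i, ?_, W, q, r ≫ (t.ιHeart.map u.inv)⟦(1 : ℤ)⟧',
    (distinguished_iff_of_isos (t.ιHeart.mapIso u) (Iso.refl X) (Iso.refl _) (by simp) (by simp)
      (by simp [← Functor.map_comp])).2 hi, hW⟩
  rw [Functor.map_comp, heartHomology_map_ιHeart_map]
  simp [u, θ]

lemma exists_hom_ιHeart_obj [t.IsLE X 0] (e : (heartHomology t 𝒜).obj X ≅ A) :
    ∃ p : X ⟶ t.ιHeart.obj A,
      (heartHomology t 𝒜).map p = e.hom ≫ (ιHeartCompHeartHomologyIso t 𝒜).inv.app A := by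
  obtain ⟨A₀, W, i, q, r, hq, hW⟩ := exists_triangle_of_isLE t 𝒜 X
  have := isIso_heartHomology_map_of_isLE t 𝒜 hq
  let θ := ιHeartCompHeartHomologyIso t 𝒜
  refine ⟨q ≫ t.ιHeart.map (θ.inv.app A₀ ≫ inv ((heartHomology t 𝒜).map q) ≫ e.hom), ?_⟩
  rw [Functor.map_comp, heartHomology_map_ιHeart_map]
  simp [θ]

/-- Every morphism from the heart to `X` factors through the lowest homology object, since the rest
of `X` is in degrees `≥ 1`. There, homology is faithful. -/
lemma ιHeart_obj_hom_ext [t.IsGE X 0] {j j' : t.ιHeart.obj A ⟶ X}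
    (h : (heartHomology t 𝒜).map j = (heartHomology t 𝒜).map j') : j = j' := by
  obtain ⟨A₀, W, j₀, q, r, hj₀, hW⟩ := exists_triangle_of_isGE t 𝒜 X
  have := isIso_heartHomology_map_of_isGE t 𝒜 hj₀
  have hq (φ : t.ιHeart.obj A ⟶ X) : ∃ u, φ = t.ιHeart.map u ≫ j₀ := by
    obtain ⟨v, rfl⟩ := exists_eq_comp_mor₁ hj₀ φ (t.zero _ 0 1)
    obtain ⟨u, rfl⟩ := (t.ιHeart (H := 𝒜)).map_surjective v
    exact ⟨u, rfl⟩
  obtain ⟨u, rfl⟩ := hq j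
  obtain ⟨u', rfl⟩ := hq j'
  rw [Functor.map_comp, Functor.map_comp, cancel_mono, heartHomology_map_ιHeart_map,
    heartHomology_map_ιHeart_map, cancel_epi, cancel_mono] at h
  rw [h]

lemma hom_ιHeart_obj_ext [t.IsLE X 0] {p p' : X ⟶ t.ιHeart.obj A}
    (h : (heartHomology t 𝒜).map p = (heartHomology t 𝒜).map p') : p = p' := by
  obtain ⟨A₀, W, i, p₀, r, hp₀, hW⟩ := exists_triangle_of_isLE t 𝒜 X
  have := isIso_heartHomology_map_of_isLE t 𝒜 hp₀
  have hq (φ : X ⟶ t.ιHeart.obj A) : ∃ u, φ = p₀ ≫ t.ιHeart.map u := by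
    obtain ⟨v, rfl⟩ := exists_eq_mor₂_comp hp₀ φ (t.zero _ (-1) 0)
    obtain ⟨u, rfl⟩ := (t.ιHeart (H := 𝒜)).map_surjective v
    exact ⟨u, rfl⟩
  obtain ⟨u, rfl⟩ := hq p
  obtain ⟨u', rfl⟩ := hq p'
  rw [Functor.map_comp, Functor.map_comp, cancel_epi, heartHomology_map_ιHeart_map,
    heartHomology_map_ιHeart_map, cancel_epi, cancel_mono] at h
  rw [h]

/-- An object `X` with homology `A` and `D` in degrees `0` and `1` is, after a shift,
an extension of `D` by `A⟦1⟧`. -/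
lemma exists_distinguished_of_isGE_of_isLE [t.IsGE X 0] [t.IsLE X 1] {W : 𝒯}
    {j : t.ιHeart.obj A ⟶ X} {q : X ⟶ W} {r : W ⟶ (t.ιHeart.obj A)⟦(1 : ℤ)⟧}
    (hj : Triangle.mk j q r ∈ distTriang 𝒯) (hW : t.IsGE W 1) {D : 𝒜}
    {p : X⟦(1 : ℤ)⟧ ⟶ t.ιHeart.obj D} (hp : IsIso ((heartHomology t 𝒜).map p)) :
    ∃ w, Triangle.mk (j⟦(1 : ℤ)⟧') p w ∈ distTriang 𝒯 := by
  have hA : t.IsLE ((t.ιHeart.obj A)⟦(1 : ℤ)⟧) (-1) := t.isLE_shift _ 0 1 (-1)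
  have hA₁ : t.IsLE ((t.ιHeart.obj A)⟦(1 : ℤ)⟧) 1 := t.isLE_of_le _ (-1) 1
  have hW₁ : t.IsLE W 1 := t.isLE₂ _ (distinguished_rotate_iff.1 hj) 1 ‹_› hA₁
  have : t.IsGE (W⟦(1 : ℤ)⟧) 0 := t.isGE_shift W 1 1 0
  have : t.IsLE (W⟦(1 : ℤ)⟧) 0 := t.isLE_shift W 1 1 0
  have hj₁ := distinguished_shift_iff.2 hj
  obtain ⟨ψ, hψ⟩ := exists_eq_mor₂_comp hj₁ p (t.zero _ (-1) 0)
  have := isIso_heartHomology_map_of_isLE t 𝒜 hj₁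
  have : IsIso ((heartHomology t 𝒜).map ψ) := by
    rw [hψ, Functor.map_comp] at hp
    exact IsIso.of_isIso_comp_left ((heartHomology t 𝒜).map (q⟦(1 : ℤ)⟧')) _
  have := isIso_of_isIso_heartHomology_map t ψ this
  exact ⟨inv ψ ≫ (-r⟦(1 : ℤ)⟧'), (distinguished_iff_of_isos (Iso.refl _) (Iso.refl _)
    (asIso ψ) (by simp) (by simp [hψ]) (by simp)).1 hj₁⟩

end

variable {X Y Z : 𝒯} {x : X ⟶ Y} {y : Y ⟶ Z} {z : Z ⟶ X⟦(1 : ℤ)⟧}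
  (hT : Triangle.mk x y z ∈ distTriang 𝒯) (S : SixTermExact 𝒜)

omit hT in
lemma nonempty_arrows_iso_homologyArrows_iff :
    Nonempty (S.arrows ≅ homologyArrows t 𝒜 (Triangle.mk x y z)) ↔
      ∃ (eA : S.A ≅ (heartHomology t 𝒜).obj X) (eB : S.B ≅ (heartHomology t 𝒜).obj Y)
        (eC : S.C ≅ (heartHomology t 𝒜).obj Z) (eD : S.D ≅ (heartHomology t 𝒜).obj (X⟦(1 : ℤ)⟧))
        (eE : S.E ≅ (heartHomology t 𝒜).obj (Y⟦(1 : ℤ)⟧))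
        (eF : S.F ≅ (heartHomology t 𝒜).obj (Z⟦(1 : ℤ)⟧)),
        S.a ≫ eB.hom = eA.hom ≫ (heartHomology t 𝒜).map x ∧
        S.b ≫ eC.hom = eB.hom ≫ (heartHomology t 𝒜).map y ∧
        S.c ≫ eD.hom = eC.hom ≫ (heartHomology t 𝒜).map z ∧
        S.d ≫ eE.hom = eD.hom ≫ (heartHomology t 𝒜).map (x⟦(1 : ℤ)⟧') ∧
        S.e ≫ eF.hom = eE.hom ≫ (heartHomology t 𝒜).map (y⟦(1 : ℤ)⟧') :=
  nonempty_mk₅_iso_iff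

include hT in
variable {S} in
-- Commutativity of the squares can be tested on homology because their sources, or their targets,
-- lie in the heart at an extreme degree. The shift of the triangle accounts for the sign in
-- `comm_c`.
lemma nonempty_homologyData [t.IsGE X 0] [t.IsGE Y 0] [t.IsGE Z 0] [t.IsLE X 1] [t.IsLE Y 1]
    [t.IsLE Z 1] (h : Nonempty (S.arrows ≅ homologyArrows t 𝒜 (Triangle.mk x y z))) :
    Nonempty (HomologyData (t.ιHeart.map S.a) (t.ιHeart.map S.b) (t.ιHeart.map S.c)
      (t.ιHeart.map S.d) (t.ιHeart.map S.e)) := by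
  have : t.IsLE (X⟦(1 : ℤ)⟧) 0 := t.isLE_shift X 1 1 0
  have : t.IsLE (Y⟦(1 : ℤ)⟧) 0 := t.isLE_shift Y 1 1 0
  have : t.IsLE (Z⟦(1 : ℤ)⟧) 0 := t.isLE_shift Z 1 1 0
  obtain ⟨eA, eB, eC, eD, eE, eF, ha, hb, hc, hd, he⟩ :=
    (nonempty_arrows_iso_homologyArrows_iff t S).1 h
  obtain ⟨jA, hjA, _, _, _, tA, hWA⟩ := exists_ιHeart_obj_hom t eA
  obtain ⟨jB, hjB, _, _, _, tB, hWB⟩ := exists_ιHeart_obj_hom t eB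
  obtain ⟨jC, hjC, _, _, _, tC, hWC⟩ := exists_ιHeart_obj_hom t eC
  obtain ⟨pD, hpD⟩ := exists_hom_ιHeart_obj t eD.symm
  obtain ⟨pE, hpE⟩ := exists_hom_ιHeart_obj t eE.symm
  obtain ⟨pF, hpF⟩ := exists_hom_ιHeart_obj t eF.symm
  obtain ⟨wA, hA⟩ := exists_distinguished_of_isGE_of_isLE t tA hWA (p := pD) (by
    rw [hpD]; infer_instance)
  obtain ⟨wB, hB⟩ := exists_distinguished_of_isGE_of_isLE t tB hWB (p := pE) (by
    rw [hpE]; infer_instance)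
  obtain ⟨wC, hC⟩ := exists_distinguished_of_isGE_of_isLE t tC hWC (p := pF) (by
    rw [hpF]; infer_instance)
  have ca : t.ιHeart.map S.a ≫ jB = jA ≫ x := ιHeart_obj_hom_ext t (by
    rw [Functor.map_comp, Functor.map_comp, hjA, hjB, heartHomology_map_ιHeart_map]
    simp [ha])
  have cb : t.ιHeart.map S.b ≫ jC = jB ≫ y := ιHeart_obj_hom_ext t (by
    rw [Functor.map_comp, Functor.map_comp, hjB, hjC, heartHomology_map_ιHeart_map]
    simp [hb])
  have cc : jC ≫ z ≫ pD = t.ιHeart.map S.c := ιHeart_obj_hom_ext t (by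
    rw [Functor.map_comp, Functor.map_comp, hjC, hpD, heartHomology_map_ιHeart_map, assoc,
      ← reassoc_of% hc]
    simp)
  have cd : x⟦(1 : ℤ)⟧' ≫ pE = pD ≫ t.ιHeart.map S.d := hom_ιHeart_obj_ext t (by
    rw [Functor.map_comp, Functor.map_comp, hpD, hpE, heartHomology_map_ιHeart_map]
    simp [← cancel_epi eD.hom, ← reassoc_of% hd])
  have ce : y⟦(1 : ℤ)⟧' ≫ pF = pE ≫ t.ιHeart.map S.e := hom_ιHeart_obj_ext t (by
    rw [Functor.map_comp, Functor.map_comp, hpE, hpF, heartHomology_map_ιHeart_map]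
    simp [← cancel_epi eE.hom, ← reassoc_of% he])
  exact ⟨{
    distinguished := distinguished_shift_iff.2 hT
    distinguished_A := hA
    distinguished_B := hB
    distinguished_C := hC
    comm_a := by rw [← Functor.map_comp, ca, Functor.map_comp]
    comm_b := by rw [← Functor.map_comp, cb, Functor.map_comp]
    comm_c := by
      rw [Preadditive.neg_comp, Preadditive.comp_neg, ← Functor.map_comp, ← Functor.map_comp, cc]
    comm_d := cd
    comm_e := ce }⟩

omit hT in
variable {t} in
/-- The converse of `exists_distinguished_of_isGE_of_isLE`. -/
lemma isGE_isLE_isIso_of_distinguished {A D : 𝒜} {j : t.ιHeart.obj A ⟶ X}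
    {p : X⟦(1 : ℤ)⟧ ⟶ t.ιHeart.obj D} {w : t.ιHeart.obj D ⟶ (t.ιHeart.obj A)⟦(1 : ℤ)⟧⟦(1 : ℤ)⟧}
    (h : Triangle.mk (j⟦(1 : ℤ)⟧') p w ∈ distTriang 𝒯) :
    t.IsGE X 0 ∧ t.IsLE X 1 ∧ IsIso ((heartHomology t 𝒜).map j) ∧
      IsIso ((heartHomology t 𝒜).map p) := by
  have hA : t.IsLE ((t.ιHeart.obj A)⟦(1 : ℤ)⟧) (-1) := t.isLE_shift _ 0 1 (-1)
  have hA₁ : t.IsLE ((t.ιHeart.obj A)⟦(1 : ℤ)⟧) 0 := t.isLE_of_le _ (-1) 0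
  have hA₂ : t.IsGE ((t.ιHeart.obj A)⟦(1 : ℤ)⟧) (-1) := t.isGE_shift _ 0 1 (-1)
  have hD : t.IsLE (t.ιHeart.obj D) 0 := inferInstance
  have hD₁ : t.IsGE (t.ιHeart.obj D) (-1) := t.isGE_of_ge _ (-1) 0
  have h₁ : t.IsLE (X⟦(1 : ℤ)⟧) 0 := t.isLE₂ _ h 0 hA₁ hD
  have h₂ : t.IsGE (X⟦(1 : ℤ)⟧) (-1) := t.isGE₂ _ h (-1) hA₂ hD₁
  refine ⟨t.isGE_of_shift X 0 1 (-1), t.isLE_of_shift X 1 1 0, ?_,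
    isIso_heartHomology_map_of_isLE t 𝒜 h⟩
  obtain ⟨W, q, r, hj⟩ := distinguished_cocone_triangle j
  -- The shifted cone of `j` is isomorphic to `D`, so the cone lies in degrees `≥ 1` and `j` is an
  -- isomorphism on homology.
  obtain ⟨e, -, -⟩ := exists_third_iso (distinguished_shift_iff.2 hj) h
  have : t.IsGE (W⟦(1 : ℤ)⟧) 0 := t.isGE_of_iso e.symm 0
  have : t.IsGE W 1 := t.isGE_of_shift W 1 1 0
  exact isIso_heartHomology_map_of_isGE t 𝒜 hj

omit hT in
lemma isZero_heartHomology_obj_shift [t.IsGE X 0] [t.IsLE X 1] (n : ℤ) (h₀ : n ≠ 0)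
    (h₁ : n ≠ 1) : IsZero ((heartHomology t 𝒜).obj (X⟦n⟧)) := by
  obtain h | h : n < 0 ∨ 1 < n := by lia
  · have := t.isGE_shift X 0 n (-n)
    have : t.IsGE (X⟦n⟧) 1 := t.isGE_of_ge _ 1 (-n)
    exact isZero_heartHomology_obj_of_isGE t 𝒜 _
  · have := t.isLE_shift X 1 n (1 - n)
    have : t.IsLE (X⟦n⟧) (-1) := t.isLE_of_le _ (1 - n) (-1)
    exact isZero_heartHomology_obj_of_isLE t 𝒜 _

omit hT in
variable {t S} in
-- Desuspend everything: the shift is essentially surjective and full, and `z` absorbs the sign of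
-- the shifted triangle.
lemma HomologyData.isHomologyOfTriangle (T : HomologyData (t.ιHeart.map S.a) (t.ιHeart.map S.b)
    (t.ιHeart.map S.c) (t.ιHeart.map S.d) (t.ιHeart.map S.e)) : IsHomologyOfTriangle t S := by
  obtain ⟨hT, hA, hB, hC, comm_a, comm_b, comm_c, comm_d, comm_e⟩ := T
  rename_i X₁ Y₁ Z₁ x₁ y₁ z₁ iA pA wA iB pB wB iC pC wC
  let s := shiftFunctor 𝒯 (1 : ℤ)
  obtain ⟨X, ⟨eX⟩⟩ : ∃ X, Nonempty (X⟦(1 : ℤ)⟧ ≅ X₁) := ⟨_, ⟨s.objObjPreimageIso X₁⟩⟩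
  obtain ⟨Y, ⟨eY⟩⟩ : ∃ Y, Nonempty (Y⟦(1 : ℤ)⟧ ≅ Y₁) := ⟨_, ⟨s.objObjPreimageIso Y₁⟩⟩
  obtain ⟨Z, ⟨eZ⟩⟩ : ∃ Z, Nonempty (Z⟦(1 : ℤ)⟧ ≅ Z₁) := ⟨_, ⟨s.objObjPreimageIso Z₁⟩⟩
  obtain ⟨x, hx⟩ := s.map_surjective (eX.hom ≫ x₁ ≫ eY.inv)
  obtain ⟨y, hy⟩ := s.map_surjective (eY.hom ≫ y₁ ≫ eZ.inv)
  obtain ⟨z, hz⟩ := s.map_surjective (-(eZ.hom ≫ z₁ ≫ eX.inv⟦(1 : ℤ)⟧'))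
  obtain ⟨jA, hjA⟩ := s.map_surjective (iA ≫ eX.inv)
  obtain ⟨jB, hjB⟩ := s.map_surjective (iB ≫ eY.inv)
  obtain ⟨jC, hjC⟩ := s.map_surjective (iC ≫ eZ.inv)
  have tA : Triangle.mk (jA⟦(1 : ℤ)⟧') (eX.hom ≫ pA) wA ∈ distTriang 𝒯 :=
    (distinguished_iff_of_isos (Iso.refl _) eX (Iso.refl _) (by simp [s, hjA]) (by simp)
      (by simp)).2 hA
  have tB : Triangle.mk (jB⟦(1 : ℤ)⟧') (eY.hom ≫ pB) wB ∈ distTriang 𝒯 :=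
    (distinguished_iff_of_isos (Iso.refl _) eY (Iso.refl _) (by simp [s, hjB]) (by simp)
      (by simp)).2 hB
  have tC : Triangle.mk (jC⟦(1 : ℤ)⟧') (eZ.hom ≫ pC) wC ∈ distTriang 𝒯 :=
    (distinguished_iff_of_isos (Iso.refl _) eZ (Iso.refl _) (by simp [s, hjC]) (by simp)
      (by simp)).2 hC
  have tT : Triangle.mk x y z ∈ distTriang 𝒯 := distinguished_shift_iff.1
    ((distinguished_iff_of_isos eX eY eZ (by simp [s, hx]) (by simp [s, hy])
      (by simp [s, hz, ← Functor.map_comp])).2 hT)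
  obtain ⟨_, _, _, _⟩ := isGE_isLE_isIso_of_distinguished tA
  obtain ⟨_, _, _, _⟩ := isGE_isLE_isIso_of_distinguished tB
  obtain ⟨_, _, _, _⟩ := isGE_isLE_isIso_of_distinguished tC
  have ca : t.ιHeart.map S.a ≫ jB = jA ≫ x := s.map_injective (by
    rw [Functor.map_comp, Functor.map_comp, hjA, hjB, hx, reassoc_of% comm_a]
    simp)
  have cb : t.ιHeart.map S.b ≫ jC = jB ≫ y := s.map_injective (by
    rw [Functor.map_comp, Functor.map_comp, hjB, hjC, hy, reassoc_of% comm_b]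
    simp)
  have cc : t.ιHeart.map S.c = jC ≫ z ≫ eX.hom ≫ pA := s.map_injective (by
    rw [Functor.map_comp, Functor.map_comp, hjC, hz, ← neg_inj]
    refine comm_c.symm.trans ?_
    simp [s, ← Functor.map_comp])
  have cd : x⟦(1 : ℤ)⟧' ≫ eY.hom ≫ pB = (eX.hom ≫ pA) ≫ t.ιHeart.map S.d := by
    rw [assoc, ← comm_d]
    change s.map x ≫ _ = _
    simp [hx]
  have ce : y⟦(1 : ℤ)⟧' ≫ eZ.hom ≫ pC = (eY.hom ≫ pB) ≫ t.ιHeart.map S.e := by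
    rw [assoc, ← comm_e]
    change s.map y ≫ _ = _
    simp [hy]
  let θ := ιHeartCompHeartHomologyIso t 𝒜
  refine ⟨_, tT, fun n h₀ h₁ ↦ ⟨isZero_heartHomology_obj_shift t (X := X) n h₀ h₁,
    isZero_heartHomology_obj_shift t (X := Y) n h₀ h₁,
    isZero_heartHomology_obj_shift t (X := Z) n h₀ h₁⟩,
    (nonempty_arrows_iso_homologyArrows_iff t S).2
      ⟨(θ.app S.A).symm ≪≫ asIso ((heartHomology t 𝒜).map jA),
      (θ.app S.B).symm ≪≫ asIso ((heartHomology t 𝒜).map jB),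
      (θ.app S.C).symm ≪≫ asIso ((heartHomology t 𝒜).map jC),
      (θ.app S.D).symm ≪≫ (asIso ((heartHomology t 𝒜).map (eX.hom ≫ pA))).symm,
      (θ.app S.E).symm ≪≫ (asIso ((heartHomology t 𝒜).map (eY.hom ≫ pB))).symm,
      (θ.app S.F).symm ≪≫ (asIso ((heartHomology t 𝒜).map (eZ.hom ≫ pC))).symm,
      ?_, ?_, ?_, ?_, ?_⟩⟩
  · rw [← cancel_epi (θ.hom.app S.A)]
    have := congrArg (heartHomology t 𝒜).map ca
    rw [Functor.map_comp, Functor.map_comp, heartHomology_map_ιHeart_map] at this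
    simpa [θ] using this
  · rw [← cancel_epi (θ.hom.app S.B)]
    have := congrArg (heartHomology t 𝒜).map cb
    rw [Functor.map_comp, Functor.map_comp, heartHomology_map_ιHeart_map] at this
    simpa [θ] using this
  · rw [← cancel_epi (θ.hom.app S.C), ← cancel_mono ((heartHomology t 𝒜).map (eX.hom ≫ pA))]
    have := congrArg (heartHomology t 𝒜).map cc
    rw [Functor.map_comp, Functor.map_comp, heartHomology_map_ιHeart_map] at this
    simpa [θ] using this
  · rw [← cancel_epi (θ.hom.app S.D), ← cancel_mono ((heartHomology t 𝒜).map (eY.hom ≫ pB)),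
      ← cancel_epi ((heartHomology t 𝒜).map (eX.hom ≫ pA))]
    have := congrArg (heartHomology t 𝒜).map cd
    rw [Functor.map_comp _ _ (eY.hom ≫ pB), Functor.map_comp _ (eX.hom ≫ pA),
      heartHomology_map_ιHeart_map] at this
    simpa [θ] using this.symm
  · rw [← cancel_epi (θ.hom.app S.E), ← cancel_mono ((heartHomology t 𝒜).map (eZ.hom ≫ pC)),
      ← cancel_epi ((heartHomology t 𝒜).map (eY.hom ≫ pB))]
    have := congrArg (heartHomology t 𝒜).map ce
    rw [Functor.map_comp _ _ (eZ.hom ≫ pC), Functor.map_comp _ (eY.hom ≫ pB),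
      heartHomology_map_ιHeart_map] at this
    simpa [θ] using this.symm

omit hT in
lemma isHomologyOfTriangle_iff : IsHomologyOfTriangle t S ↔
    Nonempty (HomologyData (t.ιHeart.map S.a) (t.ιHeart.map S.b) (t.ιHeart.map S.c)
      (t.ιHeart.map S.d) (t.ιHeart.map S.e)) := by
  refine ⟨fun ⟨T, hT, hT', ⟨e⟩⟩ ↦ ?_, fun ⟨T⟩ ↦ T.isHomologyOfTriangle⟩
  obtain ⟨X', Y', Z', x', y', z', h', _, _, _, _, _, _, ⟨e'⟩⟩ :=
    exists_distinguished_isGE_isLE t 𝒜 (x := T.mor₁) (y := T.mor₂) (z := T.mor₃) hT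
      (fun n h₀ h₁ ↦ (hT' n h₀ h₁).1) (fun n h₀ h₁ ↦ (hT' n h₀ h₁).2.1)
      (fun n h₀ h₁ ↦ (hT' n h₀ h₁).2.2)
  exact nonempty_homologyData t h' ⟨e ≪≫ e'⟩

end Comparison

/-! ### The equivalence of the two conditions in `𝒯`. -/

section

variable {𝒯 : Type u'} [Category.{v'} 𝒯] [Preadditive 𝒯] [HasZeroObject 𝒯] [HasShift 𝒯 ℤ]
  [∀ n : ℤ, (shiftFunctor 𝒯 n).Additive] [Pretriangulated 𝒯] [IsTriangulated 𝒯]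
  (t : TStructure 𝒯) {𝒜 : Type u} [Category.{v} 𝒜] [Abelian 𝒜] [t.Heart 𝒜]
  [HasDerivedCategory.{w} 𝒜] (G : DerivedCategory.Bounded 𝒜 ⥤ 𝒯) [G.CommShift ℤ]
  [G.IsTriangulated] (ε : singleBounded 𝒜 ⋙ G ≅ t.ιHeart) (S : SixTermExact 𝒜)

theorem isHomologyOfTriangle_iff_zero_mem_todaBracket :
    IsHomologyOfTriangle t S ↔ 0 ∈ todaBracket (S.δ ε) (S.β ε ≫ S.γ ε) (S.α ε) := by
  have hb : t.ιHeart.map S.b =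
      t.ιHeart.map (factorThruImage S.b) ≫ t.ιHeart.map (image.ι S.b) := by
    rw [← Functor.map_comp, image.fac]
  have hc : t.ιHeart.map S.c =
      t.ιHeart.map (factorThruImage S.c) ≫ t.ιHeart.map (image.ι S.c) := by
    rw [← Functor.map_comp, image.fac]
  have hd : t.ιHeart.map S.d =
      t.ιHeart.map (factorThruImage S.d) ≫ t.ιHeart.map (image.ι S.d) := by
    rw [← Functor.map_comp, image.fac]
  have h₁ := heartClass_distinguished ε S.piece₄_shortExact
  have h₂ := heartClass_distinguished ε S.piece₃_shortExact
  have h₃ := heartClass_distinguished ε S.piece₂_shortExact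
  have hk := heartClass_distinguished ε S.piece₁_shortExact
  rw [isHomologyOfTriangle_iff, hb, hd]
  constructor
  · rintro ⟨T⟩
    obtain ⟨V, q, r, H, h⟩ := T.exists_factorization t hk h₁
    rw [hc] at H
    -- The cone `V` of `c` found from the triangle is now also presented as the extension that
    -- defines the bracket.
    obtain ⟨i, p, hV, hi, hp⟩ := exists_extension_of_cone h₃ h₂ H
    exact (zero_mem_todaBracket_shiftDegreeOne_iff _ _ _ _ hV).2 (h i p hi hp)
  · intro h
    obtain ⟨V, q, r, H⟩ := distinguished_cocone_triangle (t.ιHeart.map S.c)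
    have H' := H
    rw [hc] at H'
    obtain ⟨i, p, hV, hi, hp⟩ := exists_extension_of_cone h₃ h₂ H'
    obtain ⟨f, g, hg, hf, hgf⟩ := (zero_mem_todaBracket_shiftDegreeOne_iff _ _ _ _ hV).1 h
    exact HomologyData.nonempty_of_factorization hk h₁ H hV hi hp hg hf hgf

end

/-! ### Heart homology on `D^b(𝒜)` is the usual `H⁰`. -/

section BoundedHomology

open DerivedCategory

variable (𝒜 : Type u) [Category.{v} 𝒜] [Abelian 𝒜] [HasDerivedCategory.{w} 𝒜]

/-- The usual homology functor in degree `0` on the bounded derived category. -/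
abbrev boundedHomology : Bounded 𝒜 ⥤ 𝒜 := Bounded.ι ⋙ homologyFunctor 𝒜 0

/-- The usual homology of an object of `𝒜`. -/
def singleBoundedCompBoundedHomologyIso : singleBounded 𝒜 ⋙ boundedHomology 𝒜 ≅ 𝟭 𝒜 :=
  (Functor.associator _ _ _).symm ≪≫
    Functor.isoWhiskerRight (singleBoundedCompι 𝒜) (homologyFunctor 𝒜 0) ≪≫
    singleFunctorCompHomologyFunctorIso 𝒜 0

section

variable {𝒜} {X Y Z : Bounded 𝒜} {f : X ⟶ Y} {g : Y ⟶ Z} {h : Z ⟶ X⟦(1 : ℤ)⟧}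
  (hT : Triangle.mk f g h ∈ distTriang (Bounded 𝒜))

include hT

lemma isIso_boundedHomology_map_of_isGE [hZ : (tBounded 𝒜).IsGE Z 1] :
    IsIso ((boundedHomology 𝒜).map f) := by
  have hT' := Bounded.ι.map_distinguished _ hT
  have hZ' : DerivedCategory.IsGE Z.obj 1 := (ObjectProperty.tStructure_isGE_iff _ _ _ _).1 hZ
  have h₁ : Mono ((homologyFunctor 𝒜 0).map (Bounded.ι.map f)) :=
    (HomologySequence.mono_homologyMap_mor₁_iff _ hT' (-1) 0).2
      ((isZero_of_isGE Z.obj 1 (-1) (by lia)).eq_of_src _ _)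
  have h₂ : Epi ((homologyFunctor 𝒜 0).map (Bounded.ι.map f)) :=
    (HomologySequence.epi_homologyMap_mor₁_iff _ hT' 0).2
      ((isZero_of_isGE Z.obj 1 0 (by lia)).eq_of_tgt _ _)
  exact isIso_of_mono_of_epi ((homologyFunctor 𝒜 0).map (Bounded.ι.map f))

lemma isIso_boundedHomology_map_of_isLE [hX : (tBounded 𝒜).IsLE X (-1)] :
    IsIso ((boundedHomology 𝒜).map g) := by
  have hT' := Bounded.ι.map_distinguished _ hT
  have hX' : DerivedCategory.IsLE X.obj (-1) := (ObjectProperty.tStructure_isLE_iff _ _ _ _).1 hX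
  have h₁ : Mono ((homologyFunctor 𝒜 0).map (Bounded.ι.map g)) :=
    (HomologySequence.mono_homologyMap_mor₂_iff _ hT' 0).2
      ((isZero_of_isLE X.obj (-1) 0 (by lia)).eq_of_src _ _)
  have h₂ : Epi ((homologyFunctor 𝒜 0).map (Bounded.ι.map g)) :=
    (HomologySequence.epi_homologyMap_mor₂_iff _ hT' 0 1).2
      ((isZero_of_isLE X.obj (-1) 1 (by lia)).eq_of_tgt _ _)
  exact isIso_of_mono_of_epi ((homologyFunctor 𝒜 0).map (Bounded.ι.map g))

end

instance (X : Bounded 𝒜) :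
    IsIso ((Functor.whiskerRight ((tBounded 𝒜).truncLEι 0) (boundedHomology 𝒜)).app X) := by
  have : (tBounded 𝒜).IsGE (((tBounded 𝒜).truncGE 1).obj X) 1 := inferInstance
  exact isIso_boundedHomology_map_of_isGE (truncation_distinguished (tBounded 𝒜) 0 1 rfl X)

instance (X : Bounded 𝒜) :
    IsIso ((Functor.whiskerRight ((tBounded 𝒜).truncGEπ 0) (boundedHomology 𝒜)).app X) := by
  have : (tBounded 𝒜).IsLE (((tBounded 𝒜).truncLE (-1)).obj X) (-1) := inferInstance
  exact isIso_boundedHomology_map_of_isLE (truncation_distinguished (tBounded 𝒜) (-1) 0 rfl X)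

/-- The homological functor attached to the canonical t-structure on the bounded derived
category is the usual homology in degree `0`. -/
def heartHomologyIsoBoundedHomology : heartHomology (tBounded 𝒜) 𝒜 ≅ boundedHomology 𝒜 :=
  have : IsIso (Functor.whiskerRight ((tBounded 𝒜).truncLEι 0) (boundedHomology 𝒜)) :=
    NatIso.isIso_of_isIso_app _
  have : IsIso (Functor.whiskerRight ((tBounded 𝒜).truncGEπ 0) (boundedHomology 𝒜)) :=
    NatIso.isIso_of_isIso_app _
  -- Apply the usual `H⁰` to `τ^{≥ 0} τ^{≤ 0} X ⟵ τ^{≤ 0} X ⟶ X`; both arrows become isomorphisms.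
  (Functor.rightUnitor _).symm ≪≫
    Functor.isoWhiskerLeft (heartHomology (tBounded 𝒜) 𝒜)
      (singleBoundedCompBoundedHomologyIso 𝒜).symm ≪≫
    (Functor.associator _ _ _).symm ≪≫
    Functor.isoWhiskerRight (heartHomologyCompιIso (tBounded 𝒜) 𝒜) (boundedHomology 𝒜) ≪≫
    Functor.associator _ _ _ ≪≫
    Functor.isoWhiskerLeft ((tBounded 𝒜).truncLE 0)
      (asIso (Functor.whiskerRight ((tBounded 𝒜).truncGEπ 0) (boundedHomology 𝒜))).symm ≪≫
    asIso (Functor.whiskerRight ((tBounded 𝒜).truncLEι 0) (boundedHomology 𝒜))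

end BoundedHomology

/-! ### The connecting morphism of a triangle of complexes is the usual `δ`. -/

section Connecting

open DerivedCategory

variable {𝒜 : Type u} [Category.{v} 𝒜] [Abelian 𝒜] [HasDerivedCategory.{w} 𝒜]
  {P : ShortComplex (CochainComplex 𝒜 ℤ)} (hP : P.ShortExact)

omit [HasDerivedCategory.{w} 𝒜] in
-- This is the corresponding identity in the homotopy category, after cancelling the comparison
-- isomorphisms of homology at both ends.
lemma homologyδOfTriangle_mappingCone_triangle (n₀ n₁ : ℤ) (h : n₀ + 1 = n₁) :
    CochainComplex.homologyδOfTriangle (CochainComplex.mappingCone.triangle P.f) n₀ n₁ h =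
      HomologicalComplex.homologyMap (CochainComplex.mappingCone.descShortComplex P) n₀ ≫
        hP.δ n₀ n₁ h := by
  have h₁ := CochainComplex.mappingCone.homologySequenceδ_triangleh hP n₀ n₁ h
  have h₂ := HomotopyCategory.homologyFunctor_shiftMap
    (CochainComplex.mappingCone.triangle P.f).mor₃ n₀ n₁ (by lia)
  have h₃ := h₂.symm.trans h₁
  have h₄ := (cancel_epi ((HomotopyCategory.homologyFunctorFactors 𝒜 (.up ℤ) n₀).hom.app
    (CochainComplex.mappingCone P.f))).1 h₃
  refine (cancel_mono ((HomotopyCategory.homologyFunctorFactors 𝒜 (.up ℤ) n₁).inv.app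
    P.X₁)).1 (h₄.trans ?_)
  exact (assoc _ _ _).symm

/-- The quasi-isomorphism from the mapping cone of `P.f` to `P.X₃` carries the standard triangle to
`triangleOfSES hP`, which reduces the claim to the mapping cone. -/
lemma δ_triangleOfSES (n₀ n₁ : ℤ) (h : n₀ + 1 = n₁) :
    HomologySequence.δ (triangleOfSES hP) n₀ n₁ h ≫ (homologyFunctorFactors 𝒜 n₁).hom.app P.X₁ =
      (homologyFunctorFactors 𝒜 n₀).hom.app P.X₃ ≫ hP.δ n₀ n₁ h := by
  have := CochainComplex.mappingCone.quasiIso_descShortComplex hP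
  have : IsIso (Q.map (CochainComplex.mappingCone.descShortComplex P)) := inferInstance
  have h₁ := CochainComplex.homologyFunctorFactors_hom_app_homologyδOfTriangle
    (CochainComplex.mappingCone.triangle P.f) n₀ n₁ h
  rw [homologyδOfTriangle_mappingCone_triangle hP] at h₁
  have h₂ := homologyFunctorFactors_hom_naturality
    (CochainComplex.mappingCone.descShortComplex P) n₀
  have h₃ : (homologyFunctor 𝒜 n₀).map (Q.map (CochainComplex.mappingCone.descShortComplex P)) ≫
      HomologySequence.δ (triangleOfSES hP) n₀ n₁ h =
      HomologySequence.δ (Q.mapTriangle.obj (CochainComplex.mappingCone.triangle P.f)) n₀ n₁ h := by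
    refine (assoc _ _ _).symm.trans (congrArg (· ≫ _) ?_)
    refine ((homologyFunctor 𝒜 n₀).map_comp _ _).symm.trans
      (congrArg (homologyFunctor 𝒜 n₀).map ?_)
    exact descShortComplex_triangleOfSESδ hP
  refine (cancel_epi ((homologyFunctor 𝒜 n₀).map
    (Q.map (CochainComplex.mappingCone.descShortComplex P)))).1 ?_
  refine (assoc _ _ _).symm.trans ((congrArg (· ≫ _) h₃).trans (h₁.symm.trans ?_))
  refine (assoc _ _ _).symm.trans ((congrArg (· ≫ _) h₂.symm).trans (assoc _ _ _))

end Connecting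

lemma up_rel_zero_one : (ComplexShape.up ℤ).Rel 0 1 := rfl

/-! ### The homology sequence of a short exact sequence of complexes, in `D^b(𝒜)`. -/

section BoundedTriangle

open DerivedCategory

variable (𝒜 : Type u) [Category.{v} 𝒜] [Abelian 𝒜] [HasDerivedCategory.{w} 𝒜]

/-- The homology of the shift of an object of `D^b(𝒜)` is its homology in degree `1`. -/
def shiftHeartHomologyIso :
    shiftFunctor (Bounded 𝒜) (1 : ℤ) ⋙ heartHomology (tBounded 𝒜) 𝒜 ≅
      Bounded.ι ⋙ homologyFunctor 𝒜 1 :=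
  Functor.isoWhiskerLeft (shiftFunctor (Bounded 𝒜) (1 : ℤ)) (heartHomologyIsoBoundedHomology 𝒜) ≪≫
    (Functor.associator _ _ _).symm ≪≫
    Functor.isoWhiskerRight (Bounded.ι.commShiftIso (1 : ℤ)) (homologyFunctor 𝒜 0) ≪≫
    Functor.associator _ _ _ ≪≫
    Functor.isoWhiskerLeft Bounded.ι ((homologyFunctor 𝒜 0).shiftIso 1 0 1 (by lia))

variable {𝒜}

/-- Identifies `H(z)` with the `shiftMap` that defines the connecting morphism of the usual homology
sequence. -/
lemma heartHomology_map_shiftHeartHomologyIso_hom_app {X Z : Bounded 𝒜}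
    (z : Z ⟶ X⟦(1 : ℤ)⟧) :
    (heartHomology (tBounded 𝒜) 𝒜).map z ≫ (shiftHeartHomologyIso 𝒜).hom.app X =
      (heartHomologyIsoBoundedHomology 𝒜).hom.app Z ≫
        (homologyFunctor 𝒜 0).shiftMap (n := 1)
          (Bounded.ι.map z ≫ (Bounded.ι.commShiftIso (1 : ℤ)).hom.app X) 0 1 (by lia) := by
  have h₁ : (shiftHeartHomologyIso 𝒜).hom.app X =
      (heartHomologyIsoBoundedHomology 𝒜).hom.app (X⟦(1 : ℤ)⟧) ≫
        (homologyFunctor 𝒜 0).map ((Bounded.ι.commShiftIso (1 : ℤ)).hom.app X) ≫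
          ((homologyFunctor 𝒜 0).shiftIso (1 : ℤ) 0 1 (by lia)).hom.app (Bounded.ι.obj X) := by
    refine congrArg (_ ≫ ·) ((id_comp _).trans (congrArg (_ ≫ ·) ?_))
    exact id_comp (((homologyFunctor 𝒜 0).shiftIso (1 : ℤ) 0 1 (by lia)).hom.app (Bounded.ι.obj X))
  have h₂ := (heartHomologyIsoBoundedHomology 𝒜).hom.naturality z
  rw [h₁, Functor.shiftMap]
  refine (assoc _ _ _).symm.trans ((congrArg (· ≫ _) h₂).trans ((assoc _ _ _).trans ?_))
  refine congrArg (_ ≫ ·) ?_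
  refine (assoc _ _ _).symm.trans (congrArg (· ≫ _) ?_)
  exact ((homologyFunctor 𝒜 0).map_comp _ _).symm

variable {P : ShortComplex (CochainComplex 𝒜 ℤ)} (hP : P.ShortExact)
  (h₁ : TStructure.t.bounded (Q.obj P.X₁)) (h₂ : TStructure.t.bounded (Q.obj P.X₂))
  (h₃ : TStructure.t.bounded (Q.obj P.X₃))

/-- The object of `D^b(𝒜)` attached to a complex with bounded homology. -/
abbrev toBounded (K : CochainComplex 𝒜 ℤ) (hK : TStructure.t.bounded (Q.obj K)) : Bounded 𝒜 :=
  ⟨Q.obj K, hK⟩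

/-- The morphism in `D^b(𝒜)` induced by a morphism of complexes. -/
def toBoundedMap {K L : CochainComplex 𝒜 ℤ} (f : K ⟶ L) (hK : TStructure.t.bounded (Q.obj K))
    (hL : TStructure.t.bounded (Q.obj L)) : toBounded K hK ⟶ toBounded L hL :=
  ObjectProperty.homMk (Q.map f)

/-- The connecting morphism in `D^b(𝒜)` of a short exact sequence of complexes. -/
def toBoundedδ : toBounded P.X₃ h₃ ⟶ (toBounded P.X₁ h₁)⟦(1 : ℤ)⟧ :=
  Bounded.ι.preimage (triangleOfSESδ hP ≫
    (Bounded.ι.commShiftIso (1 : ℤ)).inv.app (toBounded P.X₁ h₁))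

lemma ι_map_toBoundedδ :
    Bounded.ι.map (toBoundedδ hP h₁ h₃) ≫
      (Bounded.ι.commShiftIso (1 : ℤ)).hom.app (toBounded P.X₁ h₁) = triangleOfSESδ hP := by
  rw [toBoundedδ, Functor.map_preimage]
  exact (assoc _ _ _).trans ((congrArg (triangleOfSESδ hP ≫ ·)
    ((Bounded.ι.commShiftIso (1 : ℤ)).inv_hom_id_app (toBounded P.X₁ h₁))).trans (comp_id _))

lemma toBounded_distinguished :
    Triangle.mk (toBoundedMap P.f h₁ h₂) (toBoundedMap P.g h₂ h₃) (toBoundedδ hP h₁ h₃) ∈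
      distTriang (Bounded 𝒜) := by
  refine isomorphic_distinguished _ (triangleOfSES_distinguished hP) _
    (Triangle.isoMk _ _ (Iso.refl _) (Iso.refl _) (Iso.refl _)
      ((comp_id _).trans (id_comp _).symm) ((comp_id _).trans (id_comp _).symm) ?_)
  change (Bounded.ι.map (toBoundedδ hP h₁ h₃) ≫
    (Bounded.ι.commShiftIso (1 : ℤ)).hom.app (toBounded P.X₁ h₁)) ≫ (𝟙 (Q.obj P.X₁))⟦(1 : ℤ)⟧' =
      𝟙 (Q.obj P.X₃) ≫ triangleOfSESδ hP
  rw [ι_map_toBoundedδ]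
  exact (congrArg (triangleOfSESδ hP ≫ ·) (CategoryTheory.Functor.map_id _ _)).trans
    ((comp_id _).trans (id_comp _).symm)

/-- The homology in degree `0` of a complex with bounded homology. -/
def heartHomologyToBoundedIso (K : CochainComplex 𝒜 ℤ) (hK : TStructure.t.bounded (Q.obj K)) :
    (heartHomology (tBounded 𝒜) 𝒜).obj (toBounded K hK) ≅ K.homology 0 :=
  (heartHomologyIsoBoundedHomology 𝒜).app (toBounded K hK) ≪≫ (homologyFunctorFactors 𝒜 0).app K

/-- The homology in degree `1` of a complex with bounded homology. -/
def heartHomologyShiftToBoundedIso (K : CochainComplex 𝒜 ℤ)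
    (hK : TStructure.t.bounded (Q.obj K)) :
    (heartHomology (tBounded 𝒜) 𝒜).obj ((toBounded K hK)⟦(1 : ℤ)⟧) ≅ K.homology 1 :=
  (shiftHeartHomologyIso 𝒜).app (toBounded K hK) ≪≫ (homologyFunctorFactors 𝒜 1).app K

lemma heartHomologyToBoundedIso_hom_naturality {K L : CochainComplex 𝒜 ℤ} (f : K ⟶ L)
    (hK : TStructure.t.bounded (Q.obj K)) (hL : TStructure.t.bounded (Q.obj L)) :
    (heartHomology (tBounded 𝒜) 𝒜).map (toBoundedMap f hK hL) ≫
      (heartHomologyToBoundedIso L hL).hom =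
      (heartHomologyToBoundedIso K hK).hom ≫ HomologicalComplex.homologyMap f 0 := by
  refine (assoc _ _ _).symm.trans ((congrArg (· ≫ _)
    ((heartHomologyIsoBoundedHomology 𝒜).hom.naturality (toBoundedMap f hK hL))).trans ?_)
  exact (assoc _ _ _).trans ((congrArg (_ ≫ ·) (homologyFunctorFactors_hom_naturality f 0)).trans
    (assoc _ _ _).symm)

lemma heartHomologyShiftToBoundedIso_hom_naturality {K L : CochainComplex 𝒜 ℤ} (f : K ⟶ L)
    (hK : TStructure.t.bounded (Q.obj K)) (hL : TStructure.t.bounded (Q.obj L)) :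
    (heartHomology (tBounded 𝒜) 𝒜).map ((toBoundedMap f hK hL)⟦(1 : ℤ)⟧') ≫
      (heartHomologyShiftToBoundedIso L hL).hom =
      (heartHomologyShiftToBoundedIso K hK).hom ≫ HomologicalComplex.homologyMap f 1 := by
  refine (assoc _ _ _).symm.trans ((congrArg (· ≫ _)
    ((shiftHeartHomologyIso 𝒜).hom.naturality (toBoundedMap f hK hL))).trans ?_)
  exact (assoc _ _ _).trans ((congrArg (_ ≫ ·) (homologyFunctorFactors_hom_naturality f 1)).trans
    (assoc _ _ _).symm)

lemma heartHomology_map_toBoundedδ :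
    (heartHomology (tBounded 𝒜) 𝒜).map (toBoundedδ hP h₁ h₃) ≫
      (heartHomologyShiftToBoundedIso P.X₁ h₁).hom =
      (heartHomologyToBoundedIso P.X₃ h₃).hom ≫ hP.δ 0 1 rfl := by
  refine (assoc _ _ _).symm.trans ((congrArg (· ≫ _)
    (heartHomology_map_shiftHeartHomologyIso_hom_app (toBoundedδ hP h₁ h₃))).trans ?_)
  rw [ι_map_toBoundedδ]
  exact (assoc _ _ _).trans ((congrArg (_ ≫ ·) (δ_triangleOfSES hP 0 1 rfl)).trans
    (assoc _ _ _).symm)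

/-- This is the bridge to the snake lemma: the homology sequence of complexes is itself a snake
sequence, with opcycles in degree `0` and cycles in degree `1` as middle rows. -/
lemma nonempty_homologyArrows_toBounded_iso :
    Nonempty (homologyArrows (tBounded 𝒜) 𝒜
        (Triangle.mk (toBoundedMap P.f h₁ h₂) (toBoundedMap P.g h₂ h₃) (toBoundedδ hP h₁ h₃)) ≅
      (HomologicalComplex.HomologySequence.snakeInput hP 0 1 up_rel_zero_one).composableArrows) :=
  nonempty_mk₅_iso_iff.2 ⟨heartHomologyToBoundedIso P.X₁ h₁, heartHomologyToBoundedIso P.X₂ h₂,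
    heartHomologyToBoundedIso P.X₃ h₃, heartHomologyShiftToBoundedIso P.X₁ h₁,
    heartHomologyShiftToBoundedIso P.X₂ h₂, heartHomologyShiftToBoundedIso P.X₃ h₃,
    heartHomologyToBoundedIso_hom_naturality P.f h₁ h₂,
    heartHomologyToBoundedIso_hom_naturality P.g h₂ h₃, heartHomology_map_toBoundedδ hP h₁ h₃,
    heartHomologyShiftToBoundedIso_hom_naturality P.f h₁ h₂,
    heartHomologyShiftToBoundedIso_hom_naturality P.g h₂ h₃⟩

end BoundedTriangle

/-! ### A snake diagram is determined by its two middle rows. -/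

section SnakeInput

variable {𝒜 : Type u} [Category.{v} 𝒜] [Abelian 𝒜]

namespace SnakeInput

open ShortComplex

/-- A morphism between the two middle rows of snake inputs extends to a morphism. -/
lemma exists_hom (I J : SnakeInput 𝒜) (f₁ : I.L₁ ⟶ J.L₁) (f₂ : I.L₂ ⟶ J.L₂)
    (comm : f₁ ≫ J.v₁₂ = I.v₁₂ ≫ f₂) : ∃ φ : I ⟶ J, φ.f₁ = f₁ ∧ φ.f₂ = f₂ := by
  obtain ⟨f₀, h₀⟩ := KernelFork.IsLimit.lift' J.h₀ (I.v₀₁ ≫ f₁)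
    (by rw [assoc, comm, ← assoc, I.w₀₂, zero_comp])
  obtain ⟨f₃, h₃⟩ := CokernelCofork.IsColimit.desc' I.h₃ (f₂ ≫ J.v₂₃)
    (by rw [← assoc, ← comm, assoc, J.w₁₃, comp_zero])
  exact ⟨{ f₀ := f₀, f₁ := f₁, f₂ := f₂, f₃ := f₃, comm₀₁ := h₀, comm₁₂ := comm,
           comm₂₃ := h₃.symm }, rfl, rfl⟩

lemma hom_ext {I J : SnakeInput 𝒜} {φ ψ : I ⟶ J} (h₁ : φ.f₁ = ψ.f₁) (h₂ : φ.f₂ = ψ.f₂) :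
    φ = ψ := by
  have h₀ : Mono J.v₀₁ := mono_of_isLimit_fork J.h₀
  have h₃ : Epi I.v₂₃ := epi_of_isColimit_cofork I.h₃
  refine SnakeInput.Hom.ext ?_ h₁ h₂ ?_
  · rw [← cancel_mono J.v₀₁, φ.comm₀₁, ψ.comm₀₁, h₁]
  · rw [← cancel_epi I.v₂₃, ← φ.comm₂₃, ← ψ.comm₂₃, h₂]

/-- Snake inputs with isomorphic middle rows are isomorphic. -/
lemma nonempty_iso (I J : SnakeInput 𝒜) (e₁ : I.L₁ ≅ J.L₁) (e₂ : I.L₂ ≅ J.L₂)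
    (comm : e₁.hom ≫ J.v₁₂ = I.v₁₂ ≫ e₂.hom) : Nonempty (I ≅ J) := by
  obtain ⟨φ, h₁, h₂⟩ := exists_hom I J e₁.hom e₂.hom comm
  obtain ⟨ψ, h₃, h₄⟩ := exists_hom J I e₁.inv e₂.inv
    (by rw [Iso.inv_comp_eq, ← assoc, comm, assoc, e₂.hom_inv_id, comp_id])
  exact ⟨{
    hom := φ
    inv := ψ
    hom_inv_id := hom_ext (by simp [h₁, h₃]) (by simp [h₂, h₄])
    inv_hom_id := hom_ext (by simp [h₁, h₃]) (by simp [h₂, h₄]) }⟩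

end SnakeInput

end SnakeInput

/-! ### Snake diagrams as short exact sequences of two-term complexes. -/

section Complexes

open HomologicalComplex HomologicalComplex.HomologySequence

variable {𝒜 : Type u} [Category.{v} 𝒜] [Abelian 𝒜]

lemma isIso_pOpcycles_zero (K : CochainComplex 𝒜 ℤ) [K.IsStrictlyGE 0] :
    IsIso (K.pOpcycles 0) :=
  K.isIso_pOpcycles (-1) 0 (by simp)
    ((K.isZero_of_isStrictlyGE 0 (-1) (by lia)).eq_of_src _ _)

lemma isIso_iCycles_one (K : CochainComplex 𝒜 ℤ) [K.IsStrictlyLE 1] : IsIso (K.iCycles 1) :=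
  K.isIso_iCycles 1 2 (by simp) ((K.isZero_of_isStrictlyLE 1 2 (by lia)).eq_of_tgt _ _)

/-- The opcycles in degree `0` of a complex in nonnegative degrees. -/
def isoOpcyclesZero (K : CochainComplex 𝒜 ℤ) [K.IsStrictlyGE 0] : K.X 0 ≅ K.opcycles 0 :=
  have := isIso_pOpcycles_zero K
  asIso (K.pOpcycles 0)

/-- The cycles in degree `1` of a complex in degrees at most `1`. -/
def cyclesOneIso (K : CochainComplex 𝒜 ℤ) [K.IsStrictlyLE 1] : K.cycles 1 ≅ K.X 1 :=
  have := isIso_iCycles_one K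
  asIso (K.iCycles 1)

variable {P : ShortComplex (CochainComplex 𝒜 ℤ)} (hP : P.ShortExact)

/-- For complexes in nonnegative degrees, the opcycles in degree `0` are the terms. -/
def evalIsoOpcycles [P.X₁.IsStrictlyGE 0] [P.X₂.IsStrictlyGE 0] [P.X₃.IsStrictlyGE 0] :
    P.map (HomologicalComplex.eval 𝒜 (ComplexShape.up ℤ) 0) ≅
      (snakeInput hP 0 1 up_rel_zero_one).L₁ :=
  ShortComplex.isoMk (isoOpcyclesZero P.X₁) (isoOpcyclesZero P.X₂)
    (isoOpcyclesZero P.X₃) (p_opcyclesMap P.f 0) (p_opcyclesMap P.g 0)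

/-- For complexes in degrees at most `1`, the cycles in degree `1` are the terms. -/
def cyclesIsoEval [P.X₁.IsStrictlyLE 1] [P.X₂.IsStrictlyLE 1] [P.X₃.IsStrictlyLE 1] :
    (snakeInput hP 0 1 up_rel_zero_one).L₂ ≅
      P.map (HomologicalComplex.eval 𝒜 (ComplexShape.up ℤ) 1) :=
  ShortComplex.isoMk (cyclesOneIso P.X₁) (cyclesOneIso P.X₂)
    (cyclesOneIso P.X₃) (cyclesMap_i P.f 1).symm (cyclesMap_i P.g 1).symm

include hP in
lemma shortExact_eval (n : ℤ) :
    (P.map (HomologicalComplex.eval 𝒜 (ComplexShape.up ℤ) n)).ShortExact :=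
  hP.map_of_exact (HomologicalComplex.eval 𝒜 (ComplexShape.up ℤ) n)

lemma snakeInput_L₁_shortExact [P.X₁.IsStrictlyGE 0] [P.X₂.IsStrictlyGE 0]
    [P.X₃.IsStrictlyGE 0] : (snakeInput hP 0 1 up_rel_zero_one).L₁.ShortExact :=
  ShortComplex.shortExact_of_iso (evalIsoOpcycles hP) (shortExact_eval hP 0)

lemma snakeInput_L₂_shortExact [P.X₁.IsStrictlyLE 1] [P.X₂.IsStrictlyLE 1]
    [P.X₃.IsStrictlyLE 1] : (snakeInput hP 0 1 up_rel_zero_one).L₂.ShortExact :=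
  ShortComplex.shortExact_of_iso (cyclesIsoEval hP).symm (shortExact_eval hP 1)

/-- In degrees `0` and `1` opcycles and cycles are the terms themselves, so the vertical map of the
snake diagram is the differential. -/
lemma evalIsoOpcycles_hom_comp [P.X₁.IsStrictlyGE 0] [P.X₂.IsStrictlyGE 0] [P.X₃.IsStrictlyGE 0]
    [P.X₁.IsStrictlyLE 1] [P.X₂.IsStrictlyLE 1] [P.X₃.IsStrictlyLE 1] :
    (evalIsoOpcycles hP).hom ≫ (snakeInput hP 0 1 up_rel_zero_one).v₁₂ ≫ (cyclesIsoEval hP).hom =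
      P.mapNatTrans (HomologicalComplex.dNatTrans 𝒜 (ComplexShape.up ℤ) 0 1) := by
  ext
  · exact pOpcycles_opcyclesToCycles_iCycles P.X₁ 0 1
  · exact pOpcycles_opcyclesToCycles_iCycles P.X₂ 0 1
  · exact pOpcycles_opcyclesToCycles_iCycles P.X₃ 0 1

/-- The complex `X₀ ⟶ X₁` in degrees `0` and `1`. -/
def twoTerm {X₀ X₁ : 𝒜} (f : X₀ ⟶ X₁) : CochainComplex 𝒜 ℤ := double f up_rel_zero_one

section TwoTerm

variable {X₀ X₁ : 𝒜} (f : X₀ ⟶ X₁)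

/-- The term in degree `0`. -/
def twoTermXZeroIso : (twoTerm f).X 0 ≅ X₀ := doubleXIso₀ f up_rel_zero_one

/-- The term in degree `1`. -/
def twoTermXOneIso : (twoTerm f).X 1 ≅ X₁ := doubleXIso₁ f up_rel_zero_one (by lia)

lemma isZero_twoTerm_X (i : ℤ) (h₀ : i ≠ 0) (h₁ : i ≠ 1) : IsZero ((twoTerm f).X i) :=
  isZero_double_X f up_rel_zero_one i h₀ h₁

lemma twoTerm_d_comp :
    (twoTerm f).d 0 1 ≫ (twoTermXOneIso f).hom = (twoTermXZeroIso f).hom ≫ f := by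
  have := double_d f up_rel_zero_one (by lia)
  refine (congrArg (· ≫ (twoTermXOneIso f).hom) this).trans ?_
  refine (assoc _ _ _).trans (congrArg ((twoTermXZeroIso f).hom ≫ ·) ?_)
  exact (assoc _ _ _).trans ((congrArg (f ≫ ·) (twoTermXOneIso f).inv_hom_id).trans (comp_id f))

instance : (twoTerm f).IsStrictlyGE 0 := by
  rw [CochainComplex.isStrictlyGE_iff]
  exact fun i hi ↦ isZero_twoTerm_X f i (by lia) (by lia)

instance : (twoTerm f).IsStrictlyLE 1 := by
  rw [CochainComplex.isStrictlyLE_iff]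
  exact fun i hi ↦ isZero_twoTerm_X f i (by lia) (by lia)

variable {f}

lemma twoTerm_hom_ext {K : CochainComplex 𝒜 ℤ} {φ ψ : twoTerm f ⟶ K} (h₀ : φ.f 0 = ψ.f 0)
    (h₁ : φ.f 1 = ψ.f 1) : φ = ψ :=
  from_double_hom_ext h₀ h₁

/-- The morphisms from a complex in degrees `0` and `1` are given by morphisms in these
degrees. -/
lemma exists_twoTerm_hom {K : CochainComplex 𝒜 ℤ} (φ₀ : X₀ ⟶ K.X 0) (φ₁ : X₁ ⟶ K.X 1)
    (comm : φ₀ ≫ K.d 0 1 = f ≫ φ₁) (hφ : φ₁ ≫ K.d 1 2 = 0) :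
    ∃ φ : twoTerm f ⟶ K, φ.f 0 = (twoTermXZeroIso f).hom ≫ φ₀ ∧
      φ.f 1 = (twoTermXOneIso f).hom ≫ φ₁ :=
  ⟨mkHomFromDouble up_rel_zero_one (by lia) φ₀ φ₁ comm (by rintro _ rfl; exact hφ),
    mkHomFromDouble_f₀ .., mkHomFromDouble_f₁ ..⟩

/-- A commutative square is a morphism between complexes in degrees `0` and `1`. -/
lemma exists_twoTerm_hom_twoTerm {Y₀ Y₁ : 𝒜} {g : Y₀ ⟶ Y₁} (a₀ : X₀ ⟶ Y₀) (a₁ : X₁ ⟶ Y₁)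
    (comm : a₀ ≫ g = f ≫ a₁) :
    ∃ φ : twoTerm f ⟶ twoTerm g, φ.f 0 ≫ (twoTermXZeroIso g).hom = (twoTermXZeroIso f).hom ≫ a₀ ∧
      φ.f 1 ≫ (twoTermXOneIso g).hom = (twoTermXOneIso f).hom ≫ a₁ := by
  obtain ⟨φ, h₀, h₁⟩ := exists_twoTerm_hom (f := f) (K := twoTerm g)
    (a₀ ≫ (twoTermXZeroIso g).inv) (a₁ ≫ (twoTermXOneIso g).inv)
    (by rw [← cancel_mono (twoTermXOneIso g).hom, assoc, assoc, twoTerm_d_comp,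
      Iso.inv_hom_id_assoc, comm, assoc, assoc, Iso.inv_hom_id, comp_id])
    ((isZero_twoTerm_X g 2 (by lia) (by lia)).eq_of_tgt _ _)
  exact ⟨φ, by rw [h₀]; simp, by rw [h₁]; simp⟩

end TwoTerm

/-- The complexes in degrees `0` and `1` given by the columns of a snake input. -/
lemma exists_shortExact_snakeInput_iso (I : ShortComplex.SnakeInput 𝒜) (h₁ : I.L₁.ShortExact)
    (h₂ : I.L₂.ShortExact) :
    ∃ (P : ShortComplex (CochainComplex 𝒜 ℤ)) (hP : P.ShortExact),
      P.X₁.IsStrictlyGE 0 ∧ P.X₂.IsStrictlyGE 0 ∧ P.X₃.IsStrictlyGE 0 ∧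
      P.X₁.IsStrictlyLE 1 ∧ P.X₂.IsStrictlyLE 1 ∧ P.X₃.IsStrictlyLE 1 ∧
      Nonempty (snakeInput hP 0 1 up_rel_zero_one ≅ I) := by
  obtain ⟨f, hf₀, hf₁⟩ := exists_twoTerm_hom_twoTerm I.L₁.f I.L₂.f I.v₁₂.comm₁₂.symm
  obtain ⟨g, hg₀, hg₁⟩ := exists_twoTerm_hom_twoTerm I.L₁.g I.L₂.g I.v₁₂.comm₂₃.symm
  let P : ShortComplex (CochainComplex 𝒜 ℤ) := ShortComplex.mk f g (by
    apply twoTerm_hom_ext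
    · change f.f 0 ≫ g.f 0 = 0
      rw [← cancel_mono (twoTermXZeroIso I.v₁₂.τ₃).hom, assoc, hg₀, reassoc_of% hf₀, I.L₁.zero,
        comp_zero, zero_comp]
    · change f.f 1 ≫ g.f 1 = 0
      rw [← cancel_mono (twoTermXOneIso I.v₁₂.τ₃).hom, assoc, hg₁, reassoc_of% hf₁, I.L₂.zero,
        comp_zero, zero_comp])
  let e₁ : P.map (HomologicalComplex.eval 𝒜 (ComplexShape.up ℤ) 0) ≅ I.L₁ :=
    ShortComplex.isoMk (twoTermXZeroIso I.v₁₂.τ₁) (twoTermXZeroIso I.v₁₂.τ₂)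
      (twoTermXZeroIso I.v₁₂.τ₃) hf₀.symm hg₀.symm
  let e₂ : P.map (HomologicalComplex.eval 𝒜 (ComplexShape.up ℤ) 1) ≅ I.L₂ :=
    ShortComplex.isoMk (twoTermXOneIso I.v₁₂.τ₁) (twoTermXOneIso I.v₁₂.τ₂)
      (twoTermXOneIso I.v₁₂.τ₃) hf₁.symm hg₁.symm
  have hP : P.ShortExact := by
    refine shortExact_of_degreewise_shortExact _ (fun i ↦ ?_)
    by_cases hi₀ : i = 0
    · subst hi₀
      exact ShortComplex.shortExact_of_iso e₁.symm h₁
    by_cases hi₁ : i = 1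
    · subst hi₁
      exact ShortComplex.shortExact_of_iso e₂.symm h₂
    have z₁ := isZero_twoTerm_X I.v₁₂.τ₁ i hi₀ hi₁
    have z₂ := isZero_twoTerm_X I.v₁₂.τ₂ i hi₀ hi₁
    have z₃ := isZero_twoTerm_X I.v₁₂.τ₃ i hi₀ hi₁
    exact
      { exact := ShortComplex.exact_of_isZero_X₂ _ z₂
        mono_f := ⟨fun _ _ _ ↦ z₁.eq_of_tgt _ _⟩
        epi_g := ⟨fun _ _ _ ↦ z₃.eq_of_src _ _⟩ }
  have i₁ : P.X₁.IsStrictlyGE 0 := inferInstanceAs ((twoTerm I.v₁₂.τ₁).IsStrictlyGE 0)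
  have i₂ : P.X₂.IsStrictlyGE 0 := inferInstanceAs ((twoTerm I.v₁₂.τ₂).IsStrictlyGE 0)
  have i₃ : P.X₃.IsStrictlyGE 0 := inferInstanceAs ((twoTerm I.v₁₂.τ₃).IsStrictlyGE 0)
  have j₁ : P.X₁.IsStrictlyLE 1 := inferInstanceAs ((twoTerm I.v₁₂.τ₁).IsStrictlyLE 1)
  have j₂ : P.X₂.IsStrictlyLE 1 := inferInstanceAs ((twoTerm I.v₁₂.τ₂).IsStrictlyLE 1)
  have j₃ : P.X₃.IsStrictlyLE 1 := inferInstanceAs ((twoTerm I.v₁₂.τ₃).IsStrictlyLE 1)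
  refine ⟨P, hP, i₁, i₂, i₃, j₁, j₂, j₃, SnakeInput.nonempty_iso _ _
    ((evalIsoOpcycles hP).symm ≪≫ e₁) (cyclesIsoEval hP ≪≫ e₂) ?_⟩
  have h : P.mapNatTrans (HomologicalComplex.dNatTrans 𝒜 (ComplexShape.up ℤ) 0 1) ≫ e₂.hom =
      e₁.hom ≫ I.v₁₂ := by
    ext
    · exact twoTerm_d_comp _
    · exact twoTerm_d_comp _
    · exact twoTerm_d_comp _
  rw [Iso.trans_hom, Iso.trans_hom, Iso.symm_hom, assoc, Iso.inv_comp_eq, ← h,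
    ← evalIsoOpcycles_hom_comp hP]
  simp only [assoc]

end Complexes

/-! ### The snake lemma and triangles in `D^b(𝒜)`. -/

section SnakeTriangle

open DerivedCategory HomologicalComplex.HomologySequence

variable {𝒜 : Type u} [Category.{v} 𝒜] [Abelian 𝒜] [HasDerivedCategory.{w} 𝒜]

lemma bounded_Q_obj (K : CochainComplex 𝒜 ℤ) [K.IsStrictlyGE 0] [K.IsStrictlyLE 1] :
    TStructure.t.bounded (Q.obj K) := by
  have h₀ : (Q.obj K).IsGE 0 := inferInstance
  have h₁ : (Q.obj K).IsLE 1 := inferInstance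
  exact ⟨⟨0, h₀⟩, ⟨1, h₁⟩⟩

lemma isGE_toBounded (K : CochainComplex 𝒜 ℤ) [K.IsStrictlyGE 0]
    (hK : TStructure.t.bounded (Q.obj K)) : (tBounded 𝒜).IsGE (toBounded K hK) 0 :=
  (ObjectProperty.tStructure_isGE_iff _ _ _ _).2 (inferInstanceAs ((Q.obj K).IsGE 0))

lemma isLE_toBounded (K : CochainComplex 𝒜 ℤ) [K.IsStrictlyLE 1]
    (hK : TStructure.t.bounded (Q.obj K)) : (tBounded 𝒜).IsLE (toBounded K hK) 1 :=
  (ObjectProperty.tStructure_isLE_iff _ _ _ _).2 (inferInstanceAs ((Q.obj K).IsLE 1))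

lemma isZero_heartHomology_shift_toBounded (K : CochainComplex 𝒜 ℤ) [K.IsStrictlyGE 0]
    [K.IsStrictlyLE 1] (hK : TStructure.t.bounded (Q.obj K)) (n : ℤ) (h₀ : n ≠ 0) (h₁ : n ≠ 1) :
    IsZero ((heartHomology (tBounded 𝒜) 𝒜).obj ((toBounded K hK)⟦n⟧)) :=
  have := isGE_toBounded K hK
  have := isLE_toBounded K hK
  isZero_heartHomology_obj_shift (tBounded 𝒜) (X := toBounded K hK) n h₀ h₁

lemma isHomologyOfTriangle_of_comesFromSnakeLemma {S : SixTermExact 𝒜}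
    (hS : S.ComesFromSnakeLemma) : IsHomologyOfTriangle (tBounded 𝒜) S := by
  obtain ⟨I, h₁, h₂, ⟨e⟩⟩ := hS
  obtain ⟨P, hP, _, _, _, _, _, _, ⟨φ⟩⟩ := exists_shortExact_snakeInput_iso I h₁ h₂
  have b₁ := bounded_Q_obj P.X₁
  have b₂ := bounded_Q_obj P.X₂
  have b₃ := bounded_Q_obj P.X₃
  obtain ⟨ψ⟩ := nonempty_homologyArrows_toBounded_iso hP b₁ b₂ b₃
  refine ⟨_, toBounded_distinguished hP b₁ b₂ b₃, fun n h₀ h₁ ↦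
    ⟨isZero_heartHomology_shift_toBounded P.X₁ b₁ n h₀ h₁,
      isZero_heartHomology_shift_toBounded P.X₂ b₂ n h₀ h₁,
      isZero_heartHomology_shift_toBounded P.X₃ b₃ n h₀ h₁⟩,
    ⟨e ≪≫ (ShortComplex.SnakeInput.composableArrowsFunctor.mapIso φ).symm ≪≫ ψ.symm⟩⟩

omit [HasDerivedCategory.{w} 𝒜] in
lemma comesFromSnakeLemma_of_shortExact {S : SixTermExact 𝒜}
    {P : ShortComplex (CochainComplex 𝒜 ℤ)} (hP : P.ShortExact)
    [P.X₁.IsStrictlyGE 0] [P.X₂.IsStrictlyGE 0] [P.X₃.IsStrictlyGE 0]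
    [P.X₁.IsStrictlyLE 1] [P.X₂.IsStrictlyLE 1] [P.X₃.IsStrictlyLE 1]
    (e : S.arrows ≅ (snakeInput hP 0 1 up_rel_zero_one).composableArrows) :
    S.ComesFromSnakeLemma :=
  ⟨_, snakeInput_L₁_shortExact hP, snakeInput_L₂_shortExact hP, ⟨e⟩⟩

omit [HasDerivedCategory.{w} 𝒜] in
lemma isZero_homology_twoTerm_id (X : 𝒜) (n : ℤ) : IsZero ((twoTerm (𝟙 X)).homology n) := by
  have hd : IsIso ((twoTerm (𝟙 X)).d 0 1) := by
    have h := twoTerm_d_comp (𝟙 X)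
    rw [comp_id, ← Iso.eq_comp_inv] at h
    rw [h]
    infer_instance
  rw [← HomologicalComplex.exactAt_iff_isZero_homology]
  by_cases h₀ : n = 0
  · subst h₀
    rw [HomologicalComplex.exactAt_iff' _ (-1) 0 1 (by simp) (by simp)]
    refine (ShortComplex.exact_iff_mono _ ?_).2 ?_
    · exact (isZero_twoTerm_X (𝟙 X) (-1) (by lia) (by lia)).eq_of_src _ _
    · change Mono ((twoTerm (𝟙 X)).d 0 1)
      infer_instance
  by_cases h₁ : n = 1
  · subst h₁
    rw [HomologicalComplex.exactAt_iff' _ 0 1 2 (by simp) (by simp)]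
    refine (ShortComplex.exact_iff_epi _ ?_).2 ?_
    · exact (isZero_twoTerm_X (𝟙 X) 2 (by lia) (by lia)).eq_of_tgt _ _
    · change Epi ((twoTerm (𝟙 X)).d 0 1)
      infer_instance
  exact ShortComplex.exact_of_isZero_X₂ _ (isZero_twoTerm_X (𝟙 X) n h₀ h₁)

omit [HasDerivedCategory.{w} 𝒜] in
lemma isZero_biprod_X {K L : CochainComplex 𝒜 ℤ} (n : ℤ) (hK : IsZero (K.X n))
    (hL : IsZero (L.X n)) : IsZero ((K ⊞ L).X n) := by
  rw [IsZero.iff_id_eq_zero]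
  have h : (biprod.fst ≫ biprod.inl + biprod.snd ≫ biprod.inr : K ⊞ L ⟶ K ⊞ L).f n =
      (𝟙 (K ⊞ L) : K ⊞ L ⟶ K ⊞ L).f n := by rw [biprod.total]
  rw [HomologicalComplex.add_f_apply, HomologicalComplex.comp_f, HomologicalComplex.comp_f,
    hK.eq_of_tgt ((biprod.fst : K ⊞ L ⟶ K).f n) 0, hL.eq_of_tgt ((biprod.snd : K ⊞ L ⟶ L).f n) 0,
    zero_comp, zero_comp, add_zero, HomologicalComplex.id_f] at h
  exact h.symm

lemma isIso_Q_map_biprod_inl (K : CochainComplex 𝒜 ℤ) (X : 𝒜) :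
    IsIso (Q.map (biprod.inl : K ⟶ K ⊞ twoTerm (𝟙 X))) := by
  rw [isIso_Q_map_iff_quasiIso, quasiIso_iff]
  intro n
  rw [quasiIsoAt_iff_isIso_homologyMap]
  refine ⟨HomologicalComplex.homologyMap biprod.fst n, ?_, ?_⟩
  · rw [← HomologicalComplex.homologyMap_comp, biprod.inl_fst, HomologicalComplex.homologyMap_id]
  · have h : biprod.fst ≫ biprod.inl = 𝟙 (K ⊞ twoTerm (𝟙 X)) - biprod.snd ≫ biprod.inr :=
      eq_sub_of_add_eq biprod.total
    rw [← HomologicalComplex.homologyMap_comp, h, HomologicalComplex.homologyMap_sub,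
      HomologicalComplex.homologyMap_id, HomologicalComplex.homologyMap_comp,
      (isZero_homology_twoTerm_id X n).eq_of_tgt (HomologicalComplex.homologyMap biprod.snd n) 0,
      zero_comp, sub_zero]

omit [HasDerivedCategory.{w} 𝒜] in
/-- The top degree of a morphism which induces an epimorphism on homology. -/
lemma eq_zero_of_epi_homologyMap {K L : CochainComplex 𝒜 ℤ} (f : K ⟶ L) [L.IsStrictlyLE 1]
    (hf : Epi (HomologicalComplex.homologyMap f 1)) {T : 𝒜} (q : L.X 1 ⟶ T)
    (h₁ : f.f 1 ≫ q = 0) (h₂ : L.d 0 1 ≫ q = 0) : q = 0 := by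
  have := isIso_iCycles_one L
  -- In the top degree everything is a cycle and `q` kills boundaries, so `q` descends to `r` on
  -- `H¹(L)`; there it vanishes, since it vanishes after `H¹(f)`.
  obtain ⟨r, hr⟩ := CokernelCofork.IsColimit.desc' (L.homologyIsCokernel 0 1 (by simp))
    (L.iCycles 1 ≫ q) (by rw [HomologicalComplex.toCycles_i_assoc, h₂])
  change L.homologyπ 1 ≫ r = L.iCycles 1 ≫ q at hr
  have hr₀ : r = 0 := by
    rw [← cancel_epi (HomologicalComplex.homologyMap f 1), ← cancel_epi (K.homologyπ 1), comp_zero,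
      comp_zero, HomologicalComplex.homologyπ_naturality_assoc, hr,
      HomologicalComplex.cyclesMap_i_assoc, h₁, comp_zero]
  rw [← cancel_epi (L.iCycles 1), ← hr, hr₀, comp_zero, comp_zero]

/-- A morphism `f` between complexes in degrees `0` and `1` such that `H¹(f)` is an epimorphism
becomes, after the replacement of its source by a quasi-isomorphic complex, an epimorphism whose
kernel is in degrees `0` and `1`. -/
lemma exists_shortExact_of_epi_homologyMap {K L : CochainComplex 𝒜 ℤ} (f : K ⟶ L)
    [K.IsStrictlyGE 0] [L.IsStrictlyGE 0] [K.IsStrictlyLE 1] [L.IsStrictlyLE 1]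
    (hf : Epi (HomologicalComplex.homologyMap f 1)) :
    ∃ (N M : CochainComplex 𝒜 ℤ) (j : N ⟶ M) (g : M ⟶ L) (w : j ≫ g = 0) (i : K ⟶ M),
      (ShortComplex.mk j g w).ShortExact ∧
      N.IsStrictlyGE 0 ∧ M.IsStrictlyGE 0 ∧ N.IsStrictlyLE 1 ∧ M.IsStrictlyLE 1 ∧
      IsIso (Q.map i) ∧ i ≫ g = f := by
  -- `r` is the identity in degree `0` and the differential in degree `1`: its source is acyclic,
  -- and it makes `(f, r)` epi in degree `0`.
  obtain ⟨r, hr₀, hr₁⟩ := exists_twoTerm_hom (f := 𝟙 (L.X 0)) (𝟙 (L.X 0)) (L.d 0 1)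
    rfl (by simp)
  let M := K ⊞ twoTerm (𝟙 (L.X 0))
  let g : M ⟶ L := biprod.desc f r
  have hg₁ (n : ℤ) : (biprod.inl : K ⟶ M).f n ≫ g.f n = f.f n := by
    rw [← HomologicalComplex.comp_f, biprod.inl_desc]
  have hg₂ (n : ℤ) : (biprod.inr : twoTerm (𝟙 (L.X 0)) ⟶ M).f n ≫ g.f n = r.f n := by
    rw [← HomologicalComplex.comp_f, biprod.inr_desc]
  have hM (n : ℤ) (h₀ : n ≠ 0) (h₁ : n ≠ 1) : IsZero (M.X n) :=
    isZero_biprod_X n (by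
      obtain h | h : n < 0 ∨ 1 < n := by lia
      · exact K.isZero_of_isStrictlyGE 0 n h
      · exact K.isZero_of_isStrictlyLE 1 n h) (isZero_twoTerm_X _ n h₀ h₁)
  have hN (n : ℤ) (h₀ : n ≠ 0) (h₁ : n ≠ 1) : IsZero ((kernel g).X n) :=
    (hM n h₀ h₁).of_mono ((kernel.ι g).f n)
  have hg (n : ℤ) : Epi (g.f n) := by
    by_cases h₀ : n = 0
    · subst h₀
      have : Epi (r.f 0) := by
        rw [hr₀]
        infer_instance
      exact epi_of_epi_fac (hg₂ 0)
    by_cases h₁ : n = 1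
    · subst h₁
      -- In degree `1` the image of `r` consists of the boundaries, and that of `f` covers the rest
      -- because `H¹(f)` is epi.
      refine Preadditive.epi_of_cancel_zero _ (fun q hq ↦ ?_)
      refine eq_zero_of_epi_homologyMap f hf q (by rw [← hg₁, assoc, hq, comp_zero]) ?_
      rw [← cancel_epi (twoTermXOneIso (𝟙 (L.X 0))).hom, ← assoc, ← hr₁, ← hg₂, assoc, hq,
        comp_zero, comp_zero]
    · have hL : IsZero (L.X n) := by
        obtain h | h : n < 0 ∨ 1 < n := by lia
        · exact L.isZero_of_isStrictlyGE 0 n h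
        · exact L.isZero_of_isStrictlyLE 1 n h
      exact ⟨fun _ _ _ ↦ hL.eq_of_src _ _⟩
  have : Epi g := HomologicalComplex.epi_of_epi_f g hg
  refine ⟨kernel g, M, kernel.ι g, g, kernel.condition g, biprod.inl,
    { exact := ShortComplex.exact_kernel g, mono_f := inferInstance, epi_g := ‹_› }, ?_, ?_, ?_, ?_,
    isIso_Q_map_biprod_inl K (L.X 0), biprod.inl_desc f r⟩
  · rw [CochainComplex.isStrictlyGE_iff]
    exact fun n hn ↦ hN n (by lia) (by lia)
  · rw [CochainComplex.isStrictlyGE_iff]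
    exact fun n hn ↦ hM n (by lia) (by lia)
  · rw [CochainComplex.isStrictlyLE_iff]
    exact fun n hn ↦ hN n (by lia) (by lia)
  · rw [CochainComplex.isStrictlyLE_iff]
    exact fun n hn ↦ hM n (by lia) (by lia)

/-- It suffices to represent `y` by an epimorphism of two-term complexes with two-term kernel: the
fibre of `y` is then this kernel. -/
lemma comesFromSnakeLemma_of_isHomologyOfTriangle {S : SixTermExact 𝒜}
    (hS : IsHomologyOfTriangle (tBounded 𝒜) S) : S.ComesFromSnakeLemma := by
  obtain ⟨⟨X₀, Y₀, Z₀, x₀, y₀, z₀⟩, hT₀, hz, ⟨e₀⟩⟩ := hS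
  obtain ⟨X, Y, Z, x, y, z, hT, _, hY, hZ, _, hY', hZ', ⟨e₁⟩⟩ :=
    exists_distinguished_isGE_isLE (tBounded 𝒜) 𝒜 hT₀ (fun n h₀ h₁ ↦ (hz n h₀ h₁).1)
      (fun n h₀ h₁ ↦ (hz n h₀ h₁).2.1) (fun n h₀ h₁ ↦ (hz n h₀ h₁).2.2)
  have e₂ : S.arrows ≅ homologyArrows (tBounded 𝒜) 𝒜 (Triangle.mk x y z) := e₀ ≪≫ e₁
  -- The zero at the right end of `(*)` enters here, through the surjectivity of `e`.
  have hy : Epi ((heartHomology (tBounded 𝒜) 𝒜).map (y⟦(1 : ℤ)⟧')) := by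
    obtain ⟨_, _, _, _, eE, eF, _, _, _, _, h⟩ :=
      (nonempty_arrows_iso_homologyArrows_iff (tBounded 𝒜) S).1 ⟨e₂⟩
    have := S.epi_e
    have : Epi (eE.hom ≫ (heartHomology (tBounded 𝒜) 𝒜).map (y⟦(1 : ℤ)⟧')) := by
      rw [← h]
      infer_instance
    exact epi_of_epi eE.hom _
  rw [ObjectProperty.tStructure_isGE_iff] at hY hZ
  rw [ObjectProperty.tStructure_isLE_iff] at hY' hZ'
  have : Y.obj.IsGE 0 := hY
  have : Y.obj.IsLE 1 := hY'
  have : Z.obj.IsGE 0 := hZ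
  have : Z.obj.IsLE 1 := hZ'
  obtain ⟨K, _, _, ⟨eY⟩⟩ := exists_iso_Q_obj_of_isGE_of_isLE Y.obj 0 1
  obtain ⟨L₀, _, _, ⟨eZ⟩⟩ := exists_iso_Q_obj_of_isGE_of_isLE Z.obj 0 1
  -- A left fraction whose denominator `s` stays among complexes in degrees `[0, 1]`; `L` then
  -- replaces `L₀` as a model of `Z`.
  obtain ⟨L, _, _, f, s, _, hf⟩ :=
    left_fac_of_isStrictlyLE_of_isStrictlyGE 0 1 (eY.inv ≫ Bounded.ι.map y ≫ eZ.hom)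
  have bK := bounded_Q_obj K
  have bL := bounded_Q_obj L
  let a : Y ≅ toBounded K bK := Bounded.ι.preimageIso eY
  let b : Z ≅ toBounded L bL := Bounded.ι.preimageIso (eZ ≪≫ asIso (Q.map s))
  have hab : y ≫ b.hom = a.hom ≫ toBoundedMap f bK bL := by
    apply Bounded.ι.map_injective
    have h₁ : Bounded.ι.map a.hom = eY.hom := Bounded.ι.map_preimage _
    have h₂ : Bounded.ι.map b.hom = eZ.hom ≫ Q.map s := Bounded.ι.map_preimage _
    have h₃ : Bounded.ι.map y ≫ eZ.hom = eY.hom ≫ Q.map f ≫ inv (Q.map s) :=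
      (Iso.inv_comp_eq eY).1 hf
    refine (Bounded.ι.map_comp _ _).trans (Eq.trans ?_ (Bounded.ι.map_comp _ _).symm)
    refine (congrArg (Bounded.ι.map y ≫ ·) h₂).trans
      (Eq.trans ?_ (congrArg (· ≫ Q.map f) h₁.symm))
    refine (assoc _ _ _).symm.trans ((congrArg (· ≫ Q.map s) h₃).trans ?_)
    rw [assoc, assoc, IsIso.inv_hom_id, comp_id]
  have hf₁ : Epi (HomologicalComplex.homologyMap f 1) := by
    let H := shiftFunctor (Bounded 𝒜) (1 : ℤ) ⋙ heartHomology (tBounded 𝒜) 𝒜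
    have h₁ : H.map y ≫ H.map b.hom = H.map a.hom ≫ H.map (toBoundedMap f bK bL) := by
      rw [← H.map_comp, ← H.map_comp, hab]
    have h₂ : H.map (toBoundedMap f bK bL) ≫ (heartHomologyShiftToBoundedIso L bL).hom =
        (heartHomologyShiftToBoundedIso K bK).hom ≫ HomologicalComplex.homologyMap f 1 :=
      heartHomologyShiftToBoundedIso_hom_naturality f bK bL
    have : Epi (H.map y) := hy
    have : Epi (H.map a.hom ≫ H.map (toBoundedMap f bK bL)) := by
      rw [← h₁]
      infer_instance
    have : Epi (H.map (toBoundedMap f bK bL)) := epi_of_epi (H.map a.hom) _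
    have : Epi ((heartHomologyShiftToBoundedIso K bK).hom ≫
        HomologicalComplex.homologyMap f 1) := by
      rw [← h₂]
      exact epi_comp _ _
    exact epi_of_epi (heartHomologyShiftToBoundedIso K bK).hom _
  obtain ⟨N, M, j, g, w, i, hP, _, _, _, _, hi, hig⟩ := exists_shortExact_of_epi_homologyMap f hf₁
  have bN := bounded_Q_obj N
  have bM := bounded_Q_obj M
  have hi' : IsIso (toBoundedMap i bK bM) := by
    have : IsIso (Bounded.ι.map (toBoundedMap i bK bM)) := hi
    exact isIso_of_reflects_iso (toBoundedMap i bK bM) Bounded.ι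
  have hig' : toBoundedMap i bK bM ≫ toBoundedMap g bM bL = toBoundedMap f bK bL :=
    Bounded.ι.map_injective ((Q.map_comp i g).symm.trans (congrArg Q.map hig))
  have hT' := toBounded_distinguished hP bN bM bL
  obtain ⟨c, hc₁, hc₂⟩ := exists_first_morphism hT hT' (a.hom ≫ toBoundedMap i bK bM) b.hom
    (hab.trans ((congrArg (a.hom ≫ ·) hig'.symm).trans (assoc _ _ _).symm))
  -- The other two components are isomorphisms, so the kernel complex `N` is a model of `X`.
  have hc : IsIso c := by
    let φ : Triangle.mk x y z ⟶ Triangle.mk (toBoundedMap j bN bM) (toBoundedMap g bM bL)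
        (toBoundedδ hP bN bL) := Triangle.homMk _ _ c (a.hom ≫ toBoundedMap i bK bM) b.hom
          hc₁ (hab.trans ((congrArg (a.hom ≫ ·) hig'.symm).trans (assoc _ _ _).symm)) hc₂
    exact isIso₁_of_isIso₂₃ φ hT hT' (inferInstanceAs (IsIso (a.hom ≫ toBoundedMap i bK bM)))
      (inferInstanceAs (IsIso b.hom))
  obtain ⟨e₃⟩ := nonempty_homologyArrows_iso (tBounded 𝒜) 𝒜 (.of_isIso c)
    (.of_isIso (a.hom ≫ toBoundedMap i bK bM)) (.of_isIso b.hom) hc₁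
    (hab.trans ((congrArg (a.hom ≫ ·) hig'.symm).trans (assoc _ _ _).symm)) hc₂
  obtain ⟨e₄⟩ := nonempty_homologyArrows_toBounded_iso hP bN bM bL
  exact comesFromSnakeLemma_of_shortExact (P := ShortComplex.mk j g w) hP (e₂ ≪≫ e₃ ≪≫ e₄)

theorem comesFromSnakeLemma_iff_isHomologyOfTriangle (S : SixTermExact 𝒜) :
    S.ComesFromSnakeLemma ↔ IsHomologyOfTriangle (tBounded 𝒜) S :=
  ⟨isHomologyOfTriangle_of_comesFromSnakeLemma, comesFromSnakeLemma_of_isHomologyOfTriangle⟩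

end SnakeTriangle

end SnakeToda

end

theorem theorem2p1 {𝒯 : Type u'} [Category.{v'} 𝒯] [Preadditive 𝒯] [HasZeroObject 𝒯]
    [HasShift 𝒯 ℤ] [∀ n : ℤ, (shiftFunctor 𝒯 n).Additive] [Pretriangulated 𝒯]
    [IsTriangulated 𝒯] (t : TStructure 𝒯)
    {𝒜 : Type u} [Category.{v} 𝒜] [Abelian 𝒜] [t.Heart 𝒜] [HasDerivedCategory.{w} 𝒜]
    (G : DerivedCategory.Bounded 𝒜 ⥤ 𝒯) [G.CommShift ℤ] [G.IsTriangulated]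
    (ε : SnakeToda.singleBounded 𝒜 ⋙ G ≅ t.ιHeart)
    (S : SnakeToda.SixTermExact 𝒜) :
    (SnakeToda.IsHomologyOfTriangle t S ↔
      0 ∈ SnakeToda.todaBracket (S.δ ε) (S.β ε ≫ S.γ ε) (S.α ε)) ∧
    (S.ComesFromSnakeLemma ↔
      0 ∈ SnakeToda.todaBracket (S.δ (SnakeToda.idExtends 𝒜))
        (S.β (SnakeToda.idExtends 𝒜) ≫ S.γ (SnakeToda.idExtends 𝒜))
        (S.α (SnakeToda.idExtends 𝒜))) :=
  ⟨SnakeToda.isHomologyOfTriangle_iff_zero_mem_todaBracket t G ε S,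
    (SnakeToda.comesFromSnakeLemma_iff_isHomologyOfTriangle S).trans
      (SnakeToda.isHomologyOfTriangle_iff_zero_mem_todaBracket (SnakeToda.tBounded 𝒜) (𝟭 _)
        (SnakeToda.idExtends 𝒜) S)⟩
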